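/- Let $(M,g)$ be a four-dimensional smooth Lorentzian manifold of signature $(-,+,+,+)$ and let $u$ be an observer, i.e. a smooth vector field with $g(u,u)=-1$. Let $W$ be the Weyl tensor and, with $\eta$ the volume element of a (local) orientation, let $E_{ac}=W_{abcd}u^bu^d$ and $H_{ac}=(*W)_{abcd}u^bu^d$, where $(*W)_{abcd}=\frac12\eta_{ab}{}^{ef}W_{efcd}$, be its electric and magnetic parts. Put $h_{ab}=g_{ab}+u_au_b$ and $\varepsilon_{abc}=\eta_{abcd}u^d$, let $D$ be the projected covariant derivative, and for a 2-tensor $A$ let $\hat A$ be its projected trace-free symmetric part. Let $a_a=u^b\nabla_bu_a$ be the acceleration, $\sigma$ the shear (the projected trace-free symmetric part of $\nabla_a u_b$), and $\omega_a=-\frac12\varepsilon_{abc}D^bu^c$ the vorticity vector, so that $D_bu_a=\frac13\theta h_{ab}+\sigma_{ab}+\varepsilon_{abc}\omega^c$. For symmetric spatial $A$ put $(\mathrm{curl}\,A)_{ab}=\varepsilon_{cd(a}D^cA_{b)}{}^d$. Write $(A,B)=A_{ab}B^{ab}$, $\mathrm{Tr}\,A^2=A^a{}_bA^b{}_a$,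 and $Y=\widehat{D\omega}+2\,a\,\hat\otimes\,\omega$, where $a\,\hat\otimes\,\omega$ is the projected trace-free symmetric part of $a\otimes\omega$. Suppose that the Cotton tensor of $g$ vanishes and that $E=0$ on $M$. Then, at every point, $$\mathrm{Tr}(\mathrm{curl}\,\sigma)^2-3\,\mathrm{Tr}\,Y^2=2(\mathrm{curl}\,\sigma,Y),$$ and, at every point where $H\neq0$, $$0<\mathrm{Tr}\,Y^2<\mathrm{Tr}(\mathrm{curl}\,\sigma)^2 .$$ Call the spacetime purely magnetic with respect to $u$ if $E=0$ everywhere and $H$ vanishes nowhere. If $g$ is a vacuum metric (zero Ricci tensor) or, more generally, has zero Cotton tensor, and if at some point (i) $\mathrm{Tr}(\mathrm{curl}\,\sigma)^2-3\,\mathrm{Tr}\,Y^2\neq2(\mathrm{curl}\,\sigma,Y)$, or (ii) $0\ge\mathrm{Tr}\,Y^2$, or (iii) $\mathrm{Tr}\,Y^2\ge\mathrm{Tr}(\mathrm{curl}\,\sigma)^2$, then the spacetime is not purely magnetic with respect to $u$. -/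

import Mathlib

open scoped Manifold ContDiff
open Bundle

namespace GravMag

noncomputable section

/-- The model space `ℝ⁴` of spacetime coordinates. -/
abbrev E4 : Type := EuclideanSpace ℝ (Fin 4)

/-! ## Tensor calculus in a coordinate domain

Throughout this part `g : E4 → Matrix (Fin 4) (Fin 4) ℝ` is the matrix of covariant components
`g_ij` of a metric as a function of the coordinates, `u : E4 → Fin 4 → ℝ` are the contravariant
components `uⁱ` of a vector field, and tensor fields are given by their components. All tensors below
have lower (covariant) indices unless the contrary is said. -/

/-- The partial derivative `∂_i f` at `y`. -/
def pd (i : Fin 4) (f : E4 → ℝ) (y : E4) : ℝ :=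
  fderiv ℝ f y (EuclideanSpace.single i 1)

/-- The contravariant components `g^{ij}` of the metric. -/
def gInv (g : E4 → Matrix (Fin 4) (Fin 4) ℝ) (y : E4) : Matrix (Fin 4) (Fin 4) ℝ :=
  (g y)⁻¹

/-- The Christoffel symbols `Γ^k_{ij}` of the Levi-Civita connection,
`Γ^k_{ij} = ½ g^{kl} (∂_i g_{jl} + ∂_j g_{il} - ∂_l g_{ij})`. -/
def christoffel (g : E4 → Matrix (Fin 4) (Fin 4) ℝ) (k i j : Fin 4) (y : E4) : ℝ :=
  (1 / 2) * ∑ l, gInv g y k l *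
    (pd i (fun z => g z j l) y + pd j (fun z => g z i l) y - pd l (fun z => g z i j) y)

/-- The covariant derivative `∇_c A_a` of a covector field. -/
def nabla1 (g : E4 → Matrix (Fin 4) (Fin 4) ℝ) (A : E4 → Fin 4 → ℝ) (y : E4)
    (c a : Fin 4) : ℝ :=
  pd c (fun z => A z a) y - ∑ e, christoffel g e c a y * A y e

/-- The covariant derivative `∇_c A_{ab}` of a covariant 2-tensor field. -/
def nabla2 (g : E4 → Matrix (Fin 4) (Fin 4) ℝ) (A : E4 → Fin 4 → Fin 4 → ℝ) (y : E4)
    (c a b : Fin 4) : ℝ :=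
  pd c (fun z => A z a b) y
    - ∑ e, (christoffel g e c a y * A y e b + christoffel g e c b y * A y a e)

/-- The curvature components `R^a_{bcd}`. -/
def riemannUp (g : E4 → Matrix (Fin 4) (Fin 4) ℝ) (y : E4) (a b c d : Fin 4) : ℝ :=
  pd c (christoffel g a d b) y - pd d (christoffel g a c b) y
    + ∑ e, (christoffel g a c e y * christoffel g e d b y
            - christoffel g a d e y * christoffel g e c b y)

/-- The Riemann tensor `R_{abcd}`. -/
def riemann (g : E4 → Matrix (Fin 4) (Fin 4) ℝ) (y : E4) (a b c d : Fin 4) : ℝ :=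
  ∑ e, g y a e * riemannUp g y e b c d

/-- The Ricci tensor `R_{bd} = R^a_{bad}`. -/
def ricci (g : E4 → Matrix (Fin 4) (Fin 4) ℝ) (y : E4) (b d : Fin 4) : ℝ :=
  ∑ a, riemannUp g y a b a d

/-- The scalar curvature. -/
def scalarCurv (g : E4 → Matrix (Fin 4) (Fin 4) ℝ) (y : E4) : ℝ :=
  ∑ a, ∑ b, gInv g y a b * ricci g y a b

/-- The Weyl tensor `W_{abcd}` in dimension four. -/
def weyl (g : E4 → Matrix (Fin 4) (Fin 4) ℝ) (y : E4) (a b c d : Fin 4) : ℝ :=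
  riemann g y a b c d
    - (1 / 2) * (g y a c * ricci g y b d - g y a d * ricci g y b c
        + g y b d * ricci g y a c - g y b c * ricci g y a d)
    + (1 / 6) * scalarCurv g y * (g y a c * g y b d - g y a d * g y b c)

/-- The Schouten tensor `P_{ab} = ½ (R_{ab} - (R/6) g_{ab})` in dimension four. -/
def schouten (g : E4 → Matrix (Fin 4) (Fin 4) ℝ) (y : E4) (a b : Fin 4) : ℝ :=
  (1 / 2) * (ricci g y a b - (1 / 6) * scalarCurv g y * g y a b)

/-- The Cotton tensor `C_{abc} = ∇_a P_{bc} - ∇_b P_{ac}`. -/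
def cotton (g : E4 → Matrix (Fin 4) (Fin 4) ℝ) (y : E4) (a b c : Fin 4) : ℝ :=
  nabla2 g (schouten g) y a b c - nabla2 g (schouten g) y b a c

/-- The Levi-Civita symbol: `1` on even and `-1` on odd permutations of `0,1,2,3`, and `0` when an
index is repeated. -/
def leviCivita (a b c d : Fin 4) : ℝ :=
  (((1 : Matrix (Fin 4) (Fin 4) ℤ).submatrix ![a, b, c, d] id).det : ℤ)

/-- The metric volume element `η_{abcd}` of the orientation given by the coordinates. -/
def volForm (g : E4 → Matrix (Fin 4) (Fin 4) ℝ) (y : E4) (a b c d : Fin 4) : ℝ :=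
  Real.sqrt |(g y).det| * leviCivita a b c d

/-- The dual Weyl tensor `*W_{abcd} = ½ η_{ab}^{ef} W_{efcd}`. -/
def dualWeyl (g : E4 → Matrix (Fin 4) (Fin 4) ℝ) (y : E4) (a b c d : Fin 4) : ℝ :=
  (1 / 2) * ∑ m, ∑ n, ∑ e, ∑ f,
    volForm g y a b m n * gInv g y m e * gInv g y n f * weyl g y e f c d

/-- The electric Weyl field `E_{ac} = W_{abcd} u^b u^d`. -/
def electricWeyl (g : E4 → Matrix (Fin 4) (Fin 4) ℝ) (u : E4 → Fin 4 → ℝ) (y : E4)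
    (a c : Fin 4) : ℝ :=
  ∑ b, ∑ d, weyl g y a b c d * u y b * u y d

/-- The magnetic Weyl field `H_{ac} = *W_{abcd} u^b u^d`. -/
def magneticWeyl (g : E4 → Matrix (Fin 4) (Fin 4) ℝ) (u : E4 → Fin 4 → ℝ) (y : E4)
    (a c : Fin 4) : ℝ :=
  ∑ b, ∑ d, dualWeyl g y a b c d * u y b * u y d

/-! ### The 1+3 formalism relative to `u` -/

/-- The covariant components `u_a = g_{ab} u^b`. -/
def lowerU (g : E4 → Matrix (Fin 4) (Fin 4) ℝ) (u : E4 → Fin 4 → ℝ) (y : E4)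
    (a : Fin 4) : ℝ :=
  ∑ b, g y a b * u y b

/-- The spatial metric `h_{ab} = g_{ab} + u_a u_b`. -/
def spatialMetric (g : E4 → Matrix (Fin 4) (Fin 4) ℝ) (u : E4 → Fin 4 → ℝ) (y : E4)
    (a b : Fin 4) : ℝ :=
  g y a b + lowerU g u y a * lowerU g u y b

/-- The projector `h^a_b = δ^a_b + u^a u_b` (upper index first). -/
def proj (g : E4 → Matrix (Fin 4) (Fin 4) ℝ) (u : E4 → Fin 4 → ℝ) (y : E4)
    (a b : Fin 4) : ℝ :=
  (if a = b then 1 else 0) + u y a * lowerU g u y b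

/-- The spatial volume element `ε_{abc} = η_{abcd} u^d`. -/
def spatialEps (g : E4 → Matrix (Fin 4) (Fin 4) ℝ) (u : E4 → Fin 4 → ℝ) (y : E4)
    (a b c : Fin 4) : ℝ :=
  ∑ d, volForm g y a b c d * u y d

/-- The covariant spatial derivative `D_c A_a` of a covector field (the totally projected covariant
derivative). -/
def spatialD1 (g : E4 → Matrix (Fin 4) (Fin 4) ℝ) (u : E4 → Fin 4 → ℝ)
    (A : E4 → Fin 4 → ℝ) (y : E4) (c a : Fin 4) : ℝ :=
  ∑ e, ∑ f, proj g u y e c * proj g u y f a * nabla1 g A y e f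

/-- The covariant spatial derivative `D_c A_{ab}` of a 2-tensor field. -/
def spatialD2 (g : E4 → Matrix (Fin 4) (Fin 4) ℝ) (u : E4 → Fin 4 → ℝ)
    (A : E4 → Fin 4 → Fin 4 → ℝ) (y : E4) (c a b : Fin 4) : ℝ :=
  ∑ e, ∑ f, ∑ k, proj g u y e c * proj g u y f a * proj g u y k b * nabla2 g A y e f k

/-- The projected trace-free symmetric part `Â_{ab}` of a 2-tensor,
`(h_{(a}^c h_{b)}^d - ⅓ h_{ab} h^{cd}) A_{cd}`. -/
def hat (g : E4 → Matrix (Fin 4) (Fin 4) ℝ) (u : E4 → Fin 4 → ℝ)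
    (A : E4 → Fin 4 → Fin 4 → ℝ) (y : E4) (a b : Fin 4) : ℝ :=
  ∑ c, ∑ d, ((1 / 2) * (proj g u y c a * proj g u y d b + proj g u y c b * proj g u y d a)
    - (1 / 3) * spatialMetric g u y a b * (gInv g y c d + u y c * u y d)) * A y c d

/-- The curl of a symmetric spatial 2-tensor, `(curl A)_{ab} = ε_{cd(a} D^c A_{b)}^d`. -/
def curl (g : E4 → Matrix (Fin 4) (Fin 4) ℝ) (u : E4 → Fin 4 → ℝ)
    (A : E4 → Fin 4 → Fin 4 → ℝ) (y : E4) (a b : Fin 4) : ℝ :=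
  (1 / 2) * ∑ c, ∑ d, ∑ e, ∑ f, gInv g y c e * gInv g y d f *
    (spatialEps g u y c d a * spatialD2 g u A y e b f
      + spatialEps g u y c d b * spatialD2 g u A y e a f)

/-- The acceleration `a_a = u^b ∇_b u_a`. -/
def accel (g : E4 → Matrix (Fin 4) (Fin 4) ℝ) (u : E4 → Fin 4 → ℝ) (y : E4)
    (a : Fin 4) : ℝ :=
  ∑ b, u y b * nabla1 g (lowerU g u) y b a

/-- The shear `σ_{ab}`: the projected trace-free symmetric part of `∇_a u_b`. -/
def shear (g : E4 → Matrix (Fin 4) (Fin 4) ℝ) (u : E4 → Fin 4 → ℝ) (y : E4)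
    (a b : Fin 4) : ℝ :=
  hat g u (nabla1 g (lowerU g u)) y a b

/-- The vorticity vector `ω_a = -½ ε_{abc} D^b u^c`, so that
`D_b u_a = ⅓ θ h_{ab} + σ_{ab} + ε_{abc} ω^c`. -/
def vorticity (g : E4 → Matrix (Fin 4) (Fin 4) ℝ) (u : E4 → Fin 4 → ℝ) (y : E4)
    (a : Fin 4) : ℝ :=
  -(1 / 2) * ∑ b, ∑ c, ∑ e, ∑ f, spatialEps g u y a b c * gInv g y b e * gInv g y c f *
    spatialD1 g u (lowerU g u) y e f

/-- The tensor `curl σ`. -/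
def curlShear (g : E4 → Matrix (Fin 4) (Fin 4) ℝ) (u : E4 → Fin 4 → ℝ) :
    E4 → Fin 4 → Fin 4 → ℝ :=
  curl g u (shear g u)

/-- The projected trace-free symmetric tensor obtained from `Dω + 2 a ⊗ ω`. -/
def vortTensor (g : E4 → Matrix (Fin 4) (Fin 4) ℝ) (u : E4 → Fin 4 → ℝ) (y : E4)
    (a b : Fin 4) : ℝ :=
  hat g u (spatialD1 g u (vorticity g u)) y a b
    + 2 * hat g u (fun z c d => accel g u z c * vorticity g u z d) y a b

/-- The product `(A, B) = A_{ab} B^{ab}`. -/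
def tInner (g : E4 → Matrix (Fin 4) (Fin 4) ℝ) (A B : E4 → Fin 4 → Fin 4 → ℝ) (y : E4) : ℝ :=
  ∑ a, ∑ b, ∑ c, ∑ d, gInv g y a c * gInv g y b d * A y a b * B y c d

/-- The trace `Tr A² = A^a_b A^b_a`. -/
def trSq (g : E4 → Matrix (Fin 4) (Fin 4) ℝ) (A : E4 → Fin 4 → Fin 4 → ℝ) (y : E4) : ℝ :=
  ∑ a, ∑ b, ∑ c, ∑ d, gInv g y a c * A y c b * gInv g y b d * A y d a

/-! ## Spacetimes and observers -/

section Manifold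

attribute [local instance] chartedSpaceSelf

variable {M : Type*} [TopologicalSpace M] [ChartedSpace E4 M] [IsManifold 𝓘(ℝ, E4) ∞ M]

variable (M) in
/-- A smooth Lorentzian metric of signature `(-,+,+,+)` on a 4-manifold. -/
structure LorentzMetric where
  /-- The scalar product on each tangent space. -/
  val (x : M) : TangentSpace 𝓘(ℝ, E4) x →L[ℝ] TangentSpace 𝓘(ℝ, E4) x →L[ℝ] ℝ
  symm (x : M) (v w : TangentSpace 𝓘(ℝ, E4) x) : val x v w = val x w v
  signature (x : M) : ∃ b : Module.Basis (Fin 4) ℝ (TangentSpace 𝓘(ℝ, E4) x),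
    ∀ i j, val x (b i) (b j) = Matrix.diagonal ![(-1 : ℝ), 1, 1, 1] i j
  contMDiff : ContMDiff 𝓘(ℝ, E4) (𝓘(ℝ, E4).prod 𝓘(ℝ, E4 →L[ℝ] E4 →L[ℝ] ℝ)) ∞
    (fun x => TotalSpace.mk' (E4 →L[ℝ] E4 →L[ℝ] ℝ)
      (E := fun x : M => TangentSpace 𝓘(ℝ, E4) x →L[ℝ] TangentSpace 𝓘(ℝ, E4) x →L[ℝ] ℝ)
      x (val x))

/-- An observer: a smooth vector field `u` with `g(u, u) = -1`. -/
structure Observer (g : LorentzMetric M) where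
  /-- The 4-velocity. -/
  vel (x : M) : TangentSpace 𝓘(ℝ, E4) x
  unit (x : M) : g.val x (vel x) (vel x) = -1
  contMDiff : ContMDiff 𝓘(ℝ, E4) 𝓘(ℝ, E4).tangent ∞
    (fun x => (⟨x, vel x⟩ : TangentBundle 𝓘(ℝ, E4) M))

variable (M) in
/-- The smooth charts of `M`. -/
def charts : Set (OpenPartialHomeomorph M E4) :=
  IsManifold.maximalAtlas 𝓘(ℝ, E4) ∞ M

/-- The components `g_{ij} = g(∂_i, ∂_j)` of the metric in the chart `e`, at the coordinates `y`. -/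
def LorentzMetric.comp (g : LorentzMetric M) (e : OpenPartialHomeomorph M E4) (y : E4) :
    Matrix (Fin 4) (Fin 4) ℝ :=
  Matrix.of fun i j => g.val (e.symm y)
    (mfderiv 𝓘(ℝ, E4) 𝓘(ℝ, E4) e.symm y (EuclideanSpace.single i (1 : ℝ) : E4))
    (mfderiv 𝓘(ℝ, E4) 𝓘(ℝ, E4) e.symm y (EuclideanSpace.single j (1 : ℝ) : E4))

/-- The components `u^i = dx^i(u)` of the observer in the chart `e`, at the coordinates `y`. -/
def Observer.comp {g : LorentzMetric M} (u : Observer g) (e : OpenPartialHomeomorph M E4) (y : E4)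
    (i : Fin 4) : ℝ :=
  (show E4 from mfderiv 𝓘(ℝ, E4) 𝓘(ℝ, E4) e (e.symm y) (u.vel (e.symm y))) i

/-- The Ricci tensor vanishes. -/
def IsVacuum (g : LorentzMetric M) : Prop :=
  ∀ e ∈ charts M, ∀ y ∈ e.target, ∀ a b, ricci (g.comp e) y a b = 0

/-- The Cotton tensor vanishes. -/
def IsCottonZero (g : LorentzMetric M) : Prop :=
  ∀ e ∈ charts M, ∀ y ∈ e.target, ∀ a b c, cotton (g.comp e) y a b c = 0

/-- The electric Weyl field relative to `u` vanishes everywhere. -/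
def ElectricVanishes {g : LorentzMetric M} (u : Observer g) : Prop :=
  ∀ e ∈ charts M, ∀ y ∈ e.target, ∀ a b, electricWeyl (g.comp e) (u.comp e) y a b = 0

/-- The magnetic Weyl field relative to `u` does not vanish at the point `x`. -/
def MagneticNonzeroAt {g : LorentzMetric M} (u : Observer g) (x : M) : Prop :=
  ∀ e ∈ charts M, x ∈ e.source → ∃ a b, magneticWeyl (g.comp e) (u.comp e) (e x) a b ≠ 0

/-- The spacetime is purely magnetic with respect to `u`: `E = 0` and `H` has no zeros. -/
def IsPurelyMagnetic {g : LorentzMetric M} (u : Observer g) : Prop :=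
  ElectricVanishes u ∧ ∀ x, MagneticNonzeroAt u x

/-! The following scalars are evaluated at the point `x`, with the volume element of the orientation
of the chart `e`. Reversing the orientation changes the sign of `ω`, of `curl σ` and of `H`, hence it
changes none of the three scalars, nor the conditions on `E` and `H` above; they agree with those of
a given orientation of `M`. -/

/-- The scalar `Tr (curl σ)²` at `x`, computed in the chart `e`. -/
def Observer.trCurlShearSq {g : LorentzMetric M} (u : Observer g)
    (e : OpenPartialHomeomorph M E4) (x : M) : ℝ :=
  trSq (g.comp e) (curlShear (g.comp e) (u.comp e)) (e x)

/-- The scalar `Tr (Dω^ + 2 a ⊗^ ω)²` at `x`, computed in the chart `e`. -/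
def Observer.trVortSq {g : LorentzMetric M} (u : Observer g)
    (e : OpenPartialHomeomorph M E4) (x : M) : ℝ :=
  trSq (g.comp e) (vortTensor (g.comp e) (u.comp e)) (e x)

/-- The scalar `(curl σ, Dω^ + 2 a ⊗^ ω)` at `x`, computed in the chart `e`. -/
def Observer.curlShearVort {g : LorentzMetric M} (u : Observer g)
    (e : OpenPartialHomeomorph M E4) (x : M) : ℝ :=
  tInner (g.comp e) (curlShear (g.comp e) (u.comp e)) (vortTensor (g.comp e) (u.comp e)) (e x)

end Manifold

end

end GravMag

/-! Write S for curl σ, Y for the trace-free vorticity tensor and |A|² for (A, A). The theorem rests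
on two pointwise relations between S, Y and H.

The first, H = S + Y (`PointData.magnetic_constraint`), is the Ricci identity for u, with the
curvature split into Weyl and Schouten parts. The Schouten part contributes only antisymmetric
terms, which symmetrisation removes, so this relation holds for every observer.

The second, (H, S - 3Y) = 0 (`PointData.magnetic_orthogonal`), uses both hypotheses. When the Cotton
tensor vanishes, the Weyl tensor satisfies the second Bianchi identity (`bianchi_weyl`), and being
trace-free it is divergence-free (`div_frWeyl`). Hence the divergence of W_{abcd} u^b u^d = 0
involves no derivative of W: it is an algebraic relation between W, u and ∇u
(`divElectric_eq_zero`). Its divergence again loses the derivatives of W (`div_divElectric`) and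
leaves W contracted with u ⊗ ∇∇u and ∇u ⊗ ∇u. When E = 0 every component of W is zero or, up to
sign, a component of H, and this contraction turns out to be (H, S - 3Y).

Together (S + Y, S - 3Y) = 0, which is the asserted equality. Putting S = H - Y instead gives |H|² =
4 (H, Y). Since H and Y are spatial and symmetric, these are Euclidean products: if H ≠ 0, then (H,
Y) > 0 forces Y ≠ 0, and |S|² - |Y|² = |H|² - 2 (H, Y) = |H|²/2 > 0. The non-existence statement is
the contrapositive.

Covariant identities are handled through a frame field (`AdaptedAt`) that at the base point y is
orthonormal, has u as its timelike leg, and has vanishing covariant derivative. At y, ordinary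
directional derivatives of frame components are then frame components of covariant derivatives. The
frame need not be orthonormal near y, but its metric coefficients have zero first derivatives at y,
so identities valid near y can be differentiated once. What remains is finite algebra in components,
recorded in `PointData`. -/

namespace GravMag

noncomputable section

open Filter Topology Matrix

/-! ### Partial derivatives -/

/-- Smoothness at a point. -/
abbrev Sm (f : E4 → ℝ) (y : E4) : Prop := ContDiffAt ℝ ∞ f y

theorem Sm.diff {f : E4 → ℝ} {y : E4} (h : Sm f y) : DifferentiableAt ℝ f y :=
  h.differentiableAt (by simp)

theorem sm_const (c : ℝ) (y : E4) : Sm (fun _ => c) y := contDiffAt_const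

theorem sm_coord (c : Fin 4) (y : E4) : Sm (fun z : E4 => z c) y :=
  (EuclideanSpace.proj (𝕜 := ℝ) c : E4 →L[ℝ] ℝ).contDiff.contDiffAt

theorem Sm.add {f h : E4 → ℝ} {y : E4} (hf : Sm f y) (hh : Sm h y) : Sm (fun z => f z + h z) y :=
  ContDiffAt.add hf hh

theorem Sm.sub {f h : E4 → ℝ} {y : E4} (hf : Sm f y) (hh : Sm h y) : Sm (fun z => f z - h z) y :=
  ContDiffAt.sub hf hh

theorem Sm.neg {f : E4 → ℝ} {y : E4} (hf : Sm f y) : Sm (fun z => -f z) y :=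
  ContDiffAt.neg hf

theorem Sm.mul {f h : E4 → ℝ} {y : E4} (hf : Sm f y) (hh : Sm h y) : Sm (fun z => f z * h z) y :=
  ContDiffAt.mul hf hh

theorem Sm.sum {ι : Type*} {s : Finset ι} {f : ι → E4 → ℝ} {y : E4} (hf : ∀ i, Sm (f i) y) :
    Sm (fun z => ∑ i ∈ s, f i z) y :=
  ContDiffAt.sum fun i _ => hf i

theorem Sm.congr {f h : E4 → ℝ} {y : E4} (hf : Sm f y) (e : h =ᶠ[𝓝 y] f) : Sm h y :=
  ContDiffAt.congr_of_eventuallyEq hf e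

theorem Sm.pd {f : E4 → ℝ} {y : E4} (hf : Sm f y) (c : Fin 4) : Sm (pd c f) y := by
  have h : ContDiffAt ℝ ∞ (fderiv ℝ f) y := hf.fderiv_right (by simp)
  exact h.clm_apply contDiffAt_const

theorem pd_congr {f h : E4 → ℝ} {y : E4} (e : f =ᶠ[𝓝 y] h) (c : Fin 4) : pd c f y = pd c h y := by
  unfold pd; rw [e.fderiv_eq]

theorem pd_congr' {f h : E4 → ℝ} {y : E4} (e : ∀ᶠ z in 𝓝 y, f z = h z) (c : Fin 4) :
    pd c f y = pd c h y := pd_congr e c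

@[simp] theorem pd_const (c : Fin 4) (r : ℝ) (y : E4) : pd c (fun _ => r) y = 0 := by
  simp [pd]

theorem pd_add {f h : E4 → ℝ} {y : E4} (hf : Sm f y) (hh : Sm h y) (c : Fin 4) :
    pd c (fun z => f z + h z) y = pd c f y + pd c h y := by
  simp [pd, fderiv_fun_add hf.diff hh.diff]

theorem pd_sub {f h : E4 → ℝ} {y : E4} (hf : Sm f y) (hh : Sm h y) (c : Fin 4) :
    pd c (fun z => f z - h z) y = pd c f y - pd c h y := by
  simp [pd, fderiv_fun_sub hf.diff hh.diff]

theorem pd_neg {f : E4 → ℝ} {y : E4} (c : Fin 4) :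
    pd c (fun z => -f z) y = -pd c f y := by
  simp [pd, fderiv_fun_neg]

theorem pd_mul {f h : E4 → ℝ} {y : E4} (hf : Sm f y) (hh : Sm h y) (c : Fin 4) :
    pd c (fun z => f z * h z) y = pd c f y * h y + f y * pd c h y := by
  simp [pd, fderiv_fun_mul hf.diff hh.diff]; ring

theorem pd_const_mul {f : E4 → ℝ} {y : E4} (hf : Sm f y) (r : ℝ) (c : Fin 4) :
    pd c (fun z => r * f z) y = r * pd c f y := by
  rw [pd_mul (sm_const r y) hf]; simp

theorem pd_mul_const {f : E4 → ℝ} {y : E4} (hf : Sm f y) (r : ℝ) (c : Fin 4) :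
    pd c (fun z => f z * r) y = pd c f y * r := by
  rw [pd_mul hf (sm_const r y)]; simp

theorem pd_sum {ι : Type*} {s : Finset ι} {f : ι → E4 → ℝ} {y : E4} (hf : ∀ i, Sm (f i) y)
    (c : Fin 4) : pd c (fun z => ∑ i ∈ s, f i z) y = ∑ i ∈ s, pd c (f i) y := by
  simp only [pd]
  rw [fderiv_fun_sum fun i _ => (hf i).diff]
  simp

theorem pd_coord (c i : Fin 4) (y : E4) :
    pd c (fun z : E4 => z i) y = if c = i then 1 else 0 := by
  have : HasFDerivAt (fun z : E4 => z i) (EuclideanSpace.proj (𝕜 := ℝ) i : E4 →L[ℝ] ℝ) y :=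
    (EuclideanSpace.proj (𝕜 := ℝ) i : E4 →L[ℝ] ℝ).hasFDerivAt
  simp [pd, this.fderiv, eq_comm]

theorem pd_comm {f : E4 → ℝ} {y : E4} (hf : Sm f y) (c d : Fin 4) :
    pd c (pd d f) y = pd d (pd c f) y := by
  have h : ContDiffAt ℝ ∞ (fderiv ℝ f) y := hf.fderiv_right (by simp)
  have hd : DifferentiableAt ℝ (fderiv ℝ f) y := h.differentiableAt (by simp)
  -- Both orders of differentiation become values of the second Fréchet derivative, which is
  -- symmetric.
  have key : ∀ c d, pd c (pd d f) y = fderiv ℝ (fderiv ℝ f) y (EuclideanSpace.single c 1)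
      (EuclideanSpace.single d 1) := by
    intro c d
    unfold pd
    rw [fderiv_clm_apply hd (by fun_prop)]
    simp
  rw [key, key]
  have := hf.isSymmSndFDerivAt (by simpa using (WithTop.coe_le_coe.2 (le_top : (2 : ℕ∞) ≤ ⊤)))
  exact this _ _

/-! ### Matrix-valued functions -/

/-- Entrywise smoothness of a matrix-valued function at a point. -/
def SmM (F : E4 → Matrix (Fin 4) (Fin 4) ℝ) (y : E4) : Prop := ∀ i j, Sm (fun z => F z i j) y

/-- The entrywise partial derivative of a matrix-valued function. -/
def pdM (c : Fin 4) (F : E4 → Matrix (Fin 4) (Fin 4) ℝ) (y : E4) : Matrix (Fin 4) (Fin 4) ℝ :=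
  Matrix.of fun i j => pd c (fun z => F z i j) y

theorem pdM_apply (c : Fin 4) (F : E4 → Matrix (Fin 4) (Fin 4) ℝ) (y : E4) (i j : Fin 4) :
    pdM c F y i j = pd c (fun z => F z i j) y := rfl

theorem SmM.add {F H : E4 → Matrix (Fin 4) (Fin 4) ℝ} {y : E4} (hF : SmM F y) (hH : SmM H y) :
    SmM (fun z => F z + H z) y := fun i j => (hF i j).add (hH i j)

theorem SmM.sub {F H : E4 → Matrix (Fin 4) (Fin 4) ℝ} {y : E4} (hF : SmM F y) (hH : SmM H y) :
    SmM (fun z => F z - H z) y := fun i j => (hF i j).sub (hH i j)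

theorem SmM.transpose {F : E4 → Matrix (Fin 4) (Fin 4) ℝ} {y : E4} (hF : SmM F y) :
    SmM (fun z => (F z)ᵀ) y := fun i j => hF j i

theorem SmM.mul {F H : E4 → Matrix (Fin 4) (Fin 4) ℝ} {y : E4} (hF : SmM F y) (hH : SmM H y) :
    SmM (fun z => F z * H z) y := by
  intro i j
  simp only [Matrix.mul_apply]
  exact Sm.sum fun k => (hF i k).mul (hH k j)

theorem SmM.pdM {F : E4 → Matrix (Fin 4) (Fin 4) ℝ} {y : E4} (hF : SmM F y) (c : Fin 4) :
    SmM (pdM c F) y := fun i j => (hF i j).pd c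

theorem pdM_congr {F H : E4 → Matrix (Fin 4) (Fin 4) ℝ} {y : E4} (e : ∀ᶠ z in 𝓝 y, F z = H z)
    (c : Fin 4) : pdM c F y = pdM c H y := by
  ext i j
  exact pd_congr (e.mono fun z hz => by simp [hz]) c

theorem pdM_const (c : Fin 4) (F : Matrix (Fin 4) (Fin 4) ℝ) (y : E4) :
    pdM c (fun _ => F) y = 0 := by
  ext i j; simp [pdM]

theorem pdM_add {F H : E4 → Matrix (Fin 4) (Fin 4) ℝ} {y : E4} (hF : SmM F y) (hH : SmM H y)
    (c : Fin 4) : pdM c (fun z => F z + H z) y = pdM c F y + pdM c H y := by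
  ext i j; exact pd_add (hF i j) (hH i j) c

theorem pdM_sub {F H : E4 → Matrix (Fin 4) (Fin 4) ℝ} {y : E4} (hF : SmM F y) (hH : SmM H y)
    (c : Fin 4) : pdM c (fun z => F z - H z) y = pdM c F y - pdM c H y := by
  ext i j; exact pd_sub (hF i j) (hH i j) c

theorem pdM_transpose (F : E4 → Matrix (Fin 4) (Fin 4) ℝ) (y : E4) (c : Fin 4) :
    pdM c (fun z => (F z)ᵀ) y = (pdM c F y)ᵀ := rfl

theorem pdM_mul {F H : E4 → Matrix (Fin 4) (Fin 4) ℝ} {y : E4} (hF : SmM F y) (hH : SmM H y)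
    (c : Fin 4) : pdM c (fun z => F z * H z) y = pdM c F y * H y + F y * pdM c H y := by
  ext i j
  simp only [pdM_apply, Matrix.mul_apply, Matrix.add_apply]
  rw [pd_sum fun k => (hF i k).mul (hH k j), ← Finset.sum_add_distrib]
  exact Finset.sum_congr rfl fun k _ => pd_mul (hF i k) (hH k j) c

theorem pdM_comm {F : E4 → Matrix (Fin 4) (Fin 4) ℝ} {y : E4} (hF : SmM F y) (c d : Fin 4) :
    pdM c (pdM d F) y = pdM d (pdM c F) y := by
  ext i j; exact pd_comm (hF i j) c d

theorem SmM.det {F : E4 → Matrix (Fin 4) (Fin 4) ℝ} {y : E4} (hF : SmM F y) :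
    Sm (fun z => (F z).det) y := by
  simp only [Matrix.det_apply']
  refine Sm.sum fun σ => ?_
  have : Sm (fun z => ∏ i, F z (σ i) i) y := contDiffAt_prod fun i _ => hF _ _
  exact (sm_const _ y).mul this

/-- Cramer's rule: the entries of the inverse are cofactors, polynomial in the entries, divided by
the determinant. -/
theorem SmM.inv {F : E4 → Matrix (Fin 4) (Fin 4) ℝ} {y : E4} (hF : SmM F y)
    (h0 : (F y).det ≠ 0) : SmM (fun z => (F z)⁻¹) y := by
  intro i j
  have h1 : Sm (fun z => ((F z).det)⁻¹) y := hF.det.inv h0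
  have h2 : Sm (fun z => (F z).adjugate i j) y := by
    simp only [Matrix.adjugate_apply]
    refine SmM.det fun k l => ?_
    by_cases hk : k = j
    · subst hk; simpa using sm_const _ y
    · simpa [Matrix.updateRow_ne hk] using hF k l
  have := h1.mul h2
  simpa [Matrix.inv_def] using this

theorem SmM.inv_eventually {F : E4 → Matrix (Fin 4) (Fin 4) ℝ} {y : E4} (hF : SmM F y)
    (h0 : (F y).det ≠ 0) : ∀ᶠ z in 𝓝 y, (F z).det ≠ 0 :=
  hF.det.continuousAt.eventually_ne h0

end

noncomputable section

open Filter Topology Matrix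

/-! ### The Levi-Civita connection of a metric in coordinates -/

/-- Near `y`, the matrix-valued function `g` is smooth, symmetric and nondegenerate. -/
structure MetricAt (g : E4 → Matrix (Fin 4) (Fin 4) ℝ) (y : E4) : Prop where
  sm : SmM g y
  symm : ∀ᶠ z in 𝓝 y, (g z)ᵀ = g z
  det : (g y).det ≠ 0

variable {g : E4 → Matrix (Fin 4) (Fin 4) ℝ} {y : E4}

theorem MetricAt.symm_at (hg : MetricAt g y) (i j : Fin 4) : g y i j = g y j i :=
  congrFun (congrFun hg.symm.self_of_nhds j) i

theorem MetricAt.pd_symm (hg : MetricAt g y) (c i j : Fin 4) :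
    pd c (fun z => g z i j) y = pd c (fun z => g z j i) y :=
  pd_congr (hg.symm.mono fun _ hz => congrFun (congrFun hz j) i) c

theorem MetricAt.inv_mul (hg : MetricAt g y) : gInv g y * g y = 1 :=
  Matrix.nonsing_inv_mul _ (isUnit_iff_ne_zero.2 hg.det)

theorem MetricAt.mul_inv (hg : MetricAt g y) : g y * gInv g y = 1 :=
  Matrix.mul_nonsing_inv _ (isUnit_iff_ne_zero.2 hg.det)

theorem MetricAt.inv_symm (hg : MetricAt g y) : (gInv g y)ᵀ = gInv g y := by
  rw [gInv, Matrix.transpose_nonsing_inv, hg.symm.self_of_nhds]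

theorem MetricAt.inv_symm_at (hg : MetricAt g y) (i j : Fin 4) : gInv g y i j = gInv g y j i :=
  congrFun (congrFun hg.inv_symm j) i

theorem MetricAt.sm_inv (hg : MetricAt g y) : SmM (gInv g) y := hg.sm.inv hg.det

theorem MetricAt.sm_christoffel (hg : MetricAt g y) (k i j : Fin 4) : Sm (christoffel g k i j) y :=
  (sm_const _ y).mul (Sm.sum fun l => (hg.sm_inv k l).mul
    ((((hg.sm j l).pd i).add ((hg.sm i l).pd j)).sub ((hg.sm i j).pd l)))

theorem MetricAt.christoffel_symm (hg : MetricAt g y) (k i j : Fin 4) :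
    christoffel g k i j y = christoffel g k j i y := by
  unfold christoffel
  congr 1
  refine Finset.sum_congr rfl fun l _ => ?_
  rw [hg.pd_symm l i j]; ring

/-- The matrix `(Γ_c)^a_b = Γ^a_{cb}` of the connection form in the direction `c`. -/
def conn (g : E4 → Matrix (Fin 4) (Fin 4) ℝ) (c : Fin 4) (z : E4) : Matrix (Fin 4) (Fin 4) ℝ :=
  Matrix.of fun a b => christoffel g a c b z

theorem conn_apply (g : E4 → Matrix (Fin 4) (Fin 4) ℝ) (c : Fin 4) (z : E4) (a b : Fin 4) :
    conn g c z a b = christoffel g a c b z := rfl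

theorem MetricAt.sm_conn (hg : MetricAt g y) (c : Fin 4) : SmM (conn g c) y :=
  fun a b => hg.sm_christoffel a c b

/-- Lowering the index removes the inverse metric, so metric compatibility becomes a linear identity
between first derivatives of g. -/
theorem MetricAt.lower_christoffel (hg : MetricAt g y) (k i j : Fin 4) :
    ∑ e, g y k e * christoffel g e i j y = (1 / 2) *
      (pd i (fun z => g z j k) y + pd j (fun z => g z i k) y - pd k (fun z => g z i j) y) := by
  have h : ∀ l, ∑ e, g y k e * gInv g y e l = if k = l then 1 else 0 := fun l => by
    have := congrFun (congrFun hg.mul_inv k) l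
    rwa [Matrix.mul_apply, Matrix.one_apply] at this
  calc ∑ e, g y k e * christoffel g e i j y
      = ∑ l, (∑ e, g y k e * gInv g y e l) * ((1 / 2) *
        (pd i (fun z => g z j l) y + pd j (fun z => g z i l) y - pd l (fun z => g z i j) y)) := by
        simp only [christoffel, Finset.mul_sum, Finset.sum_mul]
        rw [Finset.sum_comm]
        exact Finset.sum_congr rfl fun _ _ => Finset.sum_congr rfl fun _ _ => by ring
    _ = _ := by simp [h]

/-- Metric compatibility of the Levi-Civita connection. -/
theorem MetricAt.pdM_metric (hg : MetricAt g y) (c : Fin 4) :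
    pdM c g y = (conn g c y)ᵀ * g y + g y * conn g c y := by
  ext a b
  have h1 := hg.lower_christoffel b c a
  have h2 := hg.lower_christoffel a c b
  simp only [pdM_apply, Matrix.add_apply, Matrix.mul_apply, Matrix.transpose_apply, conn_apply]
  have h3 : ∑ e, christoffel g e c a y * g y e b = ∑ e, g y b e * christoffel g e c a y :=
    Finset.sum_congr rfl fun e _ => by rw [hg.symm_at e b]; ring
  rw [h3, h1, h2, hg.pd_symm c b a, hg.pd_symm a c b]
  ring

/-! ### Curvature -/

/-- The curvature matrix `(R_{cd})^a_b = R^a_{bcd}`. -/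
def curvM (g : E4 → Matrix (Fin 4) (Fin 4) ℝ) (c d : Fin 4) (z : E4) :
    Matrix (Fin 4) (Fin 4) ℝ :=
  Matrix.of fun a b => riemannUp g z a b c d

theorem curvM_apply (g : E4 → Matrix (Fin 4) (Fin 4) ℝ) (c d : Fin 4) (z : E4) (a b : Fin 4) :
    curvM g c d z a b = riemannUp g z a b c d := rfl

theorem curvM_eq (g : E4 → Matrix (Fin 4) (Fin 4) ℝ) (c d : Fin 4) (z : E4) :
    curvM g c d z = pdM c (conn g d) z - pdM d (conn g c) z
      + (conn g c z * conn g d z - conn g d z * conn g c z) := by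
  ext a b
  simp only [curvM_apply, riemannUp, Matrix.add_apply, Matrix.sub_apply, Matrix.mul_apply,
    Finset.sum_sub_distrib]
  rfl

theorem MetricAt.sm_curvM (hg : MetricAt g y) (c d : Fin 4) : SmM (curvM g c d) y := by
  have h : curvM g c d = fun z => pdM c (conn g d) z - pdM d (conn g c) z
      + (conn g c z * conn g d z - conn g d z * conn g c z) := funext fun z => curvM_eq g c d z
  rw [h]
  exact (((hg.sm_conn d).pdM c).sub ((hg.sm_conn c).pdM d)).add
    (((hg.sm_conn c).mul (hg.sm_conn d)).sub ((hg.sm_conn d).mul (hg.sm_conn c)))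

theorem curvM_antisymm (g : E4 → Matrix (Fin 4) (Fin 4) ℝ) (c d : Fin 4) (z : E4) :
    curvM g c d z = -curvM g d c z := by
  rw [curvM_eq, curvM_eq]; abel

/-- The second Bianchi identity, in terms of the curvature matrices. -/
theorem MetricAt.bianchi_curvM (hg : MetricAt g y) (e c d : Fin 4) :
    (pdM e (curvM g c d) y + conn g e y * curvM g c d y - curvM g c d y * conn g e y)
      + (pdM c (curvM g d e) y + conn g c y * curvM g d e y - curvM g d e y * conn g c y)
      + (pdM d (curvM g e c) y + conn g d y * curvM g e c y - curvM g e c y * conn g d y) = 0 := by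
  have key : ∀ e c d, pdM e (curvM g c d) y = pdM e (pdM c (conn g d)) y - pdM e (pdM d (conn g c)) y
      + (pdM e (conn g c) y * conn g d y + conn g c y * pdM e (conn g d) y
        - (pdM e (conn g d) y * conn g c y + conn g d y * pdM e (conn g c) y)) := by
    intro e c d
    have h : curvM g c d = fun z => pdM c (conn g d) z - pdM d (conn g c) z
        + (conn g c z * conn g d z - conn g d z * conn g c z) := funext fun z => curvM_eq g c d z
    have s1 := (hg.sm_conn d).pdM c
    have s2 := (hg.sm_conn c).pdM d
    have s3 := (hg.sm_conn c).mul (hg.sm_conn d)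
    have s4 := (hg.sm_conn d).mul (hg.sm_conn c)
    rw [h, pdM_add (s1.sub s2) (s3.sub s4), pdM_sub s1 s2, pdM_sub s3 s4,
      pdM_mul (hg.sm_conn c) (hg.sm_conn d), pdM_mul (hg.sm_conn d) (hg.sm_conn c)]
  -- For the curvature F = dΓ + Γ∧Γ, the second derivatives of Γ cancel in pairs by symmetry. What
  -- is left is an identity of noncommutative polynomials in Γ and its first derivatives.
  rw [key, key, key, pdM_comm (hg.sm_conn d) e c, pdM_comm (hg.sm_conn c) e d,
    pdM_comm (hg.sm_conn e) c d, curvM_eq, curvM_eq, curvM_eq]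
  noncomm_ring

theorem riemann_eq (g : E4 → Matrix (Fin 4) (Fin 4) ℝ) (z : E4) (a b c d : Fin 4) :
    riemann g z a b c d = (g z * curvM g c d z) a b := by
  simp [riemann, Matrix.mul_apply, curvM_apply]

/-- Antisymmetry of the curvature in its first pair of indices. -/
theorem MetricAt.lower_curvM (hg : ∀ᶠ z in 𝓝 y, MetricAt g z) (c d : Fin 4) :
    (g y * curvM g c d y)ᵀ = -(g y * curvM g c d y) := by
  have h0 := hg.self_of_nhds
  -- Metric compatibility differentiated once more. Symmetry of ∂_c ∂_d g then says exactly that the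
  -- lowered curvature matrix plus its transpose is zero.
  have key : ∀ c d, pdM c (pdM d g) y = (pdM c (conn g d) y)ᵀ * g y
      + (conn g d y)ᵀ * ((conn g c y)ᵀ * g y + g y * conn g c y)
      + (((conn g c y)ᵀ * g y + g y * conn g c y) * conn g d y + g y * pdM c (conn g d) y) := by
    intro c d
    have e : pdM c (pdM d g) y = pdM c (fun z => (conn g d z)ᵀ * g z + g z * conn g d z) y :=
      pdM_congr (hg.mono fun z hz => hz.pdM_metric d) c
    have s1 := h0.sm_conn d
    rw [e, pdM_add (s1.transpose.mul h0.sm) (h0.sm.mul s1), pdM_mul s1.transpose h0.sm,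
      pdM_mul h0.sm s1, pdM_transpose, h0.pdM_metric c]
  have := pdM_comm h0.sm c d
  rw [key, key] at this
  have hs : (g y)ᵀ = g y := h0.symm.self_of_nhds
  rw [Matrix.transpose_mul, hs, ← sub_eq_zero, curvM_eq]
  rw [← sub_eq_zero] at this
  rw [← this]
  simp only [Matrix.transpose_add, Matrix.transpose_sub, Matrix.transpose_mul]
  noncomm_ring

theorem riemann_antisymm_right (g : E4 → Matrix (Fin 4) (Fin 4) ℝ) (z : E4) (a b c d : Fin 4) :
    riemann g z a b c d = -riemann g z a b d c := by
  rw [riemann_eq, riemann_eq, curvM_antisymm]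
  simp

theorem riemann_antisymm_left (hg : ∀ᶠ z in 𝓝 y, MetricAt g z) (a b c d : Fin 4) :
    riemann g y a b c d = -riemann g y b a c d := by
  rw [riemann_eq, riemann_eq]
  exact congrFun (congrFun (MetricAt.lower_curvM hg c d) b) a

/-- The first Bianchi identity: the connection is torsion-free, so both the ∂Γ terms and the ΓΓ
terms cancel in the cyclic sum. -/
theorem riemannUp_cyclic (hg : ∀ᶠ z in 𝓝 y, MetricAt g z) (a b c d : Fin 4) :
    riemannUp g y a b c d + riemannUp g y a c d b + riemannUp g y a d b c = 0 := by
  have hs : ∀ k i j, christoffel g k i j y = christoffel g k j i y :=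
    hg.self_of_nhds.christoffel_symm
  have hp : ∀ c k i j, pd c (christoffel g k i j) y = pd c (christoffel g k j i) y :=
    fun c k i j => pd_congr (hg.mono fun z hz => hz.christoffel_symm k i j) c
  simp only [riemannUp, Finset.sum_sub_distrib]
  rw [hp c a d b, hp d a c b, hp b a d c]
  have e1 : ∀ c d b, ∑ e, christoffel g a c e y * christoffel g e d b y
      = ∑ e, christoffel g a c e y * christoffel g e b d y :=
    fun c d b => Finset.sum_congr rfl fun e _ => by rw [hs e d b]
  rw [e1 c d b, e1 d c b, e1 b d c]
  ring

theorem riemann_cyclic (hg : ∀ᶠ z in 𝓝 y, MetricAt g z) (a b c d : Fin 4) :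
    riemann g y a b c d + riemann g y a c d b + riemann g y a d b c = 0 := by
  simp only [riemann, ← Finset.sum_add_distrib, ← mul_add, riemannUp_cyclic hg, mul_zero,
    Finset.sum_const_zero]

/-- The classical octahedron argument: four instances of the cyclic identity, combined by means of
the two antisymmetries. -/
theorem riemann_pair (hg : ∀ᶠ z in 𝓝 y, MetricAt g z) (a b c d : Fin 4) :
    riemann g y a b c d = riemann g y c d a b := by
  have L := riemann_antisymm_left hg
  have R := riemann_antisymm_right g y
  have C := riemann_cyclic hg
  linarith [C a b c d, C b c d a, C c d a b, C d a b c, L a b c d, L b c d a, L c d a b, L d a b c,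
    R a b c d, R b c d a, R c d a b, R d a b c, L a c d b, L a d b c, L b d a c, L b a c d,
    L c a b d, L c b d a, L d b c a, L d c a b, R a c d b, R a d b c, R b d a c, R b a c d,
    R c a b d, R c b d a, R d b c a, R d c a b, L b c a d, L b d c a, R b c a d, R b d c a,
    L a c b d, R a c b d, L a d c b, R a d c b, L c a d b, R c a d b, L d a b c, L d b a c,
    R d b a c, L c b a d, R c b a d]

/-- The covariant derivative `∇_e A_{abcd}` of a covariant 4-tensor field. -/
def nabla4 (g : E4 → Matrix (Fin 4) (Fin 4) ℝ) (A : E4 → Fin 4 → Fin 4 → Fin 4 → Fin 4 → ℝ)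
    (y : E4) (e a b c d : Fin 4) : ℝ :=
  pd e (fun z => A z a b c d) y
    - ∑ f, (christoffel g f e a y * A y f b c d + christoffel g f e b y * A y a f c d
      + christoffel g f e c y * A y a b f d + christoffel g f e d y * A y a b c f)

/-- The second Bianchi identity. -/
theorem MetricAt.bianchi (hg : MetricAt g y) (e a b c d : Fin 4) :
    nabla4 g (riemann g) y e a b c d + nabla4 g (riemann g) y c a b d e
      + nabla4 g (riemann g) y d a b e c = 0 := by
  have hsym := hg.christoffel_symm
  -- By metric compatibility g passes through the derivative. This isolates the covariant derivative
  -- of the curvature matrix; the remaining connection terms act on the last two indices only.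
  have key : ∀ e c d, nabla4 g (riemann g) y e a b c d =
      (g y * (pdM e (curvM g c d) y + conn g e y * curvM g c d y - curvM g c d y * conn g e y)) a b
      - ∑ f, (christoffel g f e c y * riemann g y a b f d
        + christoffel g f e d y * riemann g y a b c f) := by
    intro e c d
    have e1 : pd e (fun z => riemann g z a b c d) y
        = ((pdM e g y) * curvM g c d y + g y * pdM e (curvM g c d) y) a b := by
      rw [← pdM_mul hg.sm (hg.sm_curvM c d)]
      simp only [pdM_apply, riemann_eq]
    have e2 : ∑ f, christoffel g f e a y * riemann g y f b c d
        = ((conn g e y)ᵀ * (g y * curvM g c d y)) a b := by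
      simp only [Matrix.mul_apply (M := (conn g e y)ᵀ), riemann_eq, Matrix.transpose_apply,
        conn_apply]
    have e3 : ∑ f, christoffel g f e b y * riemann g y a f c d
        = ((g y * curvM g c d y) * conn g e y) a b := by
      simp only [Matrix.mul_apply (N := conn g e y), riemann_eq, conn_apply, mul_comm]
    simp only [nabla4, Finset.sum_add_distrib]
    rw [e1, e2, e3, hg.pdM_metric e]
    have : ((conn g e y)ᵀ * g y + g y * conn g e y) * curvM g c d y + g y * pdM e (curvM g c d) y
        = (conn g e y)ᵀ * (g y * curvM g c d y) + (g y * curvM g c d y) * conn g e y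
        + g y * (pdM e (curvM g c d) y + conn g e y * curvM g c d y - curvM g c d y * conn g e y) := by
      noncomm_ring
    rw [this]
    simp only [Matrix.add_apply]
    ring
  rw [key, key, key]
  have hb := hg.bianchi_curvM e c d
  have hb' : ∀ X Y Z : Matrix (Fin 4) (Fin 4) ℝ, X + Y + Z = 0 →
      (g y * X) a b + (g y * Y) a b + (g y * Z) a b = 0 := by
    intro X Y Z h
    rw [← Matrix.add_apply, ← Matrix.add_apply, ← mul_add, ← mul_add, h, mul_zero]
    rfl
  replace hb' := hb' _ _ _ hb
  have R := riemann_antisymm_right g y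
  -- Torsion-freeness and antisymmetry in the last pair make the connection terms on those two
  -- indices cancel over the cyclic sum.
  have t : ∀ i j k, ∑ f, christoffel g f i j y * riemann g y a b k f
      = -∑ f, christoffel g f j i y * riemann g y a b f k := by
    intro i j k
    rw [← Finset.sum_neg_distrib]
    exact Finset.sum_congr rfl fun f _ => by rw [R a b k f, hsym f i j]; ring
  simp only [Finset.sum_add_distrib]
  rw [t e d c, t c e d, t d c e]
  linarith

end

noncomputable section

open Filter Topology Matrix

variable {g : E4 → Matrix (Fin 4) (Fin 4) ℝ} {y : E4}

/-! ### The Weyl tensor -/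

theorem MetricAt.sm_riemann (hg : MetricAt g y) (a b c d : Fin 4) :
    Sm (fun z => riemann g z a b c d) y :=
  Sm.sum fun e => (hg.sm a e).mul (hg.sm_curvM c d e b)

theorem MetricAt.sm_ricci (hg : MetricAt g y) (b d : Fin 4) : Sm (fun z => ricci g z b d) y :=
  Sm.sum fun a => hg.sm_curvM a d a b

theorem MetricAt.sm_scalarCurv (hg : MetricAt g y) : Sm (scalarCurv g) y :=
  Sm.sum fun a => Sm.sum fun b => (hg.sm_inv a b).mul (hg.sm_ricci a b)

theorem MetricAt.sm_schouten (hg : MetricAt g y) (a b : Fin 4) :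
    Sm (fun z => schouten g z a b) y :=
  (sm_const _ y).mul ((hg.sm_ricci a b).sub (((sm_const _ y).mul hg.sm_scalarCurv).mul (hg.sm a b)))

/-- In this form W is the Riemann tensor minus the Kulkarni–Nomizu product of g with the Schouten
tensor, so that ∇W involves the curvature corrections only through ∇P, whose antisymmetric part is
the Cotton tensor. -/
theorem weyl_eq (g : E4 → Matrix (Fin 4) (Fin 4) ℝ) (z : E4) (a b c d : Fin 4) :
    weyl g z a b c d = riemann g z a b c d
      - (g z a c * schouten g z b d - g z a d * schouten g z b c
        + g z b d * schouten g z a c - g z b c * schouten g z a d) := by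
  simp only [weyl, schouten]; ring

theorem MetricAt.sm_weyl (hg : MetricAt g y) (a b c d : Fin 4) :
    Sm (fun z => weyl g z a b c d) y := by
  have h : (fun z => weyl g z a b c d) = fun z => riemann g z a b c d
      - (g z a c * schouten g z b d - g z a d * schouten g z b c
        + g z b d * schouten g z a c - g z b c * schouten g z a d) :=
    funext fun z => weyl_eq g z a b c d
  have s := hg.sm_schouten
  rw [h]
  exact (hg.sm_riemann a b c d).sub (((((hg.sm a c).mul (s b d)).sub ((hg.sm a d).mul (s b c))).add
    ((hg.sm b d).mul (s a c))).sub ((hg.sm b c).mul (s a d)))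

theorem MetricAt.inv_mul_apply (hg : MetricAt g y) (i j : Fin 4) :
    ∑ k, gInv g y i k * g y k j = if i = j then 1 else 0 := by
  have := congrFun (congrFun hg.inv_mul i) j
  rwa [Matrix.mul_apply, Matrix.one_apply] at this

theorem MetricAt.inv_mul_apply' (hg : MetricAt g y) (i j : Fin 4) :
    ∑ k, gInv g y k i * g y k j = if i = j then 1 else 0 := by
  rw [← hg.inv_mul_apply i j]
  exact Finset.sum_congr rfl fun k _ => by rw [hg.inv_symm_at]

theorem MetricAt.trace_riemann (hg : MetricAt g y) (b d : Fin 4) :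
    ∑ a, ∑ c, gInv g y a c * riemann g y a b c d = ricci g y b d := by
  simp only [riemann, Finset.mul_sum]
  rw [Finset.sum_comm]
  have h : ∀ c, ∑ a, ∑ e, gInv g y a c * (g y a e * riemannUp g y e b c d)
      = riemannUp g y c b c d := by
    intro c
    rw [Finset.sum_comm]
    simp only [← mul_assoc, ← Finset.sum_mul, hg.inv_mul_apply']
    simp
  simp only [h, ricci]

theorem ricci_symm (hg : ∀ᶠ z in 𝓝 y, MetricAt g z) (b d : Fin 4) :
    ricci g y b d = ricci g y d b := by
  have h := hg.self_of_nhds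
  rw [← h.trace_riemann, ← h.trace_riemann, Finset.sum_comm]
  refine Finset.sum_congr rfl fun a _ => Finset.sum_congr rfl fun c _ => ?_
  rw [h.inv_symm_at c a, riemann_pair hg]

theorem schouten_symm (hg : ∀ᶠ z in 𝓝 y, MetricAt g z) (b d : Fin 4) :
    schouten g y b d = schouten g y d b := by
  simp only [schouten, ricci_symm hg b d, hg.self_of_nhds.symm_at b d]

theorem weyl_antisymm_right (g : E4 → Matrix (Fin 4) (Fin 4) ℝ) (z : E4) (a b c d : Fin 4) :
    weyl g z a b c d = -weyl g z a b d c := by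
  rw [weyl_eq, weyl_eq, riemann_antisymm_right]; ring

theorem weyl_pair (hg : ∀ᶠ z in 𝓝 y, MetricAt g z) (a b c d : Fin 4) :
    weyl g y a b c d = weyl g y c d a b := by
  have h := hg.self_of_nhds.symm_at
  have s := schouten_symm hg
  rw [weyl_eq, weyl_eq, riemann_pair hg, h c a, h c b, h d b, h d a, s b d, s b c, s a c, s a d]
  ring

theorem weyl_cyclic (hg : ∀ᶠ z in 𝓝 y, MetricAt g z) (a b c d : Fin 4) :
    weyl g y a b c d + weyl g y a c d b + weyl g y a d b c = 0 := by
  have h := hg.self_of_nhds.symm_at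
  have s := schouten_symm hg
  have := riemann_cyclic hg a b c d
  rw [weyl_eq, weyl_eq, weyl_eq, h c b, h d b, h d c, s c b, s d b, s d c]
  linarith

/-- The coefficients 1/2 and 1/6 are those for which the traces cancel in dimension four, where
g^{ac} g_{ac} = 4. -/
theorem MetricAt.trace_weyl (hg : MetricAt g y) (b d : Fin 4) :
    ∑ a, ∑ c, gInv g y a c * weyl g y a b c d = 0 := by
  have h4 : ∑ a, ∑ c, gInv g y a c * g y a c = 4 := by
    rw [Finset.sum_comm]
    simp [hg.inv_mul_apply']
  have t1 : ∀ X : Fin 4 → ℝ, ∀ d, ∑ a, ∑ c, gInv g y a c * (g y a d * X c) = X d := by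
    intro X d
    rw [Finset.sum_comm]
    simp only [← mul_assoc, ← Finset.sum_mul, hg.inv_mul_apply']
    simp
  have t2 : ∀ X : Fin 4 → ℝ, ∀ b, ∑ a, ∑ c, gInv g y a c * (g y b c * X a) = X b := by
    intro X b
    have : ∀ a, ∑ c, gInv g y a c * (g y b c * X a) = (if a = b then 1 else 0) * X a := by
      intro a
      rw [← hg.inv_mul_apply a b, Finset.sum_mul]
      exact Finset.sum_congr rfl fun c _ => by rw [hg.symm_at b c]; ring
    simp [this]
  have e : ∀ a c, gInv g y a c * weyl g y a b c d = gInv g y a c * riemann g y a b c d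
      - (1 / 2) * (gInv g y a c * g y a c * ricci g y b d - gInv g y a c * (g y a d * ricci g y b c)
        + g y b d * (gInv g y a c * ricci g y a c) - gInv g y a c * (g y b c * ricci g y a d))
      + (1 / 6) * scalarCurv g y * (gInv g y a c * g y a c * g y b d
        - gInv g y a c * (g y a d * g y b c)) := by
    intro a c; simp only [weyl]; ring
  simp only [e, Finset.sum_add_distrib, Finset.sum_sub_distrib, ← Finset.mul_sum, ← Finset.sum_mul,
    hg.trace_riemann, h4, t1, t2]
  rw [show ∑ a, ∑ c, gInv g y a c * ricci g y a c = scalarCurv g y from rfl]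
  ring

theorem MetricAt.pd_metric (hg : MetricAt g y) (e i j : Fin 4) :
    pd e (fun z => g z i j) y
      = ∑ f, (christoffel g f e i y * g y f j + christoffel g f e j y * g y i f) := by
  have := congrFun (congrFun (hg.pdM_metric e) i) j
  rw [pdM_apply] at this
  rw [this]
  simp only [Matrix.add_apply, Matrix.mul_apply, Matrix.transpose_apply, conn_apply,
    Finset.sum_add_distrib, mul_comm]

/-- The Leibniz rule with ∇g = 0. The connection terms are left explicit, so that they can be
matched with those of a 4-tensor. -/
theorem MetricAt.pd_metric_mul (hg : MetricAt g y) {A : E4 → Fin 4 → Fin 4 → ℝ}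
    (hA : ∀ a b, Sm (fun z => A z a b) y) (e i j k l : Fin 4) :
    pd e (fun z => g z i j * A z k l) y = g y i j * nabla2 g A y e k l
      + ∑ f, (christoffel g f e i y * g y f j * A y k l + christoffel g f e j y * g y i f * A y k l
        + g y i j * (christoffel g f e k y * A y f l) + g y i j * (christoffel g f e l y * A y k f)) := by
  rw [pd_mul (hg.sm i j) (hA k l), hg.pd_metric, nabla2]
  simp only [Finset.sum_add_distrib, Finset.sum_mul, Finset.mul_sum, mul_sub, mul_add, add_mul]
  ring

/-- Since ∇g = 0, covariant differentiation of the Kulkarni–Nomizu product acts on the Schouten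
factor alone. -/
theorem MetricAt.nabla4_weyl (hg : MetricAt g y) (e a b c d : Fin 4) :
    nabla4 g (weyl g) y e a b c d = nabla4 g (riemann g) y e a b c d
      - (g y a c * nabla2 g (schouten g) y e b d - g y a d * nabla2 g (schouten g) y e b c
        + g y b d * nabla2 g (schouten g) y e a c - g y b c * nabla2 g (schouten g) y e a d) := by
  have h : (fun z => weyl g z a b c d) = fun z => riemann g z a b c d
      - (g z a c * schouten g z b d - g z a d * schouten g z b c
        + g z b d * schouten g z a c - g z b c * schouten g z a d) :=
    funext fun z => weyl_eq g z a b c d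
  have s := hg.sm_schouten
  have s1 := (hg.sm a c).mul (s b d)
  have s2 := (hg.sm a d).mul (s b c)
  have s3 := (hg.sm b d).mul (s a c)
  have s4 := (hg.sm b c).mul (s a d)
  rw [nabla4, h, pd_sub (hg.sm_riemann a b c d) (((s1.sub s2).add s3).sub s4),
    pd_sub ((s1.sub s2).add s3) s4, pd_add (s1.sub s2) s3, pd_sub s1 s2,
    hg.pd_metric_mul s, hg.pd_metric_mul s, hg.pd_metric_mul s, hg.pd_metric_mul s, nabla4]
  set Γ := christoffel g with hΓ
  set P := schouten g y with hP
  have hsum : ∑ f, (Γ f e a y * weyl g y f b c d + Γ f e b y * weyl g y a f c d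
      + Γ f e c y * weyl g y a b f d + Γ f e d y * weyl g y a b c f)
      = ∑ f, (Γ f e a y * riemann g y f b c d + Γ f e b y * riemann g y a f c d
      + Γ f e c y * riemann g y a b f d + Γ f e d y * riemann g y a b c f)
      - (∑ f, (Γ f e a y * g y f c * P b d + Γ f e c y * g y a f * P b d
          + g y a c * (Γ f e b y * P f d) + g y a c * (Γ f e d y * P b f))
        - ∑ f, (Γ f e a y * g y f d * P b c + Γ f e d y * g y a f * P b c
          + g y a d * (Γ f e b y * P f c) + g y a d * (Γ f e c y * P b f))
        + ∑ f, (Γ f e b y * g y f d * P a c + Γ f e d y * g y b f * P a c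
          + g y b d * (Γ f e a y * P f c) + g y b d * (Γ f e c y * P a f))
        - ∑ f, (Γ f e b y * g y f c * P a d + Γ f e c y * g y b f * P a d
          + g y b c * (Γ f e a y * P f d) + g y b c * (Γ f e d y * P a f))) := by
    rw [← Finset.sum_sub_distrib, ← Finset.sum_add_distrib, ← Finset.sum_sub_distrib,
      ← Finset.sum_sub_distrib]
    refine Finset.sum_congr rfl fun f _ => ?_
    rw [weyl_eq, weyl_eq, weyl_eq, weyl_eq]
    ring
  rw [hsum]
  ring

theorem nabla2_schouten_symm (hg : ∀ᶠ z in 𝓝 y, MetricAt g z) (c a b : Fin 4) :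
    nabla2 g (schouten g) y c a b = nabla2 g (schouten g) y c b a := by
  have hev : ∀ᶠ z in 𝓝 y, ∀ a b, schouten g z a b = schouten g z b a :=
    hg.eventually_nhds.mono fun z hz => schouten_symm hz
  have s := hev.self_of_nhds
  simp only [nabla2, Finset.sum_add_distrib]
  rw [pd_congr' (hev.mono fun z hz => hz a b)]
  simp only [s a, s _ b]
  ring

/-- With vanishing Cotton tensor the Weyl tensor satisfies the second Bianchi identity. -/
theorem bianchi_weyl (hg : ∀ᶠ z in 𝓝 y, MetricAt g z) (hC : ∀ a b c, cotton g y a b c = 0)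
    (e a b c d : Fin 4) :
    nabla4 g (weyl g) y e a b c d + nabla4 g (weyl g) y c a b d e
      + nabla4 g (weyl g) y d a b e c = 0 := by
  -- With zero Cotton tensor, ∇P is symmetric in all its indices, and the correction terms cancel in
  -- the cyclic sum.
  have C : ∀ i j k, nabla2 g (schouten g) y i k j = nabla2 g (schouten g) y j k i := by
    intro i j k
    rw [nabla2_schouten_symm hg i k j, nabla2_schouten_symm hg j k i]
    exact sub_eq_zero.1 (hC i j k)
  have h := hg.self_of_nhds
  rw [h.nabla4_weyl, h.nabla4_weyl, h.nabla4_weyl]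
  have := h.bianchi e a b c d
  rw [C e d b, C e c b, C e c a, C e d a, C c d b, C c d a]
  linarith

end

noncomputable section

open Filter Topology Matrix

variable {g : E4 → Matrix (Fin 4) (Fin 4) ℝ} {u : E4 → Fin 4 → ℝ} {y : E4}

/-! ### Frame components -/

/-- The components of a covector in the frame given by the columns of `P`. -/
def fr1 (P : Matrix (Fin 4) (Fin 4) ℝ) (A : Fin 4 → ℝ) (i : Fin 4) : ℝ := ∑ a, P a i * A a

/-- The frame components of a covariant 2-tensor. -/
def fr2 (P : Matrix (Fin 4) (Fin 4) ℝ) (A : Fin 4 → Fin 4 → ℝ) (i j : Fin 4) : ℝ :=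
  fr1 P (fun a => fr1 P (fun b => A a b) j) i

/-- The frame components of a covariant 3-tensor. -/
def fr3 (P : Matrix (Fin 4) (Fin 4) ℝ) (A : Fin 4 → Fin 4 → Fin 4 → ℝ) (i j k : Fin 4) : ℝ :=
  fr1 P (fun a => fr1 P (fun b => fr1 P (fun c => A a b c) k) j) i

/-- The frame components of a covariant 4-tensor. -/
def fr4 (P : Matrix (Fin 4) (Fin 4) ℝ) (A : Fin 4 → Fin 4 → Fin 4 → Fin 4 → ℝ)
    (i j k l : Fin 4) : ℝ :=
  fr1 P (fun a => fr1 P (fun b => fr1 P (fun c => fr1 P (fun d => A a b c d) l) k) j) i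

/-! ### Linearity and contraction of frame components -/

section Linear

variable (P : Matrix (Fin 4) (Fin 4) ℝ)

theorem fr1_add (A B : Fin 4 → ℝ) (i : Fin 4) :
    fr1 P (fun a => A a + B a) i = fr1 P A i + fr1 P B i := by
  simp [fr1, mul_add, Finset.sum_add_distrib]

theorem fr1_sub (A B : Fin 4 → ℝ) (i : Fin 4) :
    fr1 P (fun a => A a - B a) i = fr1 P A i - fr1 P B i := by
  simp [fr1, mul_sub, Finset.sum_sub_distrib]

theorem fr1_neg (A : Fin 4 → ℝ) (i : Fin 4) :
    fr1 P (fun a => -A a) i = -fr1 P A i := by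
  simp [fr1, Finset.sum_neg_distrib]

theorem fr1_zero (i : Fin 4) : fr1 P (fun _ => 0) i = 0 := by simp [fr1]

variable {P} in
theorem fr1_eq_zero {A : Fin 4 → ℝ} {i : Fin 4} (h : ∀ a, A a = 0) : fr1 P A i = 0 := by
  simp [fr1, h]

theorem fr1_mul_const (A : Fin 4 → ℝ) (r : ℝ) (i : Fin 4) :
    fr1 P (fun a => A a * r) i = fr1 P A i * r := by
  simp [fr1, Finset.sum_mul, mul_assoc]

theorem fr1_const_mul (A : Fin 4 → ℝ) (r : ℝ) (i : Fin 4) :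
    fr1 P (fun a => r * A a) i = r * fr1 P A i := by
  simp only [fr1, Finset.mul_sum]
  exact Finset.sum_congr rfl fun _ _ => by ring

theorem fr1_sum (A : Fin 4 → Fin 4 → ℝ) (i : Fin 4) :
    fr1 P (fun a => ∑ k, A k a) i = ∑ k, fr1 P (A k) i := by
  simp only [fr1, Finset.mul_sum]
  rw [Finset.sum_comm]

theorem fr1_comm (A : Fin 4 → Fin 4 → ℝ) (i j : Fin 4) :
    fr1 P (fun a => fr1 P (fun b => A a b) j) i = fr1 P (fun b => fr1 P (fun a => A a b) i) j := by
  simp only [fr1, Finset.mul_sum]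
  rw [Finset.sum_comm]
  exact Finset.sum_congr rfl fun _ _ => Finset.sum_congr rfl fun _ _ => by ring

variable {P}

/-- A tensor vanishes if its components in one nondegenerate frame do. This brings frame
computations back to coordinates. -/
theorem fr1_injective (hP : P.det ≠ 0) {A : Fin 4 → ℝ} (h : ∀ i, fr1 P A i = 0) (a : Fin 4) :
    A a = 0 := by
  have h1 : Pᵀ *ᵥ A = 0 := by
    ext i; simpa [Matrix.mulVec, dotProduct, fr1] using h i
  exact congrFun (Matrix.eq_zero_of_mulVec_eq_zero (by rwa [Matrix.det_transpose]) h1) a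

/-- Contraction with a vector given by its frame components. -/
theorem sum_mul_vector {v V : Fin 4 → ℝ} (hv : ∀ b, v b = ∑ j, P b j * V j) (X : Fin 4 → ℝ) :
    ∑ b, X b * v b = ∑ j, fr1 P X j * V j := by
  simp only [hv, fr1, Finset.mul_sum, Finset.sum_mul]
  rw [Finset.sum_comm]
  exact Finset.sum_congr rfl fun _ _ => Finset.sum_congr rfl fun _ _ => by ring

/-- Contraction with a contravariant 2-tensor given by its frame components. -/
theorem sum_mul_bivector {K L : Matrix (Fin 4) (Fin 4) ℝ} (hK : K = P * L * Pᵀ)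
    (X : Fin 4 → Fin 4 → ℝ) :
    ∑ a, ∑ b, X a b * K a b = ∑ i, ∑ j, fr2 P X i j * L i j := by
  have h1 : ∀ a b, K a b = ∑ i, P a i * ∑ j, P b j * L i j := by
    intro a b
    simp only [hK, Matrix.mul_apply, Matrix.transpose_apply, Finset.mul_sum, Finset.sum_mul]
    rw [Finset.sum_comm]
    exact Finset.sum_congr rfl fun _ _ => Finset.sum_congr rfl fun _ _ => by ring
  have h2 : ∀ a, ∑ b, X a b * K a b = ∑ i, P a i * ∑ j, fr1 P (X a) j * L i j := by
    intro a
    simp only [h1]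
    have : ∀ b, X a b * ∑ i, P a i * ∑ j, P b j * L i j
        = ∑ i, P a i * (X a b * ∑ j, P b j * L i j) := by
      intro b; rw [Finset.mul_sum]; exact Finset.sum_congr rfl fun _ _ => by ring
    simp only [this]
    rw [Finset.sum_comm]
    refine Finset.sum_congr rfl fun i _ => ?_
    rw [← Finset.mul_sum]
    congr 1
    exact sum_mul_vector (V := fun j => L i j) (fun b => rfl) (X a)
  simp only [h2]
  rw [Finset.sum_comm]
  refine Finset.sum_congr rfl fun i _ => ?_
  have : ∀ j, fr2 P X i j * L i j = fr1 P (fun a => fr1 P (X a) j * L i j) i := fun j => by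
    rw [fr1_mul_const]; rfl
  simp only [this, ← fr1_sum]
  rfl

end Linear

theorem Sm.fr1 {Q : E4 → Matrix (Fin 4) (Fin 4) ℝ} (hQ : SmM Q y) {A : E4 → Fin 4 → ℝ}
    (hA : ∀ a, Sm (fun z => A z a) y) (i : Fin 4) : Sm (fun z => fr1 (Q z) (A z) i) y :=
  Sm.sum fun a => (hQ a i).mul (hA a)

/-! ### Moving frames -/

/-- A frame field whose covariant derivative vanishes at `y`. -/
structure ParallelAt (g : E4 → Matrix (Fin 4) (Fin 4) ℝ) (y : E4)
    (Q : E4 → Matrix (Fin 4) (Fin 4) ℝ) : Prop where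
  sm : SmM Q y
  pd : ∀ c, pdM c Q y = -(conn g c y * Q y)

/-- A frame field with vanishing covariant derivative and prescribed value at `y`. -/
def movingFrame (g : E4 → Matrix (Fin 4) (Fin 4) ℝ) (y : E4) (P : Matrix (Fin 4) (Fin 4) ℝ)
    (z : E4) : Matrix (Fin 4) (Fin 4) ℝ :=
  Matrix.of fun a i => P a i - ∑ c, (z c - y c) * (conn g c y * P) a i

theorem movingFrame_self (P : Matrix (Fin 4) (Fin 4) ℝ) : movingFrame g y P y = P := by
  ext a i; simp [movingFrame]

/-- The field is affine in the coordinates, with the linear part chosen so that ∂_c Q = -Γ_c Q at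
the base point. Only first order at that point is controlled, so curvature is no obstruction. -/
theorem movingFrame_parallel (P : Matrix (Fin 4) (Fin 4) ℝ) :
    ParallelAt g y (movingFrame g y P) where
  sm a i := (sm_const _ y).sub (Sm.sum fun c => ((sm_coord c y).sub (sm_const _ y)).mul
    (sm_const _ y))
  pd c := by
    ext a i
    have h1 : ∀ d, Sm (fun z : E4 => (z d - y d) * (conn g d y * P) a i) y := fun d =>
      ((sm_coord d y).sub (sm_const _ y)).mul (sm_const _ y)
    have h2 : ∀ d, GravMag.pd c (fun z : E4 => (z d - y d) * (conn g d y * P) a i) y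
        = (if c = d then 1 else 0) * (conn g d y * P) a i := by
      intro d
      rw [pd_mul_const ((sm_coord d y).sub (sm_const _ y)), pd_sub (sm_coord d y) (sm_const _ y),
        pd_coord, pd_const, sub_zero]
    rw [movingFrame_self, pdM_apply]
    simp only [movingFrame, Matrix.of_apply]
    rw [pd_sub (sm_const _ y) (Sm.sum h1), pd_const, pd_sum h1]
    simp [h2]

/-- The derivative of the frame supplies precisely the connection term of the covariant derivative.
Higher ranks follow by applying this to one slot at a time. -/
theorem ParallelAt.pd_fr1 {Q : E4 → Matrix (Fin 4) (Fin 4) ℝ} (hQ : ParallelAt g y Q)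
    {A : E4 → Fin 4 → ℝ} (hA : ∀ a, Sm (fun z => A z a) y) (c i : Fin 4) :
    GravMag.pd c (fun z => fr1 (Q z) (A z) i) y
      = fr1 (Q y) (fun a => GravMag.pd c (fun z => A z a) y
          - ∑ e, christoffel g e c a y * A y e) i := by
  have hp : ∀ a, GravMag.pd c (fun z => Q z a i) y = -∑ e, christoffel g a c e y * Q y e i := by
    intro a
    have := congrFun (congrFun (hQ.pd c) a) i
    simpa [pdM_apply, Matrix.mul_apply, conn_apply] using this
  rw [fr1_sub]
  simp only [fr1]
  rw [pd_sum fun a => (hQ.sm a i).mul (hA a)]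
  simp only [pd_mul (hQ.sm _ i) (hA _), hp, Finset.sum_add_distrib, neg_mul, Finset.sum_neg_distrib,
    Finset.mul_sum, Finset.sum_mul]
  rw [Finset.sum_comm]
  have : ∑ e, ∑ a, christoffel g a c e y * Q y e i * A y a
      = ∑ e, ∑ a, Q y e i * (christoffel g a c e y * A y a) :=
    Finset.sum_congr rfl fun _ _ => Finset.sum_congr rfl fun _ _ => by ring
  rw [this]
  ring

section Derivative

variable {Q : E4 → Matrix (Fin 4) (Fin 4) ℝ}

theorem ParallelAt.pd_fr1' (hQ : ParallelAt g y Q) {A : E4 → Fin 4 → ℝ} (hA : ∀ a, Sm (fun z => A z a) y) (c i : Fin 4) :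
    GravMag.pd c (fun z => fr1 (Q z) (A z) i) y = fr1 (Q y) (nabla1 g A y c) i :=
  hQ.pd_fr1 hA c i

theorem ParallelAt.pd_fr2 (hQ : ParallelAt g y Q) {A : E4 → Fin 4 → Fin 4 → ℝ} (hA : ∀ a b, Sm (fun z => A z a b) y)
    (c i j : Fin 4) :
    GravMag.pd c (fun z => fr2 (Q z) (A z) i j) y = fr2 (Q y) (nabla2 g A y c) i j := by
  simp only [fr2]
  rw [hQ.pd_fr1 fun a => Sm.fr1 hQ.sm (hA a) j]
  simp only [hQ.pd_fr1 (hA _), nabla2, ← fr1_const_mul, ← fr1_sum, ← fr1_sub,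
    Finset.sum_add_distrib]
  congr 1; funext a; congr 1; funext b
  ring

theorem ParallelAt.pd_fr4 (hQ : ParallelAt g y Q) {A : E4 → Fin 4 → Fin 4 → Fin 4 → Fin 4 → ℝ}
    (hA : ∀ a b c d, Sm (fun z => A z a b c d) y) (e i j k l : Fin 4) :
    GravMag.pd e (fun z => fr4 (Q z) (A z) i j k l) y
      = fr4 (Q y) (nabla4 g A y e) i j k l := by
  have s1 := fun a b c => Sm.fr1 hQ.sm (hA a b c) l
  have s2 := fun a b => Sm.fr1 hQ.sm (s1 a b) k
  have s3 := fun a => Sm.fr1 hQ.sm (s2 a) j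
  simp only [fr4]
  rw [hQ.pd_fr1 s3]
  simp only [hQ.pd_fr1 (s2 _), hQ.pd_fr1 (s1 _ _), hQ.pd_fr1 (hA _ _ _), nabla4, ← fr1_const_mul,
    ← fr1_sum, ← fr1_sub, Finset.sum_add_distrib]
  congr 1; funext a; congr 1; funext b; congr 1; funext c; congr 1; funext d
  ring

end Derivative

end

noncomputable section

open Filter Topology Matrix

variable {g : E4 → Matrix (Fin 4) (Fin 4) ℝ} {u : E4 → Fin 4 → ℝ} {y : E4}

/-! ### Frames adapted to the observer -/

/-- The diagonal entries of the Minkowski metric. -/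
def sgn (i : Fin 4) : ℝ := if i = 0 then -1 else 1

/-- The columns of `P` form a positively oriented orthonormal frame at `y` whose timelike leg
is `u`. -/
structure IsFrame (g : E4 → Matrix (Fin 4) (Fin 4) ℝ) (u : E4 → Fin 4 → ℝ) (y : E4)
    (P : Matrix (Fin 4) (Fin 4) ℝ) : Prop where
  ortho : Pᵀ * g y * P = Matrix.diagonal sgn
  time : ∀ a, P a 0 = u y a
  pos : 0 < P.det

/-- The components of a Lorentzian metric and of an observer near the coordinates `y`. -/
structure ObserverAt (g : E4 → Matrix (Fin 4) (Fin 4) ℝ) (u : E4 → Fin 4 → ℝ) (y : E4) :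
    Prop where
  metric : MetricAt g y
  sm : ∀ a, Sm (fun z => u z a) y
  frame : ∃ P, IsFrame g u y P

theorem sgn_mul_self (i : Fin 4) : sgn i * sgn i = 1 := by
  unfold sgn; split_ifs <;> norm_num

theorem diagonal_sgn_sq : Matrix.diagonal sgn * Matrix.diagonal sgn = 1 := by
  rw [Matrix.diagonal_mul_diagonal]; simp [sgn_mul_self]

theorem diagonal_sgn_inv : (Matrix.diagonal sgn)⁻¹ = Matrix.diagonal sgn :=
  Matrix.inv_eq_right_inv diagonal_sgn_sq

theorem det_diagonal_sgn : (Matrix.diagonal sgn).det = -1 := by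
  simp [Matrix.det_diagonal, sgn]

/-- The metric components in a frame field. -/
def frMetric (g Q : E4 → Matrix (Fin 4) (Fin 4) ℝ) (z : E4) : Matrix (Fin 4) (Fin 4) ℝ :=
  (Q z)ᵀ * g z * Q z

/-- The contravariant components of `u` in a frame field. -/
def frVel (g : E4 → Matrix (Fin 4) (Fin 4) ℝ) (u : E4 → Fin 4 → ℝ)
    (Q : E4 → Matrix (Fin 4) (Fin 4) ℝ) (z : E4) (i : Fin 4) : ℝ :=
  ∑ j, (frMetric g Q z)⁻¹ i j * fr1 (Q z) (lowerU g u z) j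

/-- The tensor `∇_a u_b`. -/
def gradU (g : E4 → Matrix (Fin 4) (Fin 4) ℝ) (u : E4 → Fin 4 → ℝ) (z : E4) (a b : Fin 4) : ℝ :=
  nabla1 g (lowerU g u) z a b

/-- The tensor `∇^a u^b`. -/
def gradUp (g : E4 → Matrix (Fin 4) (Fin 4) ℝ) (u : E4 → Fin 4 → ℝ) (z : E4) :
    Matrix (Fin 4) (Fin 4) ℝ :=
  gInv g z * Matrix.of (gradU g u z) * (gInv g z)ᵀ

/-- The frame components of `∇^a u^b`. -/
def frGradUp (g : E4 → Matrix (Fin 4) (Fin 4) ℝ) (u : E4 → Fin 4 → ℝ)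
    (Q : E4 → Matrix (Fin 4) (Fin 4) ℝ) (z : E4) : Matrix (Fin 4) (Fin 4) ℝ :=
  (frMetric g Q z)⁻¹ * Matrix.of (fr2 (Q z) (gradU g u z)) * ((frMetric g Q z)⁻¹)ᵀ

theorem fr2_eq_mul (P : Matrix (Fin 4) (Fin 4) ℝ) (A : Fin 4 → Fin 4 → ℝ) :
    Matrix.of (fr2 P A) = Pᵀ * Matrix.of A * P := by
  ext i j
  simp only [fr2, fr1, Matrix.of_apply, Matrix.mul_apply, Matrix.transpose_apply, Finset.mul_sum,
    Finset.sum_mul]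
  rw [Finset.sum_comm]
  exact Finset.sum_congr rfl fun _ _ => Finset.sum_congr rfl fun _ _ => by ring

theorem MetricAt.sm_lowerU (hg : MetricAt g y) (hu : ∀ a, Sm (fun z => u z a) y) (a : Fin 4) :
    Sm (fun z => lowerU g u z a) y :=
  Sm.sum fun b => (hg.sm a b).mul (hu b)

theorem MetricAt.sm_nabla1 (hg : MetricAt g y) {A : E4 → Fin 4 → ℝ}
    (hA : ∀ a, Sm (fun z => A z a) y) (c a : Fin 4) : Sm (fun z => nabla1 g A z c a) y :=
  ((hA a).pd c).sub (Sm.sum fun e => (hg.sm_christoffel e c a).mul (hA e))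

theorem MetricAt.sm_gradU (hg : MetricAt g y) (hu : ∀ a, Sm (fun z => u z a) y) (a b : Fin 4) :
    Sm (fun z => gradU g u z a b) y := hg.sm_nabla1 (hg.sm_lowerU hu) a b

section NonDegenerate

variable {Q : E4 → Matrix (Fin 4) (Fin 4) ℝ} {z : E4}

theorem gInv_eq_frame (hQ : (Q z).det ≠ 0) :
    gInv g z = Q z * (frMetric g Q z)⁻¹ * (Q z)ᵀ := by
  have hQu : IsUnit (Q z).det := isUnit_iff_ne_zero.2 hQ
  have hQt : IsUnit ((Q z)ᵀ).det := by rwa [Matrix.det_transpose]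
  rw [frMetric, Matrix.mul_inv_rev, Matrix.mul_inv_rev, gInv]
  rw [← mul_assoc, Matrix.mul_nonsing_inv _ hQu, one_mul, mul_assoc,
    Matrix.nonsing_inv_mul _ hQt, mul_one]

/-- The frame need not be orthonormal away from the base point, so contravariant components are
defined through the inverse of the metric in the frame. The expansion is thus valid on a
neighbourhood and can be differentiated. -/
theorem vel_eq_frame (hg : (g z).det ≠ 0) (hQ : (Q z).det ≠ 0) (a : Fin 4) :
    u z a = ∑ i, Q z a i * frVel g u Q z i := by
  have h1 : u z = gInv g z *ᵥ (g z *ᵥ u z) := by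
    rw [Matrix.mulVec_mulVec, gInv, Matrix.nonsing_inv_mul _ (isUnit_iff_ne_zero.2 hg),
      Matrix.one_mulVec]
  have h2 : frVel g u Q z = (frMetric g Q z)⁻¹ *ᵥ ((Q z)ᵀ *ᵥ (g z *ᵥ u z)) := by
    ext i
    simp [frVel, fr1, lowerU, Matrix.mulVec, dotProduct]
  have h3 : u z = Q z *ᵥ frVel g u Q z := by
    rw [h2, Matrix.mulVec_mulVec, Matrix.mulVec_mulVec, ← gInv_eq_frame hQ, ← h1]
  exact congrFun h3 a

theorem gradUp_eq_frame (hQ : (Q z).det ≠ 0) :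
    gradUp g u z = Q z * frGradUp g u Q z * (Q z)ᵀ := by
  rw [gradUp, frGradUp, fr2_eq_mul, gInv_eq_frame hQ]
  simp only [Matrix.transpose_mul, Matrix.transpose_transpose, mul_assoc]

end NonDegenerate

/-! ### A parallel adapted frame field -/

/-- A frame field near `y`, adapted to the observer and with vanishing covariant derivative
at `y`. -/
structure AdaptedAt (g : E4 → Matrix (Fin 4) (Fin 4) ℝ) (u : E4 → Fin 4 → ℝ) (y : E4)
    (Q : E4 → Matrix (Fin 4) (Fin 4) ℝ) : Prop where
  obs : ∀ᶠ z in 𝓝 y, ObserverAt g u z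
  frame : IsFrame g u y (Q y)
  par : ParallelAt g y Q

theorem exists_adapted (h : ∀ᶠ z in 𝓝 y, ObserverAt g u z) : ∃ Q, AdaptedAt g u y Q := by
  obtain ⟨P, hP⟩ := h.self_of_nhds.frame
  exact ⟨movingFrame g y P, h, by rwa [movingFrame_self], movingFrame_parallel P⟩

/-- The derivative at `y` in the direction of the frame vector `k`. -/
def dir (P : Matrix (Fin 4) (Fin 4) ℝ) (y : E4) (k : Fin 4) (f : E4 → ℝ) : ℝ :=
  fr1 P (fun c => pd c f y) k

section Dir

variable {P : Matrix (Fin 4) (Fin 4) ℝ} {f h : E4 → ℝ} {k : Fin 4}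

theorem dir_eq_zero (hf : ∀ c, pd c f y = 0) : dir P y k f = 0 := by
  simp [dir, hf, fr1_zero]

theorem dir_congr (e : ∀ᶠ z in 𝓝 y, f z = h z) : dir P y k f = dir P y k h := by
  simp only [dir, pd_congr' e]

theorem dir_const (r : ℝ) : dir P y k (fun _ => r) = 0 := dir_eq_zero fun c => pd_const c r y

theorem dir_add (hf : Sm f y) (hh : Sm h y) :
    dir P y k (fun z => f z + h z) = dir P y k f + dir P y k h := by
  simp only [dir, pd_add hf hh, fr1_add]

theorem dir_sub (hf : Sm f y) (hh : Sm h y) :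
    dir P y k (fun z => f z - h z) = dir P y k f - dir P y k h := by
  simp only [dir, pd_sub hf hh, fr1_sub]

theorem dir_neg : dir P y k (fun z => -f z) = -dir P y k f := by
  simp only [dir, pd_neg, fr1_neg]

theorem dir_mul (hf : Sm f y) (hh : Sm h y) :
    dir P y k (fun z => f z * h z) = dir P y k f * h y + f y * dir P y k h := by
  simp only [dir, pd_mul hf hh, fr1_add, fr1_mul_const, fr1_const_mul]

theorem dir_const_mul (hf : Sm f y) (r : ℝ) :
    dir P y k (fun z => r * f z) = r * dir P y k f := by
  simp only [dir, pd_const_mul hf, fr1_const_mul]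

theorem dir_sum {F : Fin 4 → E4 → ℝ} (hF : ∀ i, Sm (F i) y) :
    dir P y k (fun z => ∑ i, F i z) = ∑ i, dir P y k (F i) := by
  simp only [dir, pd_sum hF, fr1_sum]

end Dir

namespace AdaptedAt

variable {Q : E4 → Matrix (Fin 4) (Fin 4) ℝ}

theorem metric (hQ : AdaptedAt g u y Q) : ∀ᶠ z in 𝓝 y, MetricAt g z :=
  hQ.obs.mono fun _ hz => hz.metric

theorem metric_at (hQ : AdaptedAt g u y Q) : MetricAt g y := hQ.metric.self_of_nhds

theorem sm_u (hQ : AdaptedAt g u y Q) (a : Fin 4) : Sm (fun z => u z a) y :=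
  hQ.obs.self_of_nhds.sm a

theorem det_ne (hQ : AdaptedAt g u y Q) : ∀ᶠ z in 𝓝 y, (Q z).det ≠ 0 :=
  hQ.par.sm.inv_eventually hQ.frame.pos.ne'

theorem det_pos (hQ : AdaptedAt g u y Q) : ∀ᶠ z in 𝓝 y, 0 < (Q z).det :=
  hQ.par.sm.det.continuousAt.eventually (lt_mem_nhds hQ.frame.pos)

theorem sm_frMetric (hQ : AdaptedAt g u y Q) : SmM (frMetric g Q) y :=
  (hQ.par.sm.transpose.mul hQ.metric_at.sm).mul hQ.par.sm

theorem frMetric_self (hQ : AdaptedAt g u y Q) : frMetric g Q y = Matrix.diagonal sgn :=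
  hQ.frame.ortho

theorem det_frMetric_self (hQ : AdaptedAt g u y Q) : (frMetric g Q y).det = -1 := by
  rw [hQ.frMetric_self, det_diagonal_sgn]

theorem frInv_self (hQ : AdaptedAt g u y Q) : (frMetric g Q y)⁻¹ = Matrix.diagonal sgn := by
  rw [hQ.frMetric_self, diagonal_sgn_inv]

theorem frInv_self_apply (hQ : AdaptedAt g u y Q) (i j : Fin 4) :
    (frMetric g Q y)⁻¹ i j = if i = j then sgn i else 0 := by
  rw [hQ.frInv_self, Matrix.diagonal_apply]

theorem sm_frInv (hQ : AdaptedAt g u y Q) : SmM (fun z => (frMetric g Q z)⁻¹) y :=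
  hQ.sm_frMetric.inv (by rw [hQ.det_frMetric_self]; norm_num)

/-- Metric compatibility together with ∇Q = 0 at y. To first order the frame metric stays
Minkowskian, hence raising indices commutes with one differentiation at y. -/
theorem pdM_frMetric (hQ : AdaptedAt g u y Q) (c : Fin 4) : pdM c (frMetric g Q) y = 0 := by
  have hs := hQ.par.sm
  have hm := hQ.metric_at
  have : frMetric g Q = fun z => (Q z)ᵀ * g z * Q z := rfl
  rw [this, pdM_mul (hs.transpose.mul hm.sm) hs, pdM_mul hs.transpose hm.sm, pdM_transpose,
    hQ.par.pd, hm.pdM_metric]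
  simp only [Matrix.transpose_neg, Matrix.transpose_mul]
  noncomm_ring

theorem pdM_frInv (hQ : AdaptedAt g u y Q) (c : Fin 4) :
    pdM c (fun z => (frMetric g Q z)⁻¹) y = 0 := by
  have hd : (frMetric g Q y).det ≠ 0 := by rw [hQ.det_frMetric_self]; norm_num
  have h1 : pdM c (fun z => (frMetric g Q z)⁻¹ * frMetric g Q z) y = 0 := by
    rw [pdM_congr ((hQ.sm_frMetric.inv_eventually hd).mono fun z hz =>
      Matrix.nonsing_inv_mul _ (isUnit_iff_ne_zero.2 hz)), pdM_const]
  rw [pdM_mul hQ.sm_frInv hQ.sm_frMetric, hQ.pdM_frMetric, mul_zero, add_zero] at h1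
  have h2 := congrArg (fun X => X * (frMetric g Q y)⁻¹) h1
  simpa [mul_assoc, Matrix.mul_nonsing_inv _ (isUnit_iff_ne_zero.2 hd)] using h2

theorem pd_frMetric (hQ : AdaptedAt g u y Q) (c i j : Fin 4) :
    pd c (fun z => frMetric g Q z i j) y = 0 := congrFun (congrFun (hQ.pdM_frMetric c) i) j

theorem pd_frInv (hQ : AdaptedAt g u y Q) (c i j : Fin 4) :
    pd c (fun z => (frMetric g Q z)⁻¹ i j) y = 0 := congrFun (congrFun (hQ.pdM_frInv c) i) j

theorem frU_self (hQ : AdaptedAt g u y Q) (i : Fin 4) :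
    fr1 (Q y) (lowerU g u y) i = if i = 0 then -1 else 0 := by
  have h := congrFun (congrFun hQ.frame.ortho i) 0
  have h1 : ((Q y)ᵀ * g y * Q y) i 0 = fr1 (Q y) (lowerU g u y) i := by
    rw [mul_assoc]
    simp only [Matrix.mul_apply, Matrix.transpose_apply, fr1, lowerU, hQ.frame.time]
  rw [← h1, h, Matrix.diagonal_apply]
  by_cases hi : i = 0 <;> simp [hi, sgn]

theorem sm_frU (hQ : AdaptedAt g u y Q) (i : Fin 4) :
    Sm (fun z => fr1 (Q z) (lowerU g u z) i) y :=
  Sm.fr1 hQ.par.sm (hQ.metric_at.sm_lowerU hQ.sm_u) i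

theorem sm_frVel (hQ : AdaptedAt g u y Q) (i : Fin 4) : Sm (fun z => frVel g u Q z i) y :=
  Sm.sum fun j => (hQ.sm_frInv i j).mul (hQ.sm_frU j)

theorem frVel_self (hQ : AdaptedAt g u y Q) (i : Fin 4) :
    frVel g u Q y i = if i = 0 then 1 else 0 := by
  simp only [frVel, hQ.frInv_self_apply, hQ.frU_self]
  by_cases hi : i = 0 <;> simp [hi, sgn]

/-- The frame components of `∇_k u_i` at `y`. -/
theorem dir_frU (hQ : AdaptedAt g u y Q) (k i : Fin 4) :
    dir (Q y) y k (fun z => fr1 (Q z) (lowerU g u z) i) = fr2 (Q y) (gradU g u y) k i := by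
  simp only [dir, hQ.par.pd_fr1' (hQ.metric_at.sm_lowerU hQ.sm_u)]
  rfl

theorem dir_frInv (hQ : AdaptedAt g u y Q) (k i j : Fin 4) :
    dir (Q y) y k (fun z => (frMetric g Q z)⁻¹ i j) = 0 := dir_eq_zero fun c => hQ.pd_frInv c i j

theorem dir_frVel (hQ : AdaptedAt g u y Q) (k i : Fin 4) :
    dir (Q y) y k (fun z => frVel g u Q z i) = sgn i * fr2 (Q y) (gradU g u y) k i := by
  simp only [frVel]
  rw [dir_sum fun j => (hQ.sm_frInv i j).mul (hQ.sm_frU j)]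
  simp only [dir_mul (hQ.sm_frInv i _) (hQ.sm_frU _), hQ.dir_frInv, hQ.dir_frU,
    hQ.frInv_self_apply]
  simp

theorem sm_frGradU (hQ : AdaptedAt g u y Q) (i j : Fin 4) :
    Sm (fun z => fr2 (Q z) (gradU g u z) i j) y :=
  Sm.fr1 hQ.par.sm (fun a => Sm.fr1 hQ.par.sm (hQ.metric_at.sm_gradU hQ.sm_u a) j) i

/-- The frame components of `∇_k ∇_i u_j` at `y`. -/
theorem dir_frGradU (hQ : AdaptedAt g u y Q) (k i j : Fin 4) :
    dir (Q y) y k (fun z => fr2 (Q z) (gradU g u z) i j)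
      = fr3 (Q y) (nabla2 g (gradU g u) y) k i j := by
  simp only [dir, hQ.par.pd_fr2 (hQ.metric_at.sm_gradU hQ.sm_u)]
  rfl

theorem sm_frGradUp (hQ : AdaptedAt g u y Q) : SmM (frGradUp g u Q) y :=
  (hQ.sm_frInv.mul (fun i j => hQ.sm_frGradU i j)).mul hQ.sm_frInv.transpose

theorem frGradUp_self (hQ : AdaptedAt g u y Q) (i j : Fin 4) :
    frGradUp g u Q y i j = sgn i * sgn j * fr2 (Q y) (gradU g u y) i j := by
  rw [frGradUp, hQ.frInv_self, Matrix.diagonal_transpose, Matrix.mul_diagonal,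
    Matrix.diagonal_mul, Matrix.of_apply]
  ring

/-- The inverse frame metric has zero derivative at y, so the raised indices contribute only signs.
-/
theorem dir_frGradUp (hQ : AdaptedAt g u y Q) (k i j : Fin 4) :
    dir (Q y) y k (fun z => frGradUp g u Q z i j)
      = sgn i * sgn j * fr3 (Q y) (nabla2 g (gradU g u) y) k i j := by
  have h : ∀ c, pd c (fun z => frGradUp g u Q z i j) y
      = sgn i * sgn j * pd c (fun z => fr2 (Q z) (gradU g u z) i j) y := by
    intro c
    have s1 : SmM (fun z => Matrix.of (fr2 (Q z) (gradU g u z))) y := fun i j => hQ.sm_frGradU i j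
    have e : pdM c (frGradUp g u Q) y = Matrix.diagonal sgn *
        pdM c (fun z => Matrix.of (fr2 (Q z) (gradU g u z))) y * Matrix.diagonal sgn := by
      have : frGradUp g u Q = fun z => (frMetric g Q z)⁻¹ * Matrix.of (fr2 (Q z) (gradU g u z)) *
        ((frMetric g Q z)⁻¹)ᵀ := rfl
      rw [this, pdM_mul (hQ.sm_frInv.mul s1) hQ.sm_frInv.transpose, pdM_mul hQ.sm_frInv s1,
        pdM_transpose, hQ.pdM_frInv, hQ.frInv_self]
      simp
    have e' := congrFun (congrFun e i) j
    rw [Matrix.mul_diagonal, Matrix.diagonal_mul] at e'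
    rw [← pdM_apply, e', pdM_apply]
    simp only [Matrix.of_apply]
    ring
  simp only [dir, h, fr1_const_mul]
  rw [← hQ.dir_frGradU]
  rfl

end AdaptedAt

end

noncomputable section

open Filter Topology Matrix

variable {g : E4 → Matrix (Fin 4) (Fin 4) ℝ} {u : E4 → Fin 4 → ℝ} {y : E4}

/-! ### Consequences of `g(u, u) = -1` -/

theorem ObserverAt.unit (h : ObserverAt g u y) : ∑ b, lowerU g u y b * u y b = -1 := by
  obtain ⟨P, hP⟩ := h.frame
  have h1 := congrFun (congrFun hP.ortho 0) 0
  rw [Matrix.diagonal_apply_eq] at h1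
  have h2 : (Pᵀ * g y * P) 0 0 = ∑ b, lowerU g u y b * u y b := by
    rw [mul_assoc]
    simp only [Matrix.mul_apply, Matrix.transpose_apply, lowerU, hP.time]
    exact Finset.sum_congr rfl fun _ _ => mul_comm _ _
  rw [← h2, h1]; simp [sgn]

namespace AdaptedAt

variable {Q : E4 → Matrix (Fin 4) (Fin 4) ℝ}

theorem vel (hQ : AdaptedAt g u y Q) : ∀ᶠ z in 𝓝 y, ∀ a, u z a = ∑ i, Q z a i * frVel g u Q z i := by
  filter_upwards [hQ.det_ne, hQ.metric] with z h1 h2 a using vel_eq_frame h2.det h1 a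

/-- The derivative of g(u, u) = -1: u is orthogonal to each of its covariant derivatives. -/
theorem frGradU_zero (hQ : AdaptedAt g u y Q) (k : Fin 4) :
    fr2 (Q y) (gradU g u y) k 0 = 0 := by
  have h1 : ∀ᶠ z in 𝓝 y, ∑ i, fr1 (Q z) (lowerU g u z) i * frVel g u Q z i = -1 := by
    filter_upwards [hQ.vel, hQ.obs] with z hz hz'
    rw [← sum_mul_vector hz, hz'.unit]
  have h2 := dir_congr (P := Q y) (k := k) h1
  rw [dir_const, dir_sum fun i => (hQ.sm_frU i).mul (hQ.sm_frVel i)] at h2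
  simp only [dir_mul (hQ.sm_frU _) (hQ.sm_frVel _), hQ.dir_frU, hQ.dir_frVel, hQ.frU_self,
    hQ.frVel_self, Finset.sum_add_distrib] at h2
  simp [sgn, Fin.sum_univ_four] at h2
  linarith

end AdaptedAt

theorem gradU_vel (h : ∀ᶠ z in 𝓝 y, ObserverAt g u z) (a : Fin 4) :
    ∑ b, gradU g u y a b * u y b = 0 := by
  obtain ⟨Q, hQ⟩ := exists_adapted h
  refine fr1_injective hQ.frame.pos.ne' (A := fun a => ∑ b, gradU g u y a b * u y b) (fun i => ?_) a
  rw [← hQ.frGradU_zero i, fr2]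
  congr 1
  funext a
  simp only [fr1, ← hQ.frame.time, mul_comm]

/-! ### The divergence of the Weyl tensor -/

namespace AdaptedAt

variable {Q : E4 → Matrix (Fin 4) (Fin 4) ℝ}

theorem sm_frWeyl (hQ : AdaptedAt g u y Q) (i j k l : Fin 4) :
    Sm (fun z => fr4 (Q z) (weyl g z) i j k l) y :=
  Sm.fr1 hQ.par.sm (fun a => Sm.fr1 hQ.par.sm (fun b => Sm.fr1 hQ.par.sm (fun c =>
    Sm.fr1 hQ.par.sm (fun d => hQ.metric_at.sm_weyl a b c d) l) k) j) i

theorem dir_frWeyl (hQ : AdaptedAt g u y Q) (m i j k l : Fin 4) :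
    dir (Q y) y m (fun z => fr4 (Q z) (weyl g z) i j k l)
      = fr1 (Q y) (fun e => fr4 (Q y) (nabla4 g (weyl g) y e) i j k l) m := by
  simp only [dir, hQ.par.pd_fr4 hQ.metric_at.sm_weyl]

end AdaptedAt

/-! ### Symmetries of the Weyl tensor in a frame -/

section FrameWeyl

theorem frWeyl_antisymm_right (g : E4 → Matrix (Fin 4) (Fin 4) ℝ) (y : E4)
    (P : Matrix (Fin 4) (Fin 4) ℝ) (i j k l : Fin 4) :
    fr4 P (weyl g y) i j k l = -fr4 P (weyl g y) i j l k := by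
  simp only [fr4, ← fr1_neg]
  congr 1; funext a; congr 1; funext b
  rw [fr1_comm]
  congr 1; funext c; congr 1; funext d
  exact weyl_antisymm_right g y _ _ _ _

theorem frWeyl_pair (hg : ∀ᶠ z in 𝓝 y, MetricAt g z) (P : Matrix (Fin 4) (Fin 4) ℝ)
    (i j k l : Fin 4) : fr4 P (weyl g y) i j k l = fr4 P (weyl g y) k l i j := by
  simp only [fr4]
  have e : ∀ a, fr1 P (fun b => fr1 P (fun c => fr1 P (fun d => weyl g y a b c d) l) k) j
      = fr1 P (fun c => fr1 P (fun d => fr1 P (fun b => weyl g y a b c d) j) l) k := by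
    intro a
    rw [fr1_comm]
    congr 1; funext c
    rw [fr1_comm]
  simp only [e]
  rw [fr1_comm]
  congr 1; funext c
  rw [fr1_comm]
  congr 1; funext d; congr 1; funext a; congr 1; funext b
  exact weyl_pair hg _ _ _ _

theorem frWeyl_antisymm_left (hg : ∀ᶠ z in 𝓝 y, MetricAt g z) (P : Matrix (Fin 4) (Fin 4) ℝ)
    (i j k l : Fin 4) : fr4 P (weyl g y) i j k l = -fr4 P (weyl g y) j i k l := by
  rw [frWeyl_pair hg, frWeyl_antisymm_right, frWeyl_pair hg]

theorem frWeyl_cyclic (hg : ∀ᶠ z in 𝓝 y, MetricAt g z) (P : Matrix (Fin 4) (Fin 4) ℝ)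
    (i j k l : Fin 4) :
    fr4 P (weyl g y) i j k l + fr4 P (weyl g y) i k l j + fr4 P (weyl g y) i l j k = 0 := by
  simp only [fr4]
  rw [← fr1_add, ← fr1_add]
  refine fr1_eq_zero fun a => ?_
  have e1 : fr1 P (fun b => fr1 P (fun c => fr1 P (fun d => weyl g y a b c d) j) l) k
      = fr1 P (fun b => fr1 P (fun c => fr1 P (fun d => weyl g y a c d b) l) k) j := by
    have : ∀ b, fr1 P (fun c => fr1 P (fun d => weyl g y a b c d) j) l
        = fr1 P (fun d => fr1 P (fun c => weyl g y a b c d) l) j := fun b => fr1_comm _ _ _ _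
    simp only [this]
    rw [fr1_comm]
  have e2 : fr1 P (fun b => fr1 P (fun c => fr1 P (fun d => weyl g y a b c d) k) j) l
      = fr1 P (fun b => fr1 P (fun c => fr1 P (fun d => weyl g y a d b c) l) k) j := by
    rw [fr1_comm]
    congr 1; funext b
    rw [fr1_comm]
  rw [e1, e2]
  simp only [← fr1_add]
  exact fr1_eq_zero fun b => fr1_eq_zero fun c => fr1_eq_zero fun d => weyl_cyclic hg a b c d

/-- Stated for any nondegenerate frame, with the inverse frame metric in place of signs, so that it
holds near y and its derivative can be taken. -/
theorem frWeyl_trace {z : E4} {Q : E4 → Matrix (Fin 4) (Fin 4) ℝ} (hg : MetricAt g z)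
    (hQ : (Q z).det ≠ 0) (j l : Fin 4) :
    ∑ i, ∑ k, fr4 (Q z) (weyl g z) i j k l * (frMetric g Q z)⁻¹ i k = 0 := by
  have h := fun b d => hg.trace_weyl b d
  have h1 : ∀ b d, ∑ i, ∑ k, fr2 (Q z) (fun a c => weyl g z a b c d) i k * (frMetric g Q z)⁻¹ i k
      = 0 := by
    intro b d
    rw [← sum_mul_bivector (gInv_eq_frame hQ), ← h b d]
    exact Finset.sum_congr rfl fun _ _ => Finset.sum_congr rfl fun _ _ => mul_comm _ _
  have h2 : ∀ i k, fr4 (Q z) (weyl g z) i j k l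
      = fr1 (Q z) (fun b => fr1 (Q z) (fun d => fr2 (Q z) (fun a c => weyl g z a b c d) i k) l) j := by
    intro i k
    simp only [fr4, fr2]
    rw [fr1_comm]
    congr 1; funext b
    have : ∀ a, fr1 (Q z) (fun c => fr1 (Q z) (fun d => weyl g z a b c d) l) k
        = fr1 (Q z) (fun d => fr1 (Q z) (fun c => weyl g z a b c d) k) l := fun a => fr1_comm _ _ _ _
    simp only [this]
    rw [fr1_comm]
  simp only [h2, ← fr1_mul_const, ← fr1_sum, h1, fr1_zero]

end FrameWeyl

namespace AdaptedAt

variable {Q : E4 → Matrix (Fin 4) (Fin 4) ℝ}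

theorem frWeyl_trace_self (hQ : AdaptedAt g u y Q) (j l : Fin 4) :
    ∑ i, sgn i * fr4 (Q y) (weyl g y) i j i l = 0 := by
  rw [← frWeyl_trace hQ.metric_at hQ.frame.pos.ne' j l]
  simp [hQ.frInv_self_apply, mul_comm]

/-- When the trace identity is differentiated at y, the term with the derivative of the inverse
frame metric drops out. -/
theorem dir_frWeyl_trace (hQ : AdaptedAt g u y Q) (m j l : Fin 4) :
    ∑ i, sgn i * dir (Q y) y m (fun z => fr4 (Q z) (weyl g z) i j i l) = 0 := by
  have h1 : ∀ᶠ z in 𝓝 y,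
      ∑ i, ∑ k, fr4 (Q z) (weyl g z) i j k l * (frMetric g Q z)⁻¹ i k = 0 := by
    filter_upwards [hQ.metric, hQ.det_ne] with z h1 h2 using frWeyl_trace h1 h2 j l
  have h2 := dir_congr (P := Q y) (k := m) h1
  have s : ∀ i k, Sm (fun z => fr4 (Q z) (weyl g z) i j k l * (frMetric g Q z)⁻¹ i k) y :=
    fun i k => (hQ.sm_frWeyl i j k l).mul (hQ.sm_frInv i k)
  rw [dir_const, dir_sum fun i => Sm.sum (s i)] at h2
  simp only [dir_sum (s _), dir_mul (hQ.sm_frWeyl _ _ _ _) (hQ.sm_frInv _ _), hQ.dir_frInv,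
    hQ.frInv_self_apply] at h2
  rw [← h2]
  simp [mul_comm]

theorem dir_frWeyl_bianchi (hQ : AdaptedAt g u y Q) (hC : ∀ a b c, cotton g y a b c = 0)
    (m i j k l : Fin 4) :
    dir (Q y) y m (fun z => fr4 (Q z) (weyl g z) i j k l)
      + dir (Q y) y k (fun z => fr4 (Q z) (weyl g z) i j l m)
      + dir (Q y) y l (fun z => fr4 (Q z) (weyl g z) i j m k) = 0 := by
  simp only [hQ.dir_frWeyl]
  set N := nabla4 g (weyl g) y with hN
  set P := Q y
  have B : ∀ e a b c d, N e a b c d + N c a b d e + N d a b e c = 0 :=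
    fun e a b c d => bianchi_weyl hQ.metric hC e a b c d
  have key : ∀ m k l, fr1 P (fun e => fr4 P (N e) i j k l) m
      = fr1 P (fun a => fr1 P (fun b => fr1 P (fun e => fr1 P (fun c => fr1 P (fun d =>
        N e a b c d) l) k) m) j) i := by
    intro m k l
    simp only [fr4]
    rw [fr1_comm]
    congr 1; funext a
    rw [fr1_comm]
  -- The frame contractions are reordered so that all three cyclic terms carry the same nesting; the
  -- coordinate Bianchi identity then applies under the contractions.
  have r1 : ∀ a b, fr1 P (fun e => fr1 P (fun c => fr1 P (fun d => N e a b c d) m) l) k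
      = fr1 P (fun e => fr1 P (fun c => fr1 P (fun d => N c a b d e) l) k) m := by
    intro a b
    have : ∀ e, fr1 P (fun c => fr1 P (fun d => N e a b c d) m) l
        = fr1 P (fun d => fr1 P (fun c => N e a b c d) l) m := fun e => fr1_comm _ _ _ _
    simp only [this]
    rw [fr1_comm]
  have r2 : ∀ a b, fr1 P (fun e => fr1 P (fun c => fr1 P (fun d => N e a b c d) k) m) l
      = fr1 P (fun e => fr1 P (fun c => fr1 P (fun d => N d a b e c) l) k) m := by
    intro a b
    rw [fr1_comm]
    congr 1; funext e
    rw [fr1_comm]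
  rw [key, key, key]
  simp only [r1, r2, ← fr1_add, B, fr1_zero]

/-- The contracted Bianchi identity: tracing the derivative index against the first index leaves two
derivatives of traces of W, both zero. -/
theorem div_frWeyl (hQ : AdaptedAt g u y Q) (hC : ∀ a b c, cotton g y a b c = 0)
    (j k l : Fin 4) :
    ∑ i, sgn i * dir (Q y) y i (fun z => fr4 (Q z) (weyl g z) i j k l) = 0 := by
  have h1 := hQ.dir_frWeyl_trace k j l
  have h2 := hQ.dir_frWeyl_trace l j k
  have e : ∀ i, sgn i * dir (Q y) y i (fun z => fr4 (Q z) (weyl g z) i j k l)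
      = sgn i * dir (Q y) y k (fun z => fr4 (Q z) (weyl g z) i j i l)
        - sgn i * dir (Q y) y l (fun z => fr4 (Q z) (weyl g z) i j i k) := by
    intro i
    have b := hQ.dir_frWeyl_bianchi hC i i j k l
    have a : dir (Q y) y k (fun z => fr4 (Q z) (weyl g z) i j l i)
        = -dir (Q y) y k (fun z => fr4 (Q z) (weyl g z) i j i l) := by
      rw [← dir_neg]
      congr 1; funext z; exact frWeyl_antisymm_right g z (Q z) i j l i
    rw [a] at b
    linear_combination (sgn i) * b
  simp only [e, Finset.sum_sub_distrib, h1, h2, sub_zero]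

/-- The divergence on the third index. -/
theorem div_frWeyl' (hQ : AdaptedAt g u y Q) (hC : ∀ a b c, cotton g y a b c = 0)
    (i j l : Fin 4) :
    ∑ k, sgn k * dir (Q y) y k (fun z => fr4 (Q z) (weyl g z) i j k l) = 0 := by
  rw [← hQ.div_frWeyl hC l i j]
  refine Finset.sum_congr rfl fun k _ => ?_
  congr 1
  exact dir_congr (hQ.metric.eventually_nhds.mono fun z hz => frWeyl_pair hz _ _ _ _ _)

/-! ### Integrability conditions of `E = 0` -/

end AdaptedAt

/-- The covector `W_{abcd} (∇^c u^b u^d + u^b ∇^c u^d)`, which is `∇^c E_{ac}` when the Weyl tensor is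
divergence-free. -/
def divElectric (g : E4 → Matrix (Fin 4) (Fin 4) ℝ) (u : E4 → Fin 4 → ℝ) (z : E4) (a : Fin 4) : ℝ :=
  ∑ b, (∑ c, ∑ d, weyl g z a b c d * gradUp g u z c d) * u z b
    + ∑ d, (∑ c, ∑ b, weyl g z a b c d * gradUp g u z c b) * u z d

theorem fr2_contract_vel {v V : Fin 4 → ℝ} {P : Matrix (Fin 4) (Fin 4) ℝ}
    (hV : ∀ a, v a = ∑ i, P a i * V i) (W : Fin 4 → Fin 4 → Fin 4 → Fin 4 → ℝ) (i k : Fin 4) :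
    fr2 P (fun a c => ∑ b, ∑ d, W a b c d * v b * v d) i k
      = ∑ j, ∑ l, fr4 P W i j k l * V j * V l := by
  have h : ∀ a c, ∑ b, ∑ d, W a b c d * v b * v d
      = ∑ j, (∑ l, fr1 P (fun b => fr1 P (fun d => W a b c d) l) j * V l) * V j := by
    intro a c
    have h1 : ∑ b, ∑ d, W a b c d * v b * v d = ∑ b, (∑ d, W a b c d * v d) * v b := by
      simp only [Finset.sum_mul]
      exact Finset.sum_congr rfl fun _ _ => Finset.sum_congr rfl fun _ _ => by ring
    rw [h1, sum_mul_vector hV]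
    refine Finset.sum_congr rfl fun j _ => ?_
    congr 1
    simp only [sum_mul_vector hV, fr1_sum, fr1_mul_const]
  simp only [fr2, h, fr1_sum, fr1_mul_const, Finset.sum_mul, fr4]
  refine Finset.sum_congr rfl fun j _ => Finset.sum_congr rfl fun l _ => ?_
  have e : ∀ a, fr1 P (fun c => fr1 P (fun b => fr1 P (fun d => W a b c d) l) j) k
      = fr1 P (fun b => fr1 P (fun c => fr1 P (fun d => W a b c d) l) k) j :=
    fun a => fr1_comm _ _ _ _
  simp only [e]
  ring

/-- A formula valid in any frame in which u and ∇^a u^b are expanded. It is used at y to compute and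
near y to differentiate. -/
theorem fr1_divElectric {z : E4} {P L : Matrix (Fin 4) (Fin 4) ℝ} {V : Fin 4 → ℝ}
    (hV : ∀ a, u z a = ∑ i, P a i * V i) (hL : gradUp g u z = P * L * Pᵀ) (i : Fin 4) :
    fr1 P (divElectric g u z) i = ∑ j, ∑ k, ∑ l, fr4 P (weyl g z) i j k l * (L k l * V j + L k j * V l) := by
  have h1 : ∀ a, ∑ b, (∑ c, ∑ d, weyl g z a b c d * gradUp g u z c d) * u z b
      = ∑ j, ∑ k, ∑ l, fr1 P (fun b => fr1 P (fun c => fr1 P (fun d => weyl g z a b c d) l) k) j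
        * L k l * V j := by
    intro a
    rw [sum_mul_vector hV]
    refine Finset.sum_congr rfl fun j _ => ?_
    simp only [sum_mul_bivector hL, fr1_sum, fr1_mul_const, Finset.sum_mul, fr2]
  have h2 : ∀ a, ∑ d, (∑ c, ∑ b, weyl g z a b c d * gradUp g u z c b) * u z d
      = ∑ l, ∑ k, ∑ j, fr1 P (fun d => fr1 P (fun c => fr1 P (fun b => weyl g z a b c d) j) k) l
        * L k j * V l := by
    intro a
    rw [sum_mul_vector hV]
    refine Finset.sum_congr rfl fun j _ => ?_
    simp only [sum_mul_bivector hL (fun c b => weyl g z a b c _), fr1_sum, fr1_mul_const,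
      Finset.sum_mul, fr2]
  have e : ∀ a j k l, fr1 P (fun d => fr1 P (fun c => fr1 P (fun b => weyl g z a b c d) j) k) l
      = fr1 P (fun b => fr1 P (fun c => fr1 P (fun d => weyl g z a b c d) l) k) j := by
    intro a j k l
    have : ∀ d, fr1 P (fun c => fr1 P (fun b => weyl g z a b c d) j) k
        = fr1 P (fun b => fr1 P (fun c => weyl g z a b c d) k) j := fun d => fr1_comm _ _ _ _
    simp only [this]
    rw [fr1_comm]
    congr 1; funext b
    rw [fr1_comm]
  have h3 : fr1 P (divElectric g u z) i = fr1 P (fun a => ∑ j, ∑ k, ∑ l,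
      fr1 P (fun b => fr1 P (fun c => fr1 P (fun d => weyl g z a b c d) l) k) j * L k l * V j
      + ∑ l, ∑ k, ∑ j,
      fr1 P (fun b => fr1 P (fun c => fr1 P (fun d => weyl g z a b c d) l) k) j * L k j * V l) i := by
    congr 1; funext a
    rw [divElectric, h1, h2]
    simp only [e]
  rw [h3, fr1_add]
  simp only [fr1_sum, fr1_mul_const, mul_add, Finset.sum_add_distrib]
  congr 1
  · refine Finset.sum_congr rfl fun _ _ => Finset.sum_congr rfl fun _ _ =>
      Finset.sum_congr rfl fun _ _ => ?_
    simp only [fr4]; ring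
  · have sw : ∀ F : Fin 4 → Fin 4 → Fin 4 → ℝ, ∑ l, ∑ k, ∑ j, F l k j = ∑ j, ∑ k, ∑ l, F l k j := by
      intro F
      rw [Finset.sum_comm]
      have : ∀ k, ∑ l, ∑ j, F l k j = ∑ j, ∑ l, F l k j := fun k => Finset.sum_comm
      simp only [this]
      rw [Finset.sum_comm]
    rw [sw]
    refine Finset.sum_congr rfl fun _ _ => Finset.sum_congr rfl fun _ _ =>
      Finset.sum_congr rfl fun _ _ => ?_
    simp only [fr4]; ring

end

noncomputable section

open Filter Topology Matrix

variable {g : E4 → Matrix (Fin 4) (Fin 4) ℝ} {u : E4 → Fin 4 → ℝ} {y : E4}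

namespace AdaptedAt

variable {Q : E4 → Matrix (Fin 4) (Fin 4) ℝ}

theorem gradUp_frame (hQ : AdaptedAt g u y Q) :
    ∀ᶠ z in 𝓝 y, gradUp g u z = Q z * frGradUp g u Q z * (Q z)ᵀ := by
  filter_upwards [hQ.det_ne] with z h1 using gradUp_eq_frame h1

theorem fr1_divElectric_self (hQ : AdaptedAt g u y Q) (i : Fin 4) :
    fr1 (Q y) (divElectric g u y) i =
      ∑ j, ∑ k, sgn j * sgn k * fr4 (Q y) (weyl g y) i j k 0 * fr2 (Q y) (gradU g u y) k j
      + ∑ k, ∑ l, sgn k * sgn l * fr4 (Q y) (weyl g y) i 0 k l * fr2 (Q y) (gradU g u y) k l := by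
  rw [fr1_divElectric hQ.vel.self_of_nhds hQ.gradUp_frame.self_of_nhds]
  simp only [hQ.frVel_self, hQ.frGradUp_self, mul_add, Finset.sum_add_distrib]
  rw [add_comm]
  congr 1
  · refine Finset.sum_congr rfl fun j _ => Finset.sum_congr rfl fun k _ => ?_
    simp; ring
  · rw [Finset.sum_comm]
    refine Finset.sum_congr rfl fun k _ => ?_
    rw [Finset.sum_comm]
    refine Finset.sum_congr rfl fun l _ => ?_
    simp; ring

/-- With vanishing Cotton tensor, `E = 0` forces the divergence of `E` to vanish. -/
theorem divElectric_eq_zero (hQ : AdaptedAt g u y Q) (hC : ∀ a b c, cotton g y a b c = 0)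
    (hE : ∀ᶠ z in 𝓝 y, ∀ a b, electricWeyl g u z a b = 0) (a : Fin 4) :
    divElectric g u y a = 0 := by
  refine fr1_injective hQ.frame.pos.ne' (fun i => ?_) a
  -- E = 0 in frame components on a neighbourhood, ready to be differentiated along the leg k and
  -- traced over k.
  have h1 : ∀ k, ∀ᶠ z in 𝓝 y, ∑ j, ∑ l, fr4 (Q z) (weyl g z) i j k l * frVel g u Q z j
      * frVel g u Q z l = 0 := by
    intro k
    filter_upwards [hQ.vel, hE] with z hz h0
    rw [← fr2_contract_vel hz]
    exact fr1_eq_zero fun a => fr1_eq_zero fun b => h0 a b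
  have h2 : ∀ k, ∑ j, ∑ l, (dir (Q y) y k (fun z => fr4 (Q z) (weyl g z) i j k l)
      * (if j = 0 then 1 else 0) * (if l = 0 then 1 else 0)
      + fr4 (Q y) (weyl g y) i j k l * (sgn j * fr2 (Q y) (gradU g u y) k j)
        * (if l = 0 then 1 else 0)
      + fr4 (Q y) (weyl g y) i j k l * (if j = 0 then 1 else 0)
        * (sgn l * fr2 (Q y) (gradU g u y) k l)) = 0 := by
    intro k
    have h := dir_congr (P := Q y) (k := k) (h1 k)
    have s1 : ∀ j l, Sm (fun z => fr4 (Q z) (weyl g z) i j k l * frVel g u Q z j) y :=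
      fun j l => (hQ.sm_frWeyl i j k l).mul (hQ.sm_frVel j)
    have s2 : ∀ j l, Sm (fun z => fr4 (Q z) (weyl g z) i j k l * frVel g u Q z j
        * frVel g u Q z l) y := fun j l => (s1 j l).mul (hQ.sm_frVel l)
    rw [dir_const, dir_sum fun j => Sm.sum (s2 j)] at h
    refine Eq.trans ?_ h
    refine Finset.sum_congr rfl fun j _ => ?_
    rw [dir_sum (s2 j)]
    refine Finset.sum_congr rfl fun l _ => ?_
    rw [dir_mul (s1 j l) (hQ.sm_frVel l), dir_mul (hQ.sm_frWeyl i j k l) (hQ.sm_frVel j),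
      hQ.dir_frVel, hQ.dir_frVel, hQ.frVel_self, hQ.frVel_self]
    ring
  have h3 : ∑ k, sgn k * ∑ j, ∑ l, (dir (Q y) y k (fun z => fr4 (Q z) (weyl g z) i j k l)
      * (if j = 0 then 1 else 0) * (if l = 0 then 1 else 0)
      + fr4 (Q y) (weyl g y) i j k l * (sgn j * fr2 (Q y) (gradU g u y) k j)
        * (if l = 0 then 1 else 0)
      + fr4 (Q y) (weyl g y) i j k l * (if j = 0 then 1 else 0)
        * (sgn l * fr2 (Q y) (gradU g u y) k l)) = 0 := by
    simp only [h2, mul_zero, Finset.sum_const_zero]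
  -- This removes the only terms in which W is differentiated; the rest is the frame component of
  -- `divElectric`.
  have h4 := hQ.div_frWeyl' hC i 0 0
  rw [hQ.fr1_divElectric_self]
  simp only [Finset.sum_add_distrib, mul_ite, mul_one, mul_zero, Finset.sum_ite_eq',
    Finset.mem_univ, if_true, mul_add, ite_mul, zero_mul] at h3
  have e2 : ∀ k, ∑ j, ∑ l, (if j = 0 then
      fr4 (Q y) (weyl g y) i j k l * (sgn l * fr2 (Q y) (gradU g u y) k l) else 0)
      = ∑ l, fr4 (Q y) (weyl g y) i 0 k l * (sgn l * fr2 (Q y) (gradU g u y) k l) := by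
    intro k; rw [Finset.sum_comm]; simp
  simp only [e2, h4, zero_add] at h3
  refine Eq.trans ?_ h3
  rw [Finset.sum_comm]
  congr 1
  · refine Finset.sum_congr rfl fun k _ => ?_
    rw [Finset.mul_sum]
    exact Finset.sum_congr rfl fun j _ => by ring
  · refine Finset.sum_congr rfl fun k _ => ?_
    rw [Finset.mul_sum]
    exact Finset.sum_congr rfl fun j _ => by ring

/-- The divergence of the identity `∇^c E_{ac} = 0`. -/
theorem div_divElectric (hQ : AdaptedAt g u y Q)
    (hC : ∀ᶠ z in 𝓝 y, ∀ a b c, cotton g z a b c = 0)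
    (hE : ∀ᶠ z in 𝓝 y, ∀ a b, electricWeyl g u z a b = 0) :
    ∑ i, ∑ j, ∑ k, ∑ l, sgn i * fr4 (Q y) (weyl g y) i j k l *
      (sgn k * sgn l * fr3 (Q y) (nabla2 g (gradU g u) y) i k l * (if j = 0 then 1 else 0)
        + sgn k * sgn l * fr2 (Q y) (gradU g u y) k l * (sgn j * fr2 (Q y) (gradU g u y) i j)
        + (sgn k * sgn j * fr3 (Q y) (nabla2 g (gradU g u) y) i k j * (if l = 0 then 1 else 0)
        + sgn k * sgn j * fr2 (Q y) (gradU g u y) k j * (sgn l * fr2 (Q y) (gradU g u y) i l)))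
      = 0 := by
  -- The first integrability condition is needed on a whole neighbourhood. It is proved at each
  -- nearby point with a frame adapted to that point, not with `Q`.
  have hV : ∀ᶠ z in 𝓝 y, ∀ a, divElectric g u z a = 0 := by
    filter_upwards [hQ.obs.eventually_nhds, hC, hE.eventually_nhds] with z h1 h2 h3 a
    obtain ⟨Q', hQ'⟩ := exists_adapted h1
    exact hQ'.divElectric_eq_zero h2 h3 a
  have h1 : ∀ i, ∀ᶠ z in 𝓝 y, ∑ j, ∑ k, ∑ l, fr4 (Q z) (weyl g z) i j k l *
      (frGradUp g u Q z k l * frVel g u Q z j + frGradUp g u Q z k j * frVel g u Q z l) = 0 := by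
    intro i
    filter_upwards [hV, hQ.vel, hQ.gradUp_frame] with z h1 h2 h3
    rw [← fr1_divElectric h2 h3]
    exact fr1_eq_zero h1
  have sw := hQ.sm_frWeyl
  have sv := hQ.sm_frVel
  have sb := hQ.sm_frGradUp
  have h2 : ∀ i, ∑ j, ∑ k, ∑ l, (dir (Q y) y i (fun z => fr4 (Q z) (weyl g z) i j k l)
      * (sgn k * sgn l * fr2 (Q y) (gradU g u y) k l * (if j = 0 then 1 else 0)
        + sgn k * sgn j * fr2 (Q y) (gradU g u y) k j * (if l = 0 then 1 else 0))
      + fr4 (Q y) (weyl g y) i j k l *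
      (sgn k * sgn l * fr3 (Q y) (nabla2 g (gradU g u) y) i k l * (if j = 0 then 1 else 0)
        + sgn k * sgn l * fr2 (Q y) (gradU g u y) k l * (sgn j * fr2 (Q y) (gradU g u y) i j)
        + (sgn k * sgn j * fr3 (Q y) (nabla2 g (gradU g u) y) i k j * (if l = 0 then 1 else 0)
        + sgn k * sgn j * fr2 (Q y) (gradU g u y) k j * (sgn l * fr2 (Q y) (gradU g u y) i l))))
      = 0 := by
    intro i
    have h := dir_congr (P := Q y) (k := i) (h1 i)
    have s1 : ∀ j k l, Sm (fun z => frGradUp g u Q z k l * frVel g u Q z j) y :=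
      fun j k l => (sb k l).mul (sv j)
    have s2 : ∀ j k l, Sm (fun z => frGradUp g u Q z k l * frVel g u Q z j
        + frGradUp g u Q z k j * frVel g u Q z l) y := fun j k l => (s1 j k l).add (s1 l k j)
    have s3 := fun j k l => (sw i j k l).mul (s2 j k l)
    rw [dir_const, dir_sum fun j => Sm.sum fun k => Sm.sum fun l => s3 j k l] at h
    refine Eq.trans ?_ h
    refine Finset.sum_congr rfl fun j _ => ?_
    rw [dir_sum fun k => Sm.sum fun l => s3 j k l]
    refine Finset.sum_congr rfl fun k _ => ?_
    rw [dir_sum fun l => s3 j k l]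
    refine Finset.sum_congr rfl fun l _ => ?_
    rw [dir_mul (sw i j k l) (s2 j k l), dir_add (s1 j k l) (s1 l k j), dir_mul (sb k l) (sv j),
      dir_mul (sb k j) (sv l), hQ.dir_frGradUp, hQ.dir_frGradUp, hQ.dir_frVel, hQ.dir_frVel,
      hQ.frVel_self, hQ.frVel_self, hQ.frGradUp_self, hQ.frGradUp_self]
  -- In the second divergence the derivative is contracted with the first index of W, so these terms
  -- vanish by the contracted Bianchi identity.
  have h3 : ∑ i, sgn i * ∑ j, ∑ k, ∑ l, dir (Q y) y i (fun z => fr4 (Q z) (weyl g z) i j k l)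
      * (sgn k * sgn l * fr2 (Q y) (gradU g u y) k l * (if j = 0 then 1 else 0)
        + sgn k * sgn j * fr2 (Q y) (gradU g u y) k j * (if l = 0 then 1 else 0)) = 0 := by
    have d := fun j k l => hQ.div_frWeyl hC.self_of_nhds j k l
    simp only [Finset.mul_sum]
    rw [Finset.sum_comm]
    refine Finset.sum_eq_zero fun j _ => ?_
    rw [Finset.sum_comm]
    refine Finset.sum_eq_zero fun k _ => ?_
    rw [Finset.sum_comm]
    refine Finset.sum_eq_zero fun l _ => ?_
    simp only [← mul_assoc, ← Finset.sum_mul]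
    rw [d, zero_mul]
  have split : ∀ F H : Fin 4 → Fin 4 → Fin 4 → Fin 4 → ℝ,
      (∀ i, ∑ j, ∑ k, ∑ l, (F i j k l + H i j k l) = 0) →
      ∑ i, sgn i * ∑ j, ∑ k, ∑ l, F i j k l = 0 →
      ∑ i, ∑ j, ∑ k, ∑ l, sgn i * H i j k l = 0 := by
    intro F H h h'
    have e : ∀ i, ∑ j, ∑ k, ∑ l, sgn i * H i j k l = -(sgn i * ∑ j, ∑ k, ∑ l, F i j k l) := by
      intro i
      have := h i
      simp only [Finset.sum_add_distrib] at this
      simp only [← Finset.mul_sum]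
      linear_combination sgn i * this
    simp only [e, Finset.sum_neg_distrib, h', neg_zero]
  have h4 := split _ _ h2 h3
  simp only [mul_assoc] at h4 ⊢
  exact h4

end AdaptedAt

/-! ### The Ricci identity -/

/-- The Ricci identity for a covector field. -/
theorem ricci_identity (hg : ∀ᶠ z in 𝓝 y, MetricAt g z) {A : E4 → Fin 4 → ℝ}
    (hA : ∀ a, Sm (fun z => A z a) y) (c a b : Fin 4) :
    nabla2 g (nabla1 g A) y c a b - nabla2 g (nabla1 g A) y a c b
      = -∑ e, riemannUp g y e b c a * A y e := by
  have h := hg.self_of_nhds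
  have key : ∀ c a, pd c (fun z => nabla1 g A z a b) y = pd c (pd a (fun z => A z b)) y
      - ∑ e, (pd c (christoffel g e a b) y * A y e
        + christoffel g e a b y * pd c (fun z => A z e) y) := by
    intro c a
    have s : ∀ e, Sm (fun z => christoffel g e a b z * A z e) y :=
      fun e => (h.sm_christoffel e a b).mul (hA e)
    simp only [nabla1]
    rw [pd_sub ((hA b).pd a) (Sm.sum s), pd_sum s]
    simp only [pd_mul (h.sm_christoffel _ a b) (hA _)]
  have e1 : ∀ c a, ∑ e, christoffel g e c b y * ∑ f, christoffel g f a e y * A y f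
      = ∑ e, (∑ f, christoffel g e a f y * christoffel g f c b y) * A y e := by
    intro c a
    simp only [Finset.mul_sum, Finset.sum_mul]
    rw [Finset.sum_comm]
    exact Finset.sum_congr rfl fun _ _ => Finset.sum_congr rfl fun _ _ => by ring
  have e2 : ∑ e, christoffel g e c a y * nabla1 g A y e b
      = ∑ e, christoffel g e a c y * nabla1 g A y e b :=
    Finset.sum_congr rfl fun e _ => by rw [h.christoffel_symm]
  simp only [nabla2, key, Finset.sum_add_distrib, e2]
  rw [pd_comm (hA b) c a]
  simp only [nabla1, mul_sub, Finset.sum_sub_distrib, e1, riemannUp, add_mul, sub_mul,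
    Finset.sum_add_distrib]
  ring

/-- The Ricci identity for `u_b`, in an adapted frame. -/
theorem AdaptedAt.ricci_identity {Q : E4 → Matrix (Fin 4) (Fin 4) ℝ} (hQ : AdaptedAt g u y Q)
    (k i j : Fin 4) :
    fr3 (Q y) (nabla2 g (gradU g u) y) k i j - fr3 (Q y) (nabla2 g (gradU g u) y) i k j
      = -fr4 (Q y) (riemann g y) 0 j k i := by
  have h1 : ∀ b c a, ∑ e, riemannUp g y e b c a * lowerU g u y e
      = fr1 (Q y) (fun f => riemann g y f b c a) 0 := by
    intro b c a
    simp only [fr1, hQ.frame.time, riemann, lowerU, Finset.mul_sum]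
    rw [Finset.sum_comm]
    refine Finset.sum_congr rfl fun f _ => Finset.sum_congr rfl fun e _ => ?_
    rw [hQ.metric_at.symm_at e f]; ring
  have h2 : ∀ c a b, nabla2 g (gradU g u) y c a b - nabla2 g (gradU g u) y a c b
      = -fr1 (Q y) (fun f => riemann g y f b c a) 0 := fun c a b => by
    rw [← h1]; exact GravMag.ricci_identity hQ.metric (hQ.metric_at.sm_lowerU hQ.sm_u) c a b
  have h3 : fr3 (Q y) (nabla2 g (gradU g u) y) i k j
      = fr1 (Q y) (fun c => fr1 (Q y) (fun a => fr1 (Q y) (fun b =>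
        nabla2 g (gradU g u) y a c b) j) i) k := fr1_comm _ _ _ _
  have h4 : fr4 (Q y) (riemann g y) 0 j k i
      = fr1 (Q y) (fun c => fr1 (Q y) (fun a => fr1 (Q y) (fun b => fr1 (Q y) (fun f =>
        riemann g y f b c a) 0) j) i) k := by
    simp only [fr4]
    rw [fr1_comm]
    have e : ∀ b, fr1 (Q y) (fun f => fr1 (Q y) (fun c => fr1 (Q y) (fun a =>
        riemann g y f b c a) i) k) 0 = fr1 (Q y) (fun c => fr1 (Q y) (fun a => fr1 (Q y) (fun f =>
        riemann g y f b c a) 0) i) k := by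
      intro b
      rw [fr1_comm]
      congr 1; funext c
      rw [fr1_comm]
    simp only [e]
    rw [fr1_comm]
    congr 1; funext c
    rw [fr1_comm]
  rw [h3, h4, fr3]
  simp only [← fr1_sub, h2, ← fr1_neg]

/-- The frame components of the Riemann tensor in terms of the Weyl and Schouten tensors. -/
theorem AdaptedAt.frRiemann {Q : E4 → Matrix (Fin 4) (Fin 4) ℝ} (hQ : AdaptedAt g u y Q)
    (i j k l : Fin 4) :
    fr4 (Q y) (riemann g y) i j k l = fr4 (Q y) (weyl g y) i j k l
      + (Matrix.diagonal sgn i k * fr2 (Q y) (schouten g y) j l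
        - Matrix.diagonal sgn i l * fr2 (Q y) (schouten g y) j k
        + Matrix.diagonal sgn j l * fr2 (Q y) (schouten g y) i k
        - Matrix.diagonal sgn j k * fr2 (Q y) (schouten g y) i l) := by
  have hr : ∀ a b c d, riemann g y a b c d = weyl g y a b c d
      + (g y a c * schouten g y b d - g y a d * schouten g y b c
        + g y b d * schouten g y a c - g y b c * schouten g y a d) := by
    intro a b c d; rw [weyl_eq]; ring
  have hg : ∀ i k, fr2 (Q y) (g y) i k = Matrix.diagonal sgn i k := by
    intro i k
    rw [← hQ.frame.ortho]
    exact congrFun (congrFun (fr2_eq_mul (Q y) (g y)) i) k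
  simp only [fr4, hr, fr1_add, fr1_sub]
  simp only [fr1_const_mul, fr1_mul_const]
  simp only [← hg, fr2]

end

noncomputable section

open Filter Topology Matrix

variable {g : E4 → Matrix (Fin 4) (Fin 4) ℝ} {u : E4 → Fin 4 → ℝ} {y : E4}

/-! ### The volume element -/

/-- The Vandermonde product of four indices is alternating, and equals 12 on (0, 1, 2, 3). The
closed form lets `ring` and `norm_num` evaluate the symbol. -/
theorem leviCivita_eq_vandermonde (a b c d : Fin 4) :
    leviCivita a b c d = (((b : ℕ) : ℝ) - (a : ℕ)) * ((c : ℕ) - (a : ℕ)) * ((d : ℕ) - (a : ℕ))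
      * ((c : ℕ) - (b : ℕ)) * ((d : ℕ) - (b : ℕ)) * ((d : ℕ) - (c : ℕ)) / 12 := by
  have h : ∀ a b c d : Fin 4, ((1 : Matrix (Fin 4) (Fin 4) ℤ).submatrix ![a, b, c, d] id).det * 12
      = (((b : ℕ) : ℤ) - (a : ℕ)) * ((c : ℕ) - (a : ℕ)) * ((d : ℕ) - (a : ℕ))
      * ((c : ℕ) - (b : ℕ)) * ((d : ℕ) - (b : ℕ)) * ((d : ℕ) - (c : ℕ)) := by
    decide +kernel
  rw [leviCivita, eq_div_iff (by norm_num)]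
  exact_mod_cast h a b c d

theorem leviCivita_swap (a b c d : Fin 4) : leviCivita a b c d = -leviCivita a d c b := by
  rw [leviCivita_eq_vandermonde, leviCivita_eq_vandermonde]; ring

theorem leviCivita_eq_det (a b c d : Fin 4) :
    leviCivita a b c d = ((1 : Matrix (Fin 4) (Fin 4) ℝ).submatrix ![a, b, c, d] id).det := by
  have : ((1 : Matrix (Fin 4) (Fin 4) ℝ).submatrix ![a, b, c, d] id)
      = (Int.castRingHom ℝ).mapMatrix ((1 : Matrix (Fin 4) (Fin 4) ℤ).submatrix ![a, b, c, d] id) := by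
    ext i j
    simp only [RingHom.mapMatrix_apply, Matrix.map_apply, Matrix.submatrix_apply, Matrix.one_apply]
    split_ifs <;> simp
  rw [leviCivita, this, ← RingHom.map_det]
  rfl

/-- The determinant transforms the Levi-Civita symbol. -/
theorem fr4_leviCivita (P : Matrix (Fin 4) (Fin 4) ℝ) (i j k l : Fin 4) :
    fr4 P leviCivita i j k l = P.det * leviCivita i j k l := by
  have row : ∀ a b c d : Fin 4, leviCivita a b c d = Matrix.det (Matrix.of
      ![(1 : Matrix (Fin 4) (Fin 4) ℝ) a, (1 : Matrix (Fin 4) (Fin 4) ℝ) b,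
        (1 : Matrix (Fin 4) (Fin 4) ℝ) c, (1 : Matrix (Fin 4) (Fin 4) ℝ) d]) := by
    intro a b c d
    rw [leviCivita_eq_det]
    congr 1
    ext m n
    fin_cases m <;> rfl
  -- Linearity of the determinant in one row, read off from the linear map `Matrix.cramer`. Applying
  -- it to each of the four rows replaces the unit rows by frame vectors.
  have lin : ∀ (M : Matrix (Fin 4) (Fin 4) ℝ) (r l : Fin 4),
      fr1 P (fun d => (M.updateRow r ((1 : Matrix (Fin 4) (Fin 4) ℝ) d)).det) l
        = (M.updateRow r (Pᵀ l)).det := by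
    intro M r l
    have e : Pᵀ l = ∑ d, P d l • (1 : Matrix (Fin 4) (Fin 4) ℝ) d := by
      ext a; simp [Matrix.one_apply, Finset.sum_apply]
    simp only [← Matrix.cramer_transpose_apply]
    rw [e, map_sum, Finset.sum_apply]
    simp [fr1]
  have lin3 : ∀ r0 r1 r2 : Fin 4 → ℝ, ∀ l, fr1 P (fun d => Matrix.det (Matrix.of
      ![r0, r1, r2, (1 : Matrix (Fin 4) (Fin 4) ℝ) d])) l
      = Matrix.det (Matrix.of ![r0, r1, r2, Pᵀ l]) := by
    intro r0 r1 r2 l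
    have e : ∀ x, Matrix.of ![r0, r1, r2, x] = (Matrix.of ![r0, r1, r2, 0]).updateRow 3 x := by
      intro x; ext m n; fin_cases m <;> rfl
    rw [e (Pᵀ l), ← lin]
    exact congrArg (fun F => fr1 P F l) (funext fun d => congrArg Matrix.det (e _))
  have lin2 : ∀ r0 r1 r3 : Fin 4 → ℝ, ∀ l, fr1 P (fun d => Matrix.det (Matrix.of
      ![r0, r1, (1 : Matrix (Fin 4) (Fin 4) ℝ) d, r3])) l
      = Matrix.det (Matrix.of ![r0, r1, Pᵀ l, r3]) := by
    intro r0 r1 r3 l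
    have e : ∀ x, Matrix.of ![r0, r1, x, r3] = (Matrix.of ![r0, r1, 0, r3]).updateRow 2 x := by
      intro x; ext m n; fin_cases m <;> rfl
    rw [e (Pᵀ l), ← lin]
    exact congrArg (fun F => fr1 P F l) (funext fun d => congrArg Matrix.det (e _))
  have lin1 : ∀ r0 r2 r3 : Fin 4 → ℝ, ∀ l, fr1 P (fun d => Matrix.det (Matrix.of
      ![r0, (1 : Matrix (Fin 4) (Fin 4) ℝ) d, r2, r3])) l
      = Matrix.det (Matrix.of ![r0, Pᵀ l, r2, r3]) := by
    intro r0 r2 r3 l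
    have e : ∀ x, Matrix.of ![r0, x, r2, r3] = (Matrix.of ![r0, 0, r2, r3]).updateRow 1 x := by
      intro x; ext m n; fin_cases m <;> rfl
    rw [e (Pᵀ l), ← lin]
    exact congrArg (fun F => fr1 P F l) (funext fun d => congrArg Matrix.det (e _))
  have lin0 : ∀ r1 r2 r3 : Fin 4 → ℝ, ∀ l, fr1 P (fun d => Matrix.det (Matrix.of
      ![(1 : Matrix (Fin 4) (Fin 4) ℝ) d, r1, r2, r3])) l
      = Matrix.det (Matrix.of ![Pᵀ l, r1, r2, r3]) := by
    intro r1 r2 r3 l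
    have e : ∀ x, Matrix.of ![x, r1, r2, r3] = (Matrix.of ![0, r1, r2, r3]).updateRow 0 x := by
      intro x; ext m n; fin_cases m <;> rfl
    rw [e (Pᵀ l), ← lin]
    exact congrArg (fun F => fr1 P F l) (funext fun d => congrArg Matrix.det (e _))
  have fin : Matrix.of ![Pᵀ i, Pᵀ j, Pᵀ k, Pᵀ l]
      = (1 : Matrix (Fin 4) (Fin 4) ℝ).submatrix ![i, j, k, l] id * Pᵀ := by
    ext m n
    simp only [Matrix.mul_apply, Matrix.submatrix_apply, id, Matrix.one_apply, ite_mul, one_mul,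
      zero_mul, Finset.sum_ite_eq, Finset.mem_univ, if_true]
    fin_cases m <;> rfl
  simp only [fr4, row, lin3, lin2, lin1, lin0]
  rw [fin, Matrix.det_mul, Matrix.det_transpose, ← leviCivita_eq_det, row, mul_comm]

end

noncomputable section

open Filter Topology Matrix

variable {g : E4 → Matrix (Fin 4) (Fin 4) ℝ} {u : E4 → Fin 4 → ℝ} {y : E4}

/-- The factor det Q is absorbed as √((det Q)²), which is where positive orientation of the frame is
used. -/
theorem fr4_volForm {z : E4} {Q : E4 → Matrix (Fin 4) (Fin 4) ℝ} (hQ : 0 < (Q z).det)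
    (i j k l : Fin 4) :
    fr4 (Q z) (volForm g z) i j k l = Real.sqrt |(frMetric g Q z).det| * leviCivita i j k l := by
  have h1 : fr4 (Q z) (volForm g z) i j k l
      = Real.sqrt |(g z).det| * fr4 (Q z) leviCivita i j k l := by
    simp only [fr4, volForm, fr1_const_mul]
  have h2 : |(frMetric g Q z).det| = (Q z).det ^ 2 * |(g z).det| := by
    rw [frMetric, Matrix.det_mul, Matrix.det_mul, Matrix.det_transpose, abs_mul, abs_mul,
      abs_of_pos hQ]
    ring
  rw [h1, h2, fr4_leviCivita, Real.sqrt_mul (sq_nonneg _), Real.sqrt_sq hQ.le]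
  ring

namespace AdaptedAt

variable {Q : E4 → Matrix (Fin 4) (Fin 4) ℝ}

/-- The density of the volume element in the frame field. -/
theorem sm_vol (hQ : AdaptedAt g u y Q) : Sm (fun z => Real.sqrt |(frMetric g Q z).det|) y := by
  have hd := hQ.sm_frMetric.det
  have h1 := hQ.det_frMetric_self
  -- The determinant is -1 at y, so near y the absolute value is a change of sign and the square
  -- root is smooth.
  have hn : ∀ᶠ z in 𝓝 y, (frMetric g Q z).det < 0 :=
    hd.continuousAt.eventually (gt_mem_nhds (by change (frMetric g Q y).det < 0; rw [h1]; norm_num))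
  have e : (fun z => Real.sqrt |(frMetric g Q z).det|) =ᶠ[𝓝 y]
      fun z => Real.sqrt (-(frMetric g Q z).det) :=
    hn.mono fun z hz => by simp only [abs_of_neg hz]
  exact Sm.congr (hd.neg.sqrt (by rw [h1]; norm_num)) e

theorem pd_prod_eq_zero {ι : Type*} (s : Finset ι) {F : ι → E4 → ℝ} (hF : ∀ i, Sm (F i) y)
    (c : Fin 4) (h : ∀ i, pd c (F i) y = 0) :
    Sm (fun z => ∏ i ∈ s, F i z) y ∧ pd c (fun z => ∏ i ∈ s, F i z) y = 0 := by
  classical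
  induction s using Finset.induction_on with
  | empty => simpa using sm_const 1 y
  | insert a s ha ih =>
    simp only [Finset.prod_insert ha]
    exact ⟨(hF a).mul ih.1, by rw [pd_mul (hF a) ih.1, h, ih.2]; ring⟩

/-- The volume form is parallel: its density depends only on the frame metric, all of whose entries
are stationary at y. -/
theorem dir_vol (hQ : AdaptedAt g u y Q) (k : Fin 4) :
    dir (Q y) y k (fun z => Real.sqrt |(frMetric g Q z).det|) = 0 := by
  refine dir_eq_zero fun c => ?_
  have hd := hQ.sm_frMetric.det
  have h1 := hQ.det_frMetric_self
  have hn : ∀ᶠ z in 𝓝 y, (frMetric g Q z).det < 0 :=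
    hd.continuousAt.eventually (gt_mem_nhds (by change (frMetric g Q y).det < 0; rw [h1]; norm_num))
  have e : (fun z => Real.sqrt |(frMetric g Q z).det|) =ᶠ[𝓝 y]
      fun z => Real.sqrt (-(frMetric g Q z).det) :=
    hn.mono fun z hz => by simp only [abs_of_neg hz]
  have h2 : pd c (fun z => (frMetric g Q z).det) y = 0 := by
    simp only [Matrix.det_apply']
    have hp := fun σ : Equiv.Perm (Fin 4) => pd_prod_eq_zero (y := y) Finset.univ
      (F := fun i z => frMetric g Q z (σ i) i) (fun i => hQ.sm_frMetric (σ i) i) c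
      (fun i => hQ.pd_frMetric c (σ i) i)
    rw [pd_sum fun σ => (sm_const _ y).mul (hp σ).1]
    exact Finset.sum_eq_zero fun σ _ => by rw [pd_const_mul (hp σ).1, (hp σ).2, mul_zero]
  have h3 : pd c (fun z => -(frMetric g Q z).det) y = 0 := by rw [pd_neg, h2, neg_zero]
  rw [pd_congr e]
  unfold pd at h3 ⊢
  rw [fderiv_sqrt (Sm.neg hd).diff (by rw [h1]; norm_num)]
  rw [_root_.smul_apply, h3, smul_zero]

end AdaptedAt

/-! ### Vorticity -/

theorem MetricAt.raise_lowerU (hg : MetricAt g y) (a : Fin 4) :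
    ∑ b, gInv g y a b * lowerU g u y b = u y a := by
  simp only [lowerU, Finset.mul_sum]
  rw [Finset.sum_comm]
  simp only [← mul_assoc, ← Finset.sum_mul, hg.inv_mul_apply]
  simp

theorem sum_proj_mul (g : E4 → Matrix (Fin 4) (Fin 4) ℝ) (u : E4 → Fin 4 → ℝ) (y : E4)
    (X : Fin 4 → ℝ) (a : Fin 4) :
    ∑ e, proj g u y e a * X e = X a + lowerU g u y a * ∑ e, u y e * X e := by
  simp only [proj, add_mul, Finset.sum_add_distrib, Finset.mul_sum]
  congr 1
  · simp
  · exact Finset.sum_congr rfl fun _ _ => by ring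

/-- The projected derivative of `u` is `∇_e u_f + u_e a_f`. -/
theorem sum_proj_gradU (h : ∀ᶠ z in 𝓝 y, ObserverAt g u z) (c d : Fin 4) :
    ∑ e, ∑ f, proj g u y e c * proj g u y f d * gradU g u y e f
      = gradU g u y c d + lowerU g u y c * accel g u y d := by
  have h1 : ∀ e, ∑ f, proj g u y f d * gradU g u y e f = gradU g u y e d := by
    intro e
    have h0 : ∑ f, u y f * gradU g u y e f = 0 := by
      rw [← gradU_vel h e]; exact Finset.sum_congr rfl fun _ _ => mul_comm _ _
    rw [sum_proj_mul, h0]; ring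
  have h2 : ∀ e, ∑ f, proj g u y e c * proj g u y f d * gradU g u y e f
      = proj g u y e c * gradU g u y e d := by
    intro e
    rw [← h1 e, Finset.mul_sum]; exact Finset.sum_congr rfl fun _ _ => by ring
  simp only [h2, sum_proj_mul]
  rfl

/-- The volume element is antisymmetric in the two slots contracted with u. -/
theorem spatialEps_vel (g : E4 → Matrix (Fin 4) (Fin 4) ℝ) (u : E4 → Fin 4 → ℝ) (y : E4)
    (a c : Fin 4) : ∑ b, spatialEps g u y a b c * u y b = 0 := by
  have e : ∑ b, spatialEps g u y a b c * u y b
      = ∑ b, ∑ d, volForm g y a b c d * (u y b * u y d) := by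
    simp only [spatialEps, Finset.sum_mul]
    exact Finset.sum_congr rfl fun _ _ => Finset.sum_congr rfl fun _ _ => by ring
  have h : ∑ b, ∑ d, volForm g y a b c d * (u y b * u y d)
      = -∑ b, ∑ d, volForm g y a b c d * (u y b * u y d) := by
    conv_lhs => rw [Finset.sum_comm]
    simp only [← Finset.sum_neg_distrib]
    refine Finset.sum_congr rfl fun b _ => Finset.sum_congr rfl fun d _ => ?_
    simp only [volForm, leviCivita_swap a b c d]
    ring
  rw [e]; linarith

/-- The projections in D^b u^c may be dropped: D_e u_f differs from ∇_e u_f by u_e a_f, which ε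
annihilates. Differentiating ω then needs no derivative of a projector. -/
theorem vorticity_eq (h : ∀ᶠ z in 𝓝 y, ObserverAt g u z) (a : Fin 4) :
    vorticity g u y a
      = -(1 / 2) * ∑ d, (∑ b, ∑ c, volForm g y a b c d * gradUp g u y b c) * u y d := by
  have hg := h.self_of_nhds.metric
  have hD : ∀ e f, spatialD1 g u (lowerU g u) y e f
      = gradU g u y e f + lowerU g u y e * accel g u y f := fun e f => sum_proj_gradU h e f
  have h1 : ∀ b c, ∑ e, ∑ f, gInv g y b e * gInv g y c f * spatialD1 g u (lowerU g u) y e f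
      = gradUp g u y b c + u y b * ∑ f, gInv g y c f * accel g u y f := by
    intro b c
    have e1 : gradUp g u y b c = ∑ e, ∑ f, gInv g y b e * gInv g y c f * gradU g u y e f := by
      simp only [gradUp, Matrix.mul_apply, Matrix.transpose_apply, Matrix.of_apply, Finset.sum_mul]
      rw [Finset.sum_comm]
      exact Finset.sum_congr rfl fun _ _ => Finset.sum_congr rfl fun _ _ => by ring
    rw [e1, ← hg.raise_lowerU (u := u) b]
    simp only [hD, mul_add, Finset.sum_add_distrib, Finset.sum_mul, Finset.mul_sum]
    congr 1
    rw [Finset.sum_comm]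
    exact Finset.sum_congr rfl fun _ _ => Finset.sum_congr rfl fun _ _ => by ring
  have h2 : ∑ b, ∑ c, ∑ e, ∑ f, spatialEps g u y a b c * gInv g y b e * gInv g y c f *
      spatialD1 g u (lowerU g u) y e f = ∑ b, ∑ c, spatialEps g u y a b c * gradUp g u y b c := by
    have e2 : ∀ b c, ∑ e, ∑ f, spatialEps g u y a b c * gInv g y b e * gInv g y c f *
        spatialD1 g u (lowerU g u) y e f = spatialEps g u y a b c * gradUp g u y b c
        + spatialEps g u y a b c * u y b * ∑ f, gInv g y c f * accel g u y f := by
      intro b c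
      rw [mul_assoc (spatialEps g u y a b c), ← mul_add, ← h1]
      simp only [Finset.mul_sum]
      exact Finset.sum_congr rfl fun _ _ => Finset.sum_congr rfl fun _ _ => by ring
    simp only [e2, Finset.sum_add_distrib]
    rw [add_eq_left, Finset.sum_comm]
    simp only [← Finset.sum_mul, spatialEps_vel, zero_mul, Finset.sum_const_zero]
  rw [vorticity, h2]
  congr 1
  simp only [spatialEps, Finset.sum_mul]
  have e3 : ∀ b, ∑ c, ∑ d, volForm g y a b c d * u y d * gradUp g u y b c
      = ∑ d, ∑ c, volForm g y a b c d * u y d * gradUp g u y b c := fun b => Finset.sum_comm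
  simp only [e3]
  rw [Finset.sum_comm]
  exact Finset.sum_congr rfl fun _ _ => Finset.sum_congr rfl fun _ _ =>
    Finset.sum_congr rfl fun _ _ => by ring

namespace AdaptedAt

variable {Q : E4 → Matrix (Fin 4) (Fin 4) ℝ}

/-- An identity near y, with the density and the contravariant components kept as functions, since
it is to be differentiated at y. -/
theorem fr1_vorticity (hQ : AdaptedAt g u y Q) (i : Fin 4) :
    ∀ᶠ z in 𝓝 y, fr1 (Q z) (vorticity g u z) i = -(1 / 2) * ∑ l, ∑ j, ∑ k,
      Real.sqrt |(frMetric g Q z).det| * leviCivita i j k l * frGradUp g u Q z j k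
        * frVel g u Q z l := by
  filter_upwards [hQ.obs.eventually_nhds, hQ.vel, hQ.gradUp_frame, hQ.det_pos] with z h1 h2 h3 h4
  have e : vorticity g u z = fun a =>
      -(1 / 2) * ∑ d, (∑ b, ∑ c, volForm g z a b c d * gradUp g u z b c) * u z d :=
    funext fun a => vorticity_eq h1 a
  rw [e, fr1_const_mul]
  congr 1
  simp only [sum_mul_vector h2]
  simp only [fr1_sum, fr1_mul_const,
    sum_mul_bivector h3 (fun b c => volForm g z _ b c _), Finset.sum_mul, fr2]
  refine Finset.sum_congr rfl fun l _ => Finset.sum_congr rfl fun j _ =>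
    Finset.sum_congr rfl fun k _ => ?_
  congr 2
  rw [← fr4_volForm h4, fr4]
  congr 1; funext a
  rw [fr1_comm]
  congr 1; funext b
  rw [fr1_comm]

theorem sm_vorticity (hQ : AdaptedAt g u y Q) (a : Fin 4) :
    Sm (fun z => vorticity g u z a) y := by
  have hv : ∀ a b c d, Sm (fun z => volForm g z a b c d) y := by
    intro a b c d
    have hd := hQ.metric_at.sm.det
    have h0 := hQ.metric_at.det
    have h1 : Sm (fun z => |(g z).det|) y := hd.abs h0
    exact Sm.mul (h1.sqrt (abs_ne_zero.2 h0)) (sm_const _ y)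
  have hi := hQ.metric_at.sm_inv
  have hG : SmM (gradUp g u) y :=
    (hi.mul (fun i j => hQ.metric_at.sm_gradU hQ.sm_u i j)).mul hi.transpose
  have e : ∀ᶠ z in 𝓝 y, vorticity g u z a
      = -(1 / 2) * ∑ d, (∑ b, ∑ c, volForm g z a b c d * gradUp g u z b c) * u z d :=
    hQ.obs.eventually_nhds.mono fun z hz => vorticity_eq hz a
  refine Sm.congr ?_ e
  exact (sm_const _ y).mul (Sm.sum fun d => (Sm.sum fun b => Sm.sum fun c =>
    (hv a b c d).mul (hG b c)).mul (hQ.sm_u d))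

theorem vol_self (hQ : AdaptedAt g u y Q) : Real.sqrt |(frMetric g Q y).det| = 1 := by
  rw [hQ.det_frMetric_self]; simp

theorem fr1_vorticity_self (hQ : AdaptedAt g u y Q) (i : Fin 4) :
    fr1 (Q y) (vorticity g u y) i = -(1 / 2) * ∑ j, ∑ k, leviCivita i j k 0 *
      (sgn j * sgn k * fr2 (Q y) (gradU g u y) j k) := by
  rw [(hQ.fr1_vorticity i).self_of_nhds]
  simp only [hQ.vol_self, hQ.frVel_self, hQ.frGradUp_self, one_mul]
  congr 1
  simp

/-- The frame components of `∇_m ω_i` at `y`. -/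
theorem frNabla_vorticity (hQ : AdaptedAt g u y Q) (m i : Fin 4) :
    fr2 (Q y) (nabla1 g (vorticity g u) y) m i = -(1 / 2) * (∑ j, ∑ k, leviCivita i j k 0 *
      (sgn j * sgn k * fr3 (Q y) (nabla2 g (gradU g u) y) m j k)
      + ∑ l, ∑ j, ∑ k, leviCivita i j k l * (sgn j * sgn k * fr2 (Q y) (gradU g u y) j k)
        * (sgn l * fr2 (Q y) (gradU g u y) m l)) := by
  have h1 : fr2 (Q y) (nabla1 g (vorticity g u) y) m i
      = dir (Q y) y m (fun z => fr1 (Q z) (vorticity g u z) i) := by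
    simp only [dir, hQ.par.pd_fr1' hQ.sm_vorticity]
    rfl
  have s1 : ∀ j k l, Sm (fun z => Real.sqrt |(frMetric g Q z).det| * leviCivita i j k l) y :=
    fun j k l => hQ.sm_vol.mul (sm_const _ y)
  have s2 : ∀ j k l, Sm (fun z => Real.sqrt |(frMetric g Q z).det| * leviCivita i j k l
      * frGradUp g u Q z j k) y := fun j k l => (s1 j k l).mul (hQ.sm_frGradUp j k)
  have s3 : ∀ l j k, Sm (fun z => Real.sqrt |(frMetric g Q z).det| * leviCivita i j k l
      * frGradUp g u Q z j k * frVel g u Q z l) y := fun l j k => (s2 j k l).mul (hQ.sm_frVel l)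
  have h2 : ∀ l j k, dir (Q y) y m (fun z => Real.sqrt |(frMetric g Q z).det| * leviCivita i j k l
      * frGradUp g u Q z j k * frVel g u Q z l)
      = leviCivita i j k l * (sgn j * sgn k * fr3 (Q y) (nabla2 g (gradU g u) y) m j k)
        * (if l = 0 then 1 else 0)
      + leviCivita i j k l * (sgn j * sgn k * fr2 (Q y) (gradU g u y) j k)
        * (sgn l * fr2 (Q y) (gradU g u y) m l) := by
    intro l j k
    rw [dir_mul (s2 j k l) (hQ.sm_frVel l), dir_mul (s1 j k l) (hQ.sm_frGradUp j k),
      dir_mul hQ.sm_vol (sm_const _ y), hQ.dir_vol, dir_const, hQ.dir_frGradUp, hQ.dir_frVel,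
      hQ.frVel_self, hQ.frGradUp_self, hQ.vol_self]
    ring
  rw [h1, dir_congr (hQ.fr1_vorticity i),
    dir_const_mul (Sm.sum fun l => Sm.sum fun j => Sm.sum fun k => s3 l j k),
    dir_sum fun l => Sm.sum fun j => Sm.sum fun k => s3 l j k]
  congr 1
  simp only [dir_sum fun j => Sm.sum fun k => s3 _ j k, dir_sum fun k => s3 _ _ k, h2,
    Finset.sum_add_distrib]
  congr 1
  simp

end AdaptedAt

end

noncomputable section

open Filter Topology Matrix

variable {g : E4 → Matrix (Fin 4) (Fin 4) ℝ} {u : E4 → Fin 4 → ℝ} {y : E4}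

/-! ### The shear -/

/-- The projected trace `h^{cd} ∇_c u_d`. -/
def expansion (g : E4 → Matrix (Fin 4) (Fin 4) ℝ) (u : E4 → Fin 4 → ℝ) (z : E4) : ℝ :=
  ∑ c, ∑ d, (gInv g z c d + u z c * u z d) * gradU g u z c d

/-- The projectors are expanded using u^b ∇_a u_b = 0, leaving a polynomial expression in g, u, ∇u,
the acceleration and the expansion. -/
theorem shear_eq (h : ∀ᶠ z in 𝓝 y, ObserverAt g u z) (a b : Fin 4) :
    shear g u y a b = (1 / 2) * (gradU g u y a b + gradU g u y b a
        + lowerU g u y a * accel g u y b + lowerU g u y b * accel g u y a)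
      - (1 / 3) * (g y a b + lowerU g u y a * lowerU g u y b) * expansion g u y := by
  have e : shear g u y a b
      = (1 / 2) * ((∑ c, ∑ d, proj g u y c a * proj g u y d b * gradU g u y c d)
        + ∑ c, ∑ d, proj g u y c b * proj g u y d a * gradU g u y c d)
      - (1 / 3) * spatialMetric g u y a b * expansion g u y := by
    simp only [shear, hat, expansion, Finset.mul_sum, ← Finset.sum_add_distrib,
      ← Finset.sum_sub_distrib]
    refine Finset.sum_congr rfl fun c _ => Finset.sum_congr rfl fun d _ => ?_
    simp only [gradU]
    ring
  rw [e, sum_proj_gradU h, sum_proj_gradU h, spatialMetric]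
  ring

namespace AdaptedAt

variable {Q : E4 → Matrix (Fin 4) (Fin 4) ℝ}

theorem sm_accel (hQ : AdaptedAt g u y Q) (a : Fin 4) : Sm (fun z => accel g u z a) y :=
  Sm.sum fun b => (hQ.sm_u b).mul (hQ.metric_at.sm_gradU hQ.sm_u b a)

theorem sm_expansion (hQ : AdaptedAt g u y Q) : Sm (expansion g u) y :=
  Sm.sum fun c => Sm.sum fun d => ((hQ.metric_at.sm_inv c d).add
    ((hQ.sm_u c).mul (hQ.sm_u d))).mul (hQ.metric_at.sm_gradU hQ.sm_u c d)

theorem sm_shear (hQ : AdaptedAt g u y Q) (a b : Fin 4) : Sm (fun z => shear g u z a b) y := by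
  have hB := hQ.metric_at.sm_gradU hQ.sm_u
  have hU := hQ.metric_at.sm_lowerU hQ.sm_u
  have hA := hQ.sm_accel
  refine Sm.congr ?_ (hQ.obs.eventually_nhds.mono fun z hz => shear_eq hz a b)
  exact ((sm_const _ y).mul ((((hB a b).add (hB b a)).add ((hU a).mul (hA b))).add
    ((hU b).mul (hA a)))).sub (((sm_const _ y).mul ((hQ.metric_at.sm a b).add
      ((hU a).mul (hU b)))).mul hQ.sm_expansion)

theorem frAccel_self (hQ : AdaptedAt g u y Q) (i : Fin 4) :
    fr1 (Q y) (accel g u y) i = fr2 (Q y) (gradU g u y) 0 i := by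
  rw [fr2, fr1_comm]
  congr 1
  funext a
  simp only [accel, fr1, hQ.frame.time]
  rfl

/-- The frame components of `∇_k σ_{ij}` at `y` for spatial `i` and `j`, up to a multiple of the
spatial metric. -/
theorem frNabla_shear (hQ : AdaptedAt g u y Q) :
    ∃ θ : Fin 4 → ℝ, ∀ k i j, i ≠ 0 → j ≠ 0 → fr3 (Q y) (nabla2 g (shear g u) y) k i j
      = (1 / 2) * (fr3 (Q y) (nabla2 g (gradU g u) y) k i j
        + fr3 (Q y) (nabla2 g (gradU g u) y) k j i
        + fr2 (Q y) (gradU g u y) k i * fr2 (Q y) (gradU g u y) 0 j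
        + fr2 (Q y) (gradU g u y) k j * fr2 (Q y) (gradU g u y) 0 i)
      - (if i = j then 1 else 0) * θ k := by
  -- The witness is a third of the gradient of the expansion. Its value is irrelevant because the
  -- curl does not see multiples of the spatial metric.
  refine ⟨fun k => (1 / 3) * dir (Q y) y k (expansion g u), fun k i j hi hj => ?_⟩
  have h1 : fr3 (Q y) (nabla2 g (shear g u) y) k i j
      = dir (Q y) y k (fun z => fr2 (Q z) (shear g u z) i j) := by
    simp only [dir, hQ.par.pd_fr2 hQ.sm_shear]
    rfl
  have hs : ∀ (z : E4) (i j : Fin 4), fr2 (Q z) (gradU g u z) j i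
      = fr1 (Q z) (fun a => fr1 (Q z) (fun b => gradU g u z b a) j) i := fun z i j =>
    fr1_comm _ _ _ _
  have h2 : ∀ᶠ z in 𝓝 y, fr2 (Q z) (shear g u z) i j
      = (1 / 2) * (fr2 (Q z) (gradU g u z) i j + fr2 (Q z) (gradU g u z) j i
        + fr1 (Q z) (lowerU g u z) i * fr1 (Q z) (accel g u z) j
        + fr1 (Q z) (lowerU g u z) j * fr1 (Q z) (accel g u z) i)
      - (1 / 3) * (frMetric g Q z i j + fr1 (Q z) (lowerU g u z) i * fr1 (Q z) (lowerU g u z) j)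
        * expansion g u z := by
    filter_upwards [hQ.obs.eventually_nhds] with z hz
    have hg : frMetric g Q z i j = fr2 (Q z) (g z) i j :=
      (congrFun (congrFun (fr2_eq_mul (Q z) (g z)) i) j).symm
    have e : shear g u z = fun a b => (1 / 2) * (gradU g u z a b + gradU g u z b a
        + lowerU g u z a * accel g u z b + lowerU g u z b * accel g u z a)
      - (1 / 3) * (g z a b + lowerU g u z a * lowerU g u z b) * expansion g u z :=
      funext fun a => funext fun b => shear_eq hz a b
    rw [e, hg, hs z i j]
    simp only [fr2, fr1_add, fr1_sub, fr1_mul_const, fr1_const_mul]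
  have sB := hQ.sm_frGradU
  have sU := hQ.sm_frU
  have sA : ∀ i, Sm (fun z => fr1 (Q z) (accel g u z) i) y :=
    fun i => Sm.fr1 hQ.par.sm hQ.sm_accel i
  have sG := hQ.sm_frMetric
  have t1 := (sB i j).add (sB j i)
  have t2 := t1.add ((sU i).mul (sA j))
  have t3 := t2.add ((sU j).mul (sA i))
  have t4 := (sG i j).add ((sU i).mul (sU j))
  have t5 := (sm_const (1 / 3) y).mul t4
  -- Derivatives of the acceleration are multiplied by u_i or u_j, which are zero at y for spatial i
  -- and j; only products of ∇u with the acceleration survive.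
  rw [h1, dir_congr h2, dir_sub ((sm_const _ y).mul t3) (t5.mul hQ.sm_expansion),
    dir_const_mul t3, dir_add t2 ((sU j).mul (sA i)), dir_add t1 ((sU i).mul (sA j)),
    dir_add (sB i j) (sB j i), dir_mul (sU i) (sA j), dir_mul (sU j) (sA i),
    dir_mul t5 hQ.sm_expansion, dir_const_mul t4, dir_add (sG i j) ((sU i).mul (sU j)),
    dir_mul (sU i) (sU j), dir_eq_zero fun c => hQ.pd_frMetric c i j, hQ.frU_self, hQ.frU_self,
    if_neg hi, if_neg hj, hQ.frMetric_self, Matrix.diagonal_apply, hQ.dir_frU, hQ.dir_frU,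
    hQ.dir_frGradU, hQ.dir_frGradU, hQ.frAccel_self, hQ.frAccel_self]
  have : sgn i = 1 := if_neg hi
  rw [this]
  split_ifs <;> ring

/-! ### Frame components at the base point -/

/-- The projection onto the spatial legs of an adapted frame. -/
def _root_.GravMag.spat (i : Fin 4) : ℝ := if i = 0 then 0 else 1

theorem _root_.GravMag.fr1_sum_mul (P : Matrix (Fin 4) (Fin 4) ℝ) (r : Fin 4 → ℝ)
    (X : Fin 4 → Fin 4 → ℝ) (i : Fin 4) :
    fr1 P (fun b => ∑ e, r e * X e b) i = ∑ e, r e * fr1 P (X e) i := by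
  simp only [fr1_sum, fr1_const_mul]

/-- In an adapted frame the projector is diagonal: it annihilates the timelike leg and fixes the
three others. -/
theorem fr1_proj (hQ : AdaptedAt g u y Q) (X : Fin 4 → ℝ) (i : Fin 4) :
    fr1 (Q y) (fun a => ∑ e, proj g u y e a * X e) i = spat i * fr1 (Q y) X i := by
  have h0 : ∑ e, u y e * X e = fr1 (Q y) X 0 := by simp only [fr1, hQ.frame.time]
  simp only [sum_proj_mul, h0, fr1_add, fr1_mul_const, hQ.frU_self]
  by_cases hi : i = 0
  · subst hi; simp [spat]
  · simp [spat, hi]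

theorem fr2_spatialD1 (hQ : AdaptedAt g u y Q) (A : E4 → Fin 4 → ℝ) (i j : Fin 4) :
    fr2 (Q y) (spatialD1 g u A y) i j = spat i * spat j * fr2 (Q y) (nabla1 g A y) i j := by
  simp only [fr2, spatialD1, mul_assoc, ← Finset.mul_sum, fr1_sum_mul, hQ.fr1_proj, fr1_const_mul]

theorem fr3_spatialD2 (hQ : AdaptedAt g u y Q) (A : E4 → Fin 4 → Fin 4 → ℝ) (k i j : Fin 4) :
    fr3 (Q y) (spatialD2 g u A y) k i j
      = spat k * spat i * spat j * fr3 (Q y) (nabla2 g A y) k i j := by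
  simp only [fr3, spatialD2, mul_assoc, ← Finset.mul_sum, fr1_sum_mul, hQ.fr1_proj, fr1_const_mul]

/-- The frame is orthonormal at y, so a metric contraction is a signed sum of diagonal components.
All the scalars and duals at y are reduced by this rule. -/
theorem sum_gInv_mul (hQ : AdaptedAt g u y Q) (X : Fin 4 → Fin 4 → ℝ) :
    ∑ a, ∑ b, gInv g y a b * X a b = ∑ i, sgn i * fr2 (Q y) X i i := by
  have h := sum_mul_bivector (gInv_eq_frame (g := g) hQ.frame.pos.ne') X
  simp only [hQ.frInv_self_apply] at h
  simp only [mul_comm (gInv g y _ _), h]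
  simp [mul_comm]

theorem fr2_spatialMetric (hQ : AdaptedAt g u y Q) (i j : Fin 4) :
    fr2 (Q y) (spatialMetric g u y) i j = if i = j then spat i else 0 := by
  have hg : fr2 (Q y) (g y) i j = Matrix.diagonal sgn i j := by
    rw [← hQ.frame.ortho]
    exact congrFun (congrFun (fr2_eq_mul (Q y) (g y)) i) j
  have : fr2 (Q y) (spatialMetric g u y) i j = fr2 (Q y) (g y) i j
      + fr1 (Q y) (lowerU g u y) i * fr1 (Q y) (lowerU g u y) j := by
    simp only [fr2, spatialMetric, fr1_add, fr1_mul_const, fr1_const_mul]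
  rw [this, hg, hQ.frU_self, hQ.frU_self, Matrix.diagonal_apply]
  by_cases hij : i = j
  · subst hij
    by_cases hi : i = 0 <;> simp [hi, sgn, spat]
  · by_cases hi : i = 0
    · have hj : j ≠ 0 := fun h => hij (hi.trans h.symm)
      simp [hi, hj, Ne.symm hj]
    · simp [hi, hij]

theorem fr2_hat (hQ : AdaptedAt g u y Q) (A : E4 → Fin 4 → Fin 4 → ℝ) (i j : Fin 4) :
    fr2 (Q y) (hat g u A y) i j
      = (1 / 2) * (spat i * spat j * (fr2 (Q y) (A y) i j + fr2 (Q y) (A y) j i))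
      - (1 / 3) * (if i = j then spat i else 0) * ∑ m, spat m * fr2 (Q y) (A y) m m := by
  have e : hat g u A y = fun a b =>
      (1 / 2) * ((∑ c, proj g u y c a * ∑ d, proj g u y d b * A y c d)
        + ∑ d, proj g u y d a * ∑ c, proj g u y c b * A y c d)
      - spatialMetric g u y a b * ((1 / 3) * ((∑ c, ∑ d, gInv g y c d * A y c d)
        + ∑ c, u y c * ∑ d, u y d * A y c d)) := by
    funext a b
    have e2 : ∑ d, proj g u y d a * ∑ c, proj g u y c b * A y c d
        = ∑ c, ∑ d, proj g u y c b * proj g u y d a * A y c d := by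
      simp only [Finset.mul_sum]
      rw [Finset.sum_comm]
      exact Finset.sum_congr rfl fun _ _ => Finset.sum_congr rfl fun _ _ => by ring
    rw [e2]
    simp only [hat, Finset.mul_sum, ← Finset.sum_add_distrib, ← Finset.sum_sub_distrib]
    exact Finset.sum_congr rfl fun _ _ => Finset.sum_congr rfl fun _ _ => by ring
  have h0 : ∑ c, u y c * ∑ d, u y d * A y c d = fr2 (Q y) (A y) 0 0 := by
    simp only [fr2, fr1, hQ.frame.time]
  have hs : fr2 (Q y) (A y) j i = fr1 (Q y) (fun a => fr1 (Q y) (fun b => A y b a) j) i :=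
    fr1_comm _ _ _ _
  -- The term u^c u^d in h^{cd} cancels the time-time entry of the Lorentzian trace and leaves the
  -- spatial trace.
  have hm : ∑ m, spat m * fr2 (Q y) (A y) m m
      = ∑ m, sgn m * fr2 (Q y) (A y) m m + fr2 (Q y) (A y) 0 0 := by
    simp [Fin.sum_univ_four, sgn, spat]
    ring
  rw [e, hm, h0, hQ.sum_gInv_mul, ← hQ.fr2_spatialMetric, hs]
  simp only [fr2, fr1_sub, fr1_add, fr1_const_mul, fr1_sum_mul, hQ.fr1_proj, fr1_mul_const]
  ring

theorem fr3_spatialEps (hQ : AdaptedAt g u y Q) (i j k : Fin 4) :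
    fr3 (Q y) (spatialEps g u y) i j k = leviCivita i j k 0 := by
  have h := fr4_volForm (g := g) hQ.frame.pos i j k 0
  rw [hQ.vol_self, one_mul] at h
  rw [← h]
  have h0 : ∀ a b c, spatialEps g u y a b c = fr1 (Q y) (fun d => volForm g y a b c d) 0 := by
    intro a b c
    simp only [spatialEps, fr1, hQ.frame.time, mul_comm]
  simp only [fr3, fr4, h0]

theorem fr2_curl (hQ : AdaptedAt g u y Q) (A : E4 → Fin 4 → Fin 4 → ℝ) (i j : Fin 4) :
    fr2 (Q y) (curl g u A y) i j = (1 / 2) * ∑ m, sgn m * ∑ n, sgn n *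
      (leviCivita m n i 0 * fr3 (Q y) (spatialD2 g u A y) m j n
        + leviCivita m n j 0 * fr3 (Q y) (spatialD2 g u A y) m i n) := by
  have e : curl g u A y = fun a b => (1 / 2) * ∑ c, ∑ e, gInv g y c e * ∑ d, ∑ f, gInv g y d f *
      (spatialEps g u y c d a * spatialD2 g u A y e b f
      + spatialEps g u y c d b * spatialD2 g u A y e a f) := by
    funext a b
    rw [curl]
    congr 1
    refine Finset.sum_congr rfl fun c _ => ?_
    rw [Finset.sum_comm]
    simp only [Finset.mul_sum, mul_assoc]
  have r3 : ∀ (X : Fin 4 → Fin 4 → Fin 4 → ℝ) (m n i : Fin 4),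
      fr1 (Q y) (fun a => fr1 (Q y) (fun c => fr1 (Q y) (fun d => X c d a) n) m) i
      = fr3 (Q y) X m n i := by
    intro X m n i
    rw [fr3, fr1_comm]
    congr 1; funext a
    rw [fr1_comm]
  have r2 : ∀ (X : Fin 4 → Fin 4 → Fin 4 → ℝ) (m n j : Fin 4),
      fr1 (Q y) (fun b => fr1 (Q y) (fun e => fr1 (Q y) (fun f => X e b f) n) m) j
      = fr3 (Q y) X m j n := fun X m n j => fr1_comm _ _ _ _
  rw [e]
  simp only [hQ.sum_gInv_mul]
  simp only [fr2, fr1_const_mul, fr1_sum, fr1_add, fr1_mul_const, r3 (spatialEps g u y),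
    r2 (spatialD2 g u A y), hQ.fr3_spatialEps]

theorem fr4_dualWeyl (hQ : AdaptedAt g u y Q) (i j k l : Fin 4) :
    fr4 (Q y) (dualWeyl g y) i j k l = (1 / 2) * ∑ m, sgn m * ∑ n, sgn n *
      (leviCivita i j m n * fr4 (Q y) (weyl g y) m n k l) := by
  have e : dualWeyl g y = fun a b c d => (1 / 2) * ∑ m, ∑ e, gInv g y m e * ∑ n, ∑ f,
      gInv g y n f * (volForm g y a b m n * weyl g y e f c d) := by
    funext a b c d
    rw [dualWeyl]
    congr 1
    refine Finset.sum_congr rfl fun m _ => ?_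
    rw [Finset.sum_comm]
    simp only [Finset.mul_sum]
    exact Finset.sum_congr rfl fun _ _ => Finset.sum_congr rfl fun _ _ =>
      Finset.sum_congr rfl fun _ _ => by ring
  have hv : ∀ m n, fr1 (Q y) (fun a => fr1 (Q y) (fun b => fr1 (Q y) (fun c => fr1 (Q y)
      (fun d => volForm g y a b c d) n) m) j) i = leviCivita i j m n := by
    intro m n
    have h := fr4_volForm (g := g) hQ.frame.pos i j m n
    rw [hQ.vol_self, one_mul] at h
    exact h
  have hw : ∀ m n, fr1 (Q y) (fun c => fr1 (Q y) (fun d => fr1 (Q y) (fun e => fr1 (Q y)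
      (fun f => weyl g y e f c d) n) m) l) k = fr4 (Q y) (weyl g y) m n k l := by
    intro m n
    simp only [fr4]
    have : ∀ c, fr1 (Q y) (fun d => fr1 (Q y) (fun e => fr1 (Q y) (fun f => weyl g y e f c d) n) m) l
        = fr1 (Q y) (fun e => fr1 (Q y) (fun f => fr1 (Q y) (fun d => weyl g y e f c d) l) n) m := by
      intro c
      rw [fr1_comm]
      congr 1; funext e
      rw [fr1_comm]
    simp only [this]
    rw [fr1_comm]
    congr 1; funext e
    rw [fr1_comm]
  rw [e]
  simp only [hQ.sum_gInv_mul]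
  simp only [fr4, fr2, fr1_const_mul, fr1_sum, fr1_mul_const]
  congr 1
  refine Finset.sum_congr rfl fun m _ => ?_
  congr 1
  refine Finset.sum_congr rfl fun n _ => ?_
  congr 1
  rw [hv, hw]
  rfl

theorem fr2_magneticWeyl (hQ : AdaptedAt g u y Q) (i k : Fin 4) :
    fr2 (Q y) (magneticWeyl g u y) i k = fr4 (Q y) (dualWeyl g y) i 0 k 0 := by
  have := fr2_contract_vel hQ.vel.self_of_nhds (dualWeyl g y) i k
  simp only [hQ.frVel_self] at this
  simp at this
  exact this

theorem fr2_electricWeyl (hQ : AdaptedAt g u y Q) (i k : Fin 4) :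
    fr2 (Q y) (electricWeyl g u y) i k = fr4 (Q y) (weyl g y) i 0 k 0 := by
  have := fr2_contract_vel hQ.vel.self_of_nhds (weyl g y) i k
  simp only [hQ.frVel_self] at this
  simp at this
  exact this

theorem tInner_frame (hQ : AdaptedAt g u y Q) (A B : E4 → Fin 4 → Fin 4 → ℝ) :
    tInner g A B y = ∑ i, sgn i * ∑ j, sgn j * (fr2 (Q y) (A y) i j * fr2 (Q y) (B y) i j) := by
  have e : tInner g A B y = ∑ a, ∑ c, gInv g y a c * ∑ b, ∑ d, gInv g y b d * (A y a b * B y c d) := by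
    rw [tInner]
    refine Finset.sum_congr rfl fun a _ => ?_
    rw [Finset.sum_comm]
    simp only [Finset.mul_sum]
    exact Finset.sum_congr rfl fun _ _ => Finset.sum_congr rfl fun _ _ =>
      Finset.sum_congr rfl fun _ _ => by ring
  rw [e]
  simp only [hQ.sum_gInv_mul]
  simp only [fr2, fr1_const_mul, fr1_sum, fr1_mul_const]

theorem trSq_frame (hQ : AdaptedAt g u y Q) (A : E4 → Fin 4 → Fin 4 → ℝ) :
    trSq g A y = ∑ i, sgn i * ∑ j, sgn j * (fr2 (Q y) (A y) i j * fr2 (Q y) (A y) j i) := by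
  have e : trSq g A y = ∑ a, ∑ c, gInv g y a c * ∑ b, ∑ d, gInv g y b d * (A y c b * A y d a) := by
    rw [trSq]
    refine Finset.sum_congr rfl fun a _ => ?_
    rw [Finset.sum_comm]
    simp only [Finset.mul_sum]
    exact Finset.sum_congr rfl fun _ _ => Finset.sum_congr rfl fun _ _ =>
      Finset.sum_congr rfl fun _ _ => by ring
  rw [e]
  simp only [hQ.sum_gInv_mul]
  have hs : ∀ i j, fr1 (Q y) (fun a => fr1 (Q y) (fun b => A y b a) j) i
      = fr1 (Q y) (fun a => fr1 (Q y) (fun b => A y a b) i) j :=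
    fun i j => fr1_comm _ _ _ _
  simp only [fr2, fr1_const_mul, fr1_sum, fr1_mul_const, hs]

end AdaptedAt

end

noncomputable section

/-! ### Pointwise algebra in an adapted frame -/

/-- The algebraic properties of the frame components at a point of the Weyl tensor `w`, the Schouten
tensor `p`, the gradient `B` of the velocity, and its second derivative `T`. -/
structure PointData (w : Fin 4 → Fin 4 → Fin 4 → Fin 4 → ℝ) (p B : Fin 4 → Fin 4 → ℝ)
    (T : Fin 4 → Fin 4 → Fin 4 → ℝ) : Prop where
  left : ∀ i j k l, w i j k l = -w j i k l
  right : ∀ i j k l, w i j k l = -w i j l k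
  pair : ∀ i j k l, w i j k l = w k l i j
  cyclic : ∀ i j k l, w i j k l + w i k l j + w i l j k = 0
  trace : ∀ j l, ∑ i, sgn i * w i j i l = 0
  time : ∀ k, B k 0 = 0
  ricci : ∀ k i j, T k i j - T i k j = -(w 0 j k i
      + (Matrix.diagonal sgn 0 k * p j i - Matrix.diagonal sgn 0 i * p j k
        + Matrix.diagonal sgn j i * p 0 k - Matrix.diagonal sgn j k * p 0 i))

/-- The magnetic components. -/
def magAlg (w : Fin 4 → Fin 4 → Fin 4 → Fin 4 → ℝ) (i k : Fin 4) : ℝ :=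
  (1 / 2) * ∑ m, sgn m * ∑ n, sgn n * (leviCivita i 0 m n * w m n k 0)

/-- The components of the projected derivative of the shear. -/
def shearAlg (B : Fin 4 → Fin 4 → ℝ) (T : Fin 4 → Fin 4 → Fin 4 → ℝ) (θ : Fin 4 → ℝ)
    (k i j : Fin 4) : ℝ :=
  spat k * spat i * spat j * ((1 / 2) * (T k i j + T k j i + B k i * B 0 j + B k j * B 0 i)
    - (if i = j then 1 else 0) * θ k)

/-- The components of the curl of the shear. -/
def curlAlg (B : Fin 4 → Fin 4 → ℝ) (T : Fin 4 → Fin 4 → Fin 4 → ℝ) (θ : Fin 4 → ℝ)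
    (i j : Fin 4) : ℝ :=
  (1 / 2) * ∑ m, sgn m * ∑ n, sgn n * (leviCivita m n i 0 * shearAlg B T θ m j n
    + leviCivita m n j 0 * shearAlg B T θ m i n)

/-- The vorticity components. -/
def vortAlg (B : Fin 4 → Fin 4 → ℝ) (i : Fin 4) : ℝ :=
  -(1 / 2) * ∑ j, ∑ k, leviCivita i j k 0 * (sgn j * sgn k * B j k)

/-- The components of the derivative of the vorticity. -/
def dvortAlg (B : Fin 4 → Fin 4 → ℝ) (T : Fin 4 → Fin 4 → Fin 4 → ℝ) (m i : Fin 4) : ℝ :=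
  -(1 / 2) * (∑ j, ∑ k, leviCivita i j k 0 * (sgn j * sgn k * T m j k)
    + ∑ l, ∑ j, ∑ k, leviCivita i j k l * (sgn j * sgn k * B j k) * (sgn l * B m l))

/-- The projected trace-free symmetric part. -/
def hatAlg (A : Fin 4 → Fin 4 → ℝ) (i j : Fin 4) : ℝ :=
  (1 / 2) * (spat i * spat j * (A i j + A j i))
    - (1 / 3) * (if i = j then spat i else 0) * ∑ m, spat m * A m m

theorem sgn_zero : sgn 0 = -1 := rfl

theorem sgn_one : sgn 1 = 1 := rfl

theorem sgn_two : sgn 2 = 1 := rfl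

theorem sgn_three : sgn 3 = 1 := rfl

theorem spat_zero : spat 0 = 0 := rfl

theorem spat_one : spat 1 = 1 := rfl

theorem spat_two : spat 2 = 1 := rfl

theorem spat_three : spat 3 = 1 := rfl

/-- The Levi-Civita sums are written out once, here and in the similar tables below, so that later
arguments are linear arithmetic in components. -/
theorem magAlg_table (w : Fin 4 → Fin 4 → Fin 4 → Fin 4 → ℝ) (k : Fin 4) :
    magAlg w 0 k = 0 ∧
    magAlg w 1 k = -(1 / 2) * (w 2 3 k 0 - w 3 2 k 0) ∧
    magAlg w 2 k = -(1 / 2) * (w 3 1 k 0 - w 1 3 k 0) ∧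
    magAlg w 3 k = -(1 / 2) * (w 1 2 k 0 - w 2 1 k 0) := by
  simp only [magAlg, Fin.sum_univ_four, leviCivita_eq_vandermonde, sgn_zero, sgn_one, sgn_two,
    sgn_three]
  refine ⟨?_, ?_, ?_, ?_⟩ <;> norm_num <;> ring

theorem vortAlg_table (B : Fin 4 → Fin 4 → ℝ) :
    vortAlg B 0 = 0 ∧
    vortAlg B 1 = (1 / 2) * (B 2 3 - B 3 2) ∧
    vortAlg B 2 = (1 / 2) * (B 3 1 - B 1 3) ∧
    vortAlg B 3 = (1 / 2) * (B 1 2 - B 2 1) := by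
  simp only [vortAlg, Fin.sum_univ_four, leviCivita_eq_vandermonde, sgn_zero, sgn_one, sgn_two,
    sgn_three]
  refine ⟨?_, ?_, ?_, ?_⟩ <;> norm_num <;> ring

theorem dvortAlg_table (B : Fin 4 → Fin 4 → ℝ) (T : Fin 4 → Fin 4 → Fin 4 → ℝ)
    (hB : ∀ k, B k 0 = 0) (m : Fin 4) :
    dvortAlg B T m 1 = (1 / 2) * (T m 2 3 - T m 3 2 - B 0 2 * B m 3 + B 0 3 * B m 2) ∧
    dvortAlg B T m 2 = (1 / 2) * (T m 3 1 - T m 1 3 - B 0 3 * B m 1 + B 0 1 * B m 3) ∧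
    dvortAlg B T m 3 = (1 / 2) * (T m 1 2 - T m 2 1 - B 0 1 * B m 2 + B 0 2 * B m 1) := by
  simp only [dvortAlg, Fin.sum_univ_four, leviCivita_eq_vandermonde, sgn_zero, sgn_one, sgn_two,
    sgn_three, hB]
  refine ⟨?_, ?_, ?_⟩ <;> norm_num <;> ring

theorem curlAlg_zero_left (B : Fin 4 → Fin 4 → ℝ) (T : Fin 4 → Fin 4 → Fin 4 → ℝ) (θ : Fin 4 → ℝ)
    (j : Fin 4) : curlAlg B T θ 0 j = 0 := by
  have h0 : ∀ m n, leviCivita m n 0 0 = 0 := fun m n => by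
    rw [leviCivita_eq_vandermonde]; simp
  have h1 : ∀ m n, shearAlg B T θ m 0 n = 0 := fun m n => by
    rw [shearAlg, spat_zero]; ring
  simp only [curlAlg, h0, h1, zero_mul, mul_zero, add_zero, Finset.sum_const_zero]

theorem curlAlg_eq (B : Fin 4 → Fin 4 → ℝ) (T : Fin 4 → Fin 4 → Fin 4 → ℝ) (θ : Fin 4 → ℝ)
    (i j : Fin 4) : curlAlg B T θ i j = (1 / 2) *
      (∑ m, sgn m * ∑ n, sgn n * (leviCivita m n i 0 * shearAlg B T θ m j n)
      + ∑ m, sgn m * ∑ n, sgn n * (leviCivita m n j 0 * shearAlg B T θ m i n)) := by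
  simp only [curlAlg, mul_add, Finset.sum_add_distrib]

theorem curlAlg_symm (B : Fin 4 → Fin 4 → ℝ) (T : Fin 4 → Fin 4 → Fin 4 → ℝ) (θ : Fin 4 → ℝ)
    (i j : Fin 4) : curlAlg B T θ i j = curlAlg B T θ j i := by
  rw [curlAlg_eq, curlAlg_eq, add_comm]

/-- Because ε_{abc} = η_{abcd} u^d has u in the last slot and (1 2 3 0) is an odd permutation,
ε_{123} = -1 in an adapted frame. -/
theorem sum_leviCivita (X : Fin 4 → Fin 4 → ℝ) :
    ∑ m, sgn m * ∑ n, sgn n * (leviCivita m n 1 0 * X m n) = X 3 2 - X 2 3 ∧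
    ∑ m, sgn m * ∑ n, sgn n * (leviCivita m n 2 0 * X m n) = X 1 3 - X 3 1 ∧
    ∑ m, sgn m * ∑ n, sgn n * (leviCivita m n 3 0 * X m n) = X 2 1 - X 1 2 := by
  simp only [Fin.sum_univ_four, leviCivita_eq_vandermonde, sgn_zero, sgn_one, sgn_two, sgn_three]
  refine ⟨?_, ?_, ?_⟩ <;> norm_num <;> ring

/-- The unknown θ drops out: in each off-diagonal entry the two terms with equal shear indices have
the same derivative index and opposite signs. -/
theorem curlAlg_table (B : Fin 4 → Fin 4 → ℝ) (T : Fin 4 → Fin 4 → Fin 4 → ℝ) (θ : Fin 4 → ℝ) :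
    curlAlg B T θ 1 1 = shearAlg B T θ 3 1 2 - shearAlg B T θ 2 1 3 ∧
    curlAlg B T θ 2 2 = shearAlg B T θ 1 2 3 - shearAlg B T θ 3 2 1 ∧
    curlAlg B T θ 3 3 = shearAlg B T θ 2 3 1 - shearAlg B T θ 1 3 2 ∧
    curlAlg B T θ 1 2 = (1 / 2) * (shearAlg B T θ 3 2 2 - shearAlg B T θ 2 2 3
      + shearAlg B T θ 1 1 3 - shearAlg B T θ 3 1 1) ∧
    curlAlg B T θ 1 3 = (1 / 2) * (shearAlg B T θ 3 3 2 - shearAlg B T θ 2 3 3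
      + shearAlg B T θ 2 1 1 - shearAlg B T θ 1 1 2) ∧
    curlAlg B T θ 2 3 = (1 / 2) * (shearAlg B T θ 1 3 3 - shearAlg B T θ 3 3 1
      + shearAlg B T θ 2 2 1 - shearAlg B T θ 1 2 2) := by
  have h1 := fun j => (sum_leviCivita fun m n => shearAlg B T θ m j n).1
  have h2 := fun j => (sum_leviCivita fun m n => shearAlg B T θ m j n).2.1
  have h3 := fun j => (sum_leviCivita fun m n => shearAlg B T θ m j n).2.2
  simp only [curlAlg_eq, h1, h2, h3]
  refine ⟨?_, ?_, ?_, ?_, ?_, ?_⟩ <;> ring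

/-- A symmetric matrix is determined by its upper triangle. -/
theorem eq_of_symm {A C : Fin 4 → Fin 4 → ℝ} (hA : ∀ i j, A i j = A j i) (hC : ∀ i j, C i j = C j i)
    (h0 : ∀ j, A 0 j = C 0 j) (h11 : A 1 1 = C 1 1) (h22 : A 2 2 = C 2 2) (h33 : A 3 3 = C 3 3)
    (h12 : A 1 2 = C 1 2) (h13 : A 1 3 = C 1 3) (h23 : A 2 3 = C 2 3) (i j : Fin 4) :
    A i j = C i j := by
  have s : ∀ i j, A i j = C i j → A j i = C j i := fun i j h => by rw [hA, hC, h]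
  fin_cases i <;> fin_cases j
  exacts [h0 _, h0 _, h0 _, h0 _, s _ _ (h0 _), h11, h12, h13, s _ _ (h0 _), s _ _ h12, h22, h23,
    s _ _ (h0 _), s _ _ h13, s _ _ h23, h33]

theorem symm_of_upper {A : Fin 4 → Fin 4 → ℝ} (h0 : ∀ j, A 0 j = A j 0) (h12 : A 1 2 = A 2 1)
    (h13 : A 1 3 = A 3 1) (h23 : A 2 3 = A 3 2) (i j : Fin 4) : A i j = A j i := by
  fin_cases i <;> fin_cases j
  exacts [rfl, h0 _, h0 _, h0 _, (h0 _).symm, rfl, h12, h13, (h0 _).symm, h12.symm, rfl, h23,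
    (h0 _).symm, h13.symm, h23.symm, rfl]

theorem hatAlg_table (A : Fin 4 → Fin 4 → ℝ) :
    hatAlg A 1 1 = A 1 1 - (1 / 3) * (A 1 1 + A 2 2 + A 3 3) ∧
    hatAlg A 2 2 = A 2 2 - (1 / 3) * (A 1 1 + A 2 2 + A 3 3) ∧
    hatAlg A 3 3 = A 3 3 - (1 / 3) * (A 1 1 + A 2 2 + A 3 3) ∧
    hatAlg A 1 2 = (1 / 2) * (A 1 2 + A 2 1) ∧
    hatAlg A 1 3 = (1 / 2) * (A 1 3 + A 3 1) ∧
    hatAlg A 2 3 = (1 / 2) * (A 2 3 + A 3 2) := by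
  have n12 : (1 : Fin 4) ≠ 2 := by decide
  have n13 : (1 : Fin 4) ≠ 3 := by decide
  have n23 : (2 : Fin 4) ≠ 3 := by decide
  simp only [hatAlg, Fin.sum_univ_four, spat_zero, spat_one, spat_two, spat_three, if_true,
    if_neg n12, if_neg n13, if_neg n23]
  refine ⟨?_, ?_, ?_, ?_, ?_, ?_⟩ <;> ring

theorem hatAlg_zero_left (A : Fin 4 → Fin 4 → ℝ) (j : Fin 4) : hatAlg A 0 j = 0 := by
  simp [hatAlg, spat_zero]

theorem hatAlg_symm (A : Fin 4 → Fin 4 → ℝ) (i j : Fin 4) : hatAlg A i j = hatAlg A j i := by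
  by_cases h : i = j
  · rw [h]
  · rw [hatAlg, hatAlg, if_neg h, if_neg (Ne.symm h)]; ring

namespace PointData

variable {w : Fin 4 → Fin 4 → Fin 4 → Fin 4 → ℝ} {p B : Fin 4 → Fin 4 → ℝ}
  {T : Fin 4 → Fin 4 → Fin 4 → ℝ}

theorem weyl_diag (h : PointData w p B T) (i k l : Fin 4) : w i i k l = 0 := by
  linarith [h.left i i k l]

theorem weyl_diag' (h : PointData w p B T) (i k l : Fin 4) : w k l i i = 0 := by
  linarith [h.right k l i i]

/-- Symmetry of H is the trace condition W^i_{j i 0} = 0 in disguise. Its time components vanish by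
the antisymmetries of η and W. -/
theorem magAlg_symm (h : PointData w p B T) (i k : Fin 4) : magAlg w i k = magAlg w k i := by
  have t1 := h.trace 1 0
  have t2 := h.trace 2 0
  have t3 := h.trace 3 0
  simp only [Fin.sum_univ_four, sgn_zero, sgn_one, sgn_two, sgn_three, h.weyl_diag,
    h.weyl_diag'] at t1 t2 t3
  have l1 := h.left 2 1
  have l2 := h.left 3 1
  have l3 := h.left 3 2
  have z : ∀ i, magAlg w i 0 = 0 := by
    intro i
    simp only [magAlg, h.weyl_diag', mul_zero, Finset.sum_const_zero]
  have e12 : magAlg w 1 2 = magAlg w 2 1 := by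
    rw [(magAlg_table w 2).2.1, (magAlg_table w 1).2.2.1]
    linarith [l3 2 0, l2 1 0]
  have e13 : magAlg w 1 3 = magAlg w 3 1 := by
    rw [(magAlg_table w 3).2.1, (magAlg_table w 1).2.2.2]
    linarith [l3 3 0, l1 1 0]
  have e23 : magAlg w 2 3 = magAlg w 3 2 := by
    rw [(magAlg_table w 3).2.2.1, (magAlg_table w 2).2.2.2]
    linarith [l2 3 0, l1 2 0]
  have z' : ∀ i, magAlg w 0 i = 0 := fun i => (magAlg_table w i).1
  exact symm_of_upper (fun j => (z' j).trans (z j).symm) e12 e13 e23 i k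

/-- The algebraic form of the constraint `H = curl σ + Y`. -/
theorem magnetic_constraint (h : PointData w p B T) (θ : Fin 4 → ℝ) (i j : Fin 4) :
    magAlg w i j = curlAlg B T θ i j + (hatAlg (dvortAlg B T) i j
      + 2 * hatAlg (fun a b => B 0 a * vortAlg B b) i j) := by
  have R := h.ricci
  have C := h.cyclic 0 1 2 3
  have P : ∀ j k i, w 0 j k i = -w k i j 0 := fun j k i => by rw [h.pair, h.right]
  have L := h.left
  have t1 := h.trace 1 0
  have t2 := h.trace 2 0
  have t3 := h.trace 3 0
  simp only [Fin.sum_univ_four, sgn_zero, sgn_one, sgn_two, sgn_three, h.weyl_diag,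
    h.weyl_diag'] at t1 t2 t3
  simp only [P] at R C
  -- The Ricci identity for spatial derivative indices. The Schouten components p 0 i enter only
  -- through δ terms, which cancel in the symmetrised combinations below.
  have r121 := R 1 2 1
  have r122 := R 1 2 2
  have r123 := R 1 2 3
  have r131 := R 1 3 1
  have r132 := R 1 3 2
  have r133 := R 1 3 3
  have r231 := R 2 3 1
  have r232 := R 2 3 2
  have r233 := R 2 3 3
  simp [sgn_one, sgn_two, sgn_three] at r121 r122 r123 r131 r132 r133 r231 r232 r233
  obtain ⟨s11, s22, s33, s12, s13, s23⟩ := curlAlg_table B T θ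
  obtain ⟨d11, d22, d33, d12, d13, d23⟩ := hatAlg_table (dvortAlg B T)
  obtain ⟨a11, a22, a33, a12, a13, a23⟩ := hatAlg_table (fun a b => B 0 a * vortAlg B b)
  obtain ⟨-, v1, v2, v3⟩ := vortAlg_table B
  have D := dvortAlg_table B T h.time
  have N : ∀ k i j, shearAlg B T θ k i j = spat k * spat i * spat j *
    ((1 / 2) * (T k i j + T k j i + B k i * B 0 j + B k j * B 0 i)
    - (if i = j then 1 else 0) * θ k) := fun _ _ _ => rfl
  have zl : ∀ j, magAlg w 0 j = curlAlg B T θ 0 j + (hatAlg (dvortAlg B T) 0 j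
      + 2 * hatAlg (fun a b => B 0 a * vortAlg B b) 0 j) := by
    intro j
    rw [(magAlg_table w j).1, curlAlg_zero_left, hatAlg_zero_left, hatAlg_zero_left]; ring
  have e11 : magAlg w 1 1 = curlAlg B T θ 1 1 + (hatAlg (dvortAlg B T) 1 1
      + 2 * hatAlg (fun a b => B 0 a * vortAlg B b) 1 1) := by
    rw [(magAlg_table w 1).2.1, s11, d11, a11, v1, v2, v3, (D 1).1, (D 2).2.1, (D 3).2.2, N, N]
    simp [spat_one, spat_two, spat_three]
    linarith [L 3 2 1 0, L 3 2 2 0, L 3 2 3 0, L 3 1 1 0, L 3 1 2 0, L 3 1 3 0, L 2 1 1 0,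
      L 2 1 2 0, L 2 1 3 0]
  have e22 : magAlg w 2 2 = curlAlg B T θ 2 2 + (hatAlg (dvortAlg B T) 2 2
      + 2 * hatAlg (fun a b => B 0 a * vortAlg B b) 2 2) := by
    rw [(magAlg_table w 2).2.2.1, s22, d22, a22, v1, v2, v3, (D 1).1, (D 2).2.1, (D 3).2.2, N, N]
    simp [spat_one, spat_two, spat_three]
    linarith [L 3 2 1 0, L 3 2 2 0, L 3 2 3 0, L 3 1 1 0, L 3 1 2 0, L 3 1 3 0, L 2 1 1 0,
      L 2 1 2 0, L 2 1 3 0]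
  have e33 : magAlg w 3 3 = curlAlg B T θ 3 3 + (hatAlg (dvortAlg B T) 3 3
      + 2 * hatAlg (fun a b => B 0 a * vortAlg B b) 3 3) := by
    rw [(magAlg_table w 3).2.2.2, s33, d33, a33, v1, v2, v3, (D 1).1, (D 2).2.1, (D 3).2.2, N, N]
    simp [spat_one, spat_two, spat_three]
    linarith [L 3 2 1 0, L 3 2 2 0, L 3 2 3 0, L 3 1 1 0, L 3 1 2 0, L 3 1 3 0, L 2 1 1 0,
      L 2 1 2 0, L 2 1 3 0]
  have e12 : magAlg w 1 2 = curlAlg B T θ 1 2 + (hatAlg (dvortAlg B T) 1 2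
      + 2 * hatAlg (fun a b => B 0 a * vortAlg B b) 1 2) := by
    rw [(magAlg_table w 2).2.1, s12, d12, a12, v1, v2, (D 1).2.1, (D 2).1, N, N, N, N]
    simp [spat_one, spat_two, spat_three]
    linarith [L 3 2 1 0, L 3 2 2 0, L 3 2 3 0, L 3 1 1 0, L 3 1 2 0, L 3 1 3 0, L 2 1 1 0,
      L 2 1 2 0, L 2 1 3 0]
  have e13 : magAlg w 1 3 = curlAlg B T θ 1 3 + (hatAlg (dvortAlg B T) 1 3
      + 2 * hatAlg (fun a b => B 0 a * vortAlg B b) 1 3) := by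
    rw [(magAlg_table w 3).2.1, s13, d13, a13, v1, v3, (D 1).2.2, (D 3).1, N, N, N, N]
    simp [spat_one, spat_two, spat_three]
    linarith [L 3 2 1 0, L 3 2 2 0, L 3 2 3 0, L 3 1 1 0, L 3 1 2 0, L 3 1 3 0, L 2 1 1 0,
      L 2 1 2 0, L 2 1 3 0]
  have e23 : magAlg w 2 3 = curlAlg B T θ 2 3 + (hatAlg (dvortAlg B T) 2 3
      + 2 * hatAlg (fun a b => B 0 a * vortAlg B b) 2 3) := by
    rw [(magAlg_table w 3).2.2.1, s23, d23, a23, v2, v3, (D 2).2.2, (D 3).2.1, N, N, N, N]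
    simp [spat_one, spat_two, spat_three]
    linarith [L 3 2 1 0, L 3 2 2 0, L 3 2 3 0, L 3 1 1 0, L 3 1 2 0, L 3 1 3 0, L 2 1 1 0,
      L 2 1 2 0, L 2 1 3 0]
  exact eq_of_symm (C := fun i j => curlAlg B T θ i j + (hatAlg (dvortAlg B T) i j
      + 2 * hatAlg (fun a b => B 0 a * vortAlg B b) i j)) h.magAlg_symm
    (fun i j => congrArg₂ _ (curlAlg_symm B T θ i j) (congrArg₂ _ (hatAlg_symm _ i j)
      (congrArg _ (hatAlg_symm _ i j)))) zl e11 e22 e33 e12 e13 e23 i j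

end PointData

end

/-! ### Weyl components and the second divergence when E = 0 -/

noncomputable section

namespace PointData

variable {w : Fin 4 → Fin 4 → Fin 4 → Fin 4 → ℝ} {p B : Fin 4 → Fin 4 → ℝ}
  {T : Fin 4 → Fin 4 → Fin 4 → ℝ}

theorem weyl_zero_of_left (h : PointData w p B T) (hE : ∀ i k, w i 0 k 0 = 0) (k l : Fin 4) :
    w 0 k 0 l = 0 := by
  rw [h.left, h.right, neg_neg]; exact hE k l

/-- In dimension three a trace-free tensor with the symmetries of the curvature vanishes. -/
theorem weyl_spatial_eq_zero (h : PointData w p B T) (hE : ∀ i k, w i 0 k 0 = 0) :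
    w 1 2 1 2 = 0 ∧ w 1 2 1 3 = 0 ∧ w 1 2 2 3 = 0 ∧ w 1 3 1 3 = 0 ∧ w 1 3 2 3 = 0
      ∧ w 2 3 2 3 = 0 := by
  -- With E = 0 the time term leaves these traces. They become the vanishing of the
  -- three-dimensional Ricci contraction, which determines the spatial components.
  have t11 := h.trace 1 1
  have t22 := h.trace 2 2
  have t33 := h.trace 3 3
  have t12 := h.trace 1 2
  have t13 := h.trace 1 3
  have t23 := h.trace 2 3
  simp only [Fin.sum_univ_four, sgn_zero, sgn_one, sgn_two, sgn_three, h.weyl_diag, h.weyl_diag',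
    h.weyl_zero_of_left hE] at t11 t22 t33 t12 t13 t23
  have L := fun k l => h.left 2 1 k l
  have L' := fun k l => h.left 3 1 k l
  have L'' := fun k l => h.left 3 2 k l
  have R := fun k l => h.right k l 2 1
  have R' := fun k l => h.right k l 3 1
  have R'' := fun k l => h.right k l 3 2
  simp only [L, L', L'', R, R', R''] at t11 t22 t33 t12 t13 t23
  refine ⟨?_, ?_, ?_, ?_, ?_, ?_⟩ <;> linarith [h.pair 1 2 1 3, h.pair 1 2 2 3, h.pair 1 3 2 3]

/-- The components of the Weyl tensor in terms of the magnetic part. -/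
theorem weyl_eq_magAlg (h : PointData w p B T) (k : Fin 4) :
    w 1 2 k 0 = -magAlg w 3 k ∧ w 1 3 k 0 = magAlg w 2 k ∧ w 2 3 k 0 = -magAlg w 1 k := by
  obtain ⟨-, m1, m2, m3⟩ := magAlg_table w k
  refine ⟨?_, ?_, ?_⟩ <;> linarith [h.left 2 1 k 0, h.left 3 1 k 0, h.left 3 2 k 0]

/-- H is trace-free because of the cyclic identity on the indices 0, 1, 2, 3. -/
theorem magAlg_trace (h : PointData w p B T) :
    magAlg w 3 3 = -magAlg w 1 1 - magAlg w 2 2 := by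
  have c := h.cyclic 0 1 2 3
  rw [h.pair 0 1, h.pair 0 2, h.pair 0 3, h.right 2 3, h.right 3 1, h.right 1 2, h.left 3 1,
    (h.weyl_eq_magAlg 1).2.2, (h.weyl_eq_magAlg 2).2.1, (h.weyl_eq_magAlg 3).1] at c
  linarith

/-- If the electric part vanishes, the second divergence of the electric part is the contraction of
`H` with `curl σ - 3 Y`. -/
theorem magnetic_orthogonal (h : PointData w p B T) (hE : ∀ i k, w i 0 k 0 = 0)
    (hD : ∑ i, ∑ j, ∑ k, ∑ l, sgn i * w i j k l *
      (sgn k * sgn l * T i k l * (if j = 0 then 1 else 0)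
        + sgn k * sgn l * B k l * (sgn j * B i j)
        + (sgn k * sgn j * T i k j * (if l = 0 then 1 else 0)
        + sgn k * sgn j * B k j * (sgn l * B i l))) = 0) (θ : Fin 4 → ℝ) :
    ∑ i, sgn i * ∑ j, sgn j * (magAlg w i j * (curlAlg B T θ i j - 3 * (hatAlg (dvortAlg B T) i j
      + 2 * hatAlg (fun a b => B 0 a * vortAlg B b) i j))) = 0 := by
  have hE' := h.weyl_zero_of_left hE
  have hE1 : ∀ i k, w i 0 0 k = 0 := fun i k => by rw [h.right, hE, neg_zero]
  have hE2 : ∀ i k, w 0 i k 0 = 0 := fun i k => by rw [h.left, hE, neg_zero]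
  obtain ⟨z1, z2, z3, z4, z5, z6⟩ := h.weyl_spatial_eq_zero hE
  have z2' := (h.pair 1 3 1 2).trans z2
  have z3' := (h.pair 2 3 1 2).trans z3
  have z5' := (h.pair 2 3 1 3).trans z5
  have L := fun k l => h.left 2 1 k l
  have L' := fun k l => h.left 3 1 k l
  have L'' := fun k l => h.left 3 2 k l
  have R := fun k l => h.right k l 2 1
  have R' := fun k l => h.right k l 3 1
  have R'' := fun k l => h.right k l 3 2
  have M1 := fun k => (h.weyl_eq_magAlg k).1
  have M2 := fun k => (h.weyl_eq_magAlg k).2.1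
  have M3 := fun k => (h.weyl_eq_magAlg k).2.2
  have M1' : ∀ k, w 1 2 0 k = magAlg w 3 k := fun k => by rw [h.right, M1, neg_neg]
  have M2' : ∀ k, w 1 3 0 k = -magAlg w 2 k := fun k => by rw [h.right, M2]
  have M3' : ∀ k, w 2 3 0 k = magAlg w 1 k := fun k => by rw [h.right, M3, neg_neg]
  have N1 : ∀ k, w k 0 1 2 = -magAlg w 3 k := fun k => by rw [h.pair, M1]
  have N2 : ∀ k, w k 0 1 3 = magAlg w 2 k := fun k => by rw [h.pair, M2]
  have N3 : ∀ k, w k 0 2 3 = -magAlg w 1 k := fun k => by rw [h.pair, M3]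
  have N1' : ∀ k, w 0 k 1 2 = magAlg w 3 k := fun k => by rw [h.pair, M1']
  have N2' : ∀ k, w 0 k 1 3 = -magAlg w 2 k := fun k => by rw [h.pair, M2']
  have N3' : ∀ k, w 0 k 2 3 = magAlg w 1 k := fun k => by rw [h.pair, M3']
  have z : ∀ i, magAlg w i 0 = 0 := fun i => by
    rw [h.magAlg_symm]; exact (magAlg_table w i).1
  have z' : ∀ i, magAlg w 0 i = 0 := fun i => (magAlg_table w i).1
  -- Every Weyl component becomes zero or plus or minus an entry of H. As the spatial components
  -- vanish and B k 0 = 0, each surviving quadratic term contains an acceleration component B 0 a.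
  simp only [Fin.sum_univ_four, sgn_zero, sgn_one, sgn_two, sgn_three, h.weyl_diag, h.weyl_diag',
    hE, hE', hE1, hE2, L, L', L'', R, R', R'', z1, z2, z3, z4, z5, z6, z2', z3', z5', M1, M2, M3,
    M1', M2', M3', N1, N2, N3, N1', N2', N3', z, neg_zero, neg_neg, mul_zero, zero_mul, add_zero,
    zero_add, one_mul, mul_one, h.time, if_true] at hD
  norm_num at hD
  have n2 : (2 : Fin 4) ≠ 0 := by decide
  have n3 : (3 : Fin 4) ≠ 0 := by decide
  simp only [if_neg n2, if_neg n3, add_zero, zero_add] at hD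
  obtain ⟨s11, s22, s33, s12, s13, s23⟩ := curlAlg_table B T θ
  obtain ⟨d11, d22, d33, d12, d13, d23⟩ := hatAlg_table (dvortAlg B T)
  obtain ⟨a11, a22, a33, a12, a13, a23⟩ := hatAlg_table (fun a b => B 0 a * vortAlg B b)
  obtain ⟨-, v1, v2, v3⟩ := vortAlg_table B
  have D1 := fun m => (dvortAlg_table B T h.time m).1
  have D2 := fun m => (dvortAlg_table B T h.time m).2.1
  have D3 := fun m => (dvortAlg_table B T h.time m).2.2
  have N : ∀ k i j, shearAlg B T θ k i j = spat k * spat i * spat j *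
    ((1 / 2) * (T k i j + T k j i + B k i * B 0 j + B k j * B 0 i)
    - (if i = j then 1 else 0) * θ k) := fun _ _ _ => rfl
  have n12 : (1 : Fin 4) ≠ 2 := by decide
  have n13 : (1 : Fin 4) ≠ 3 := by decide
  have n23 : (2 : Fin 4) ≠ 3 := by decide
  simp only [Fin.sum_univ_four, z, z', zero_mul, mul_zero, zero_add, add_zero,
    h.magAlg_symm 2 1, h.magAlg_symm 3 1, h.magAlg_symm 3 2, curlAlg_symm B T θ 2 1,
    curlAlg_symm B T θ 3 1, curlAlg_symm B T θ 3 2, hatAlg_symm _ 2 1, hatAlg_symm _ 3 1,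
    hatAlg_symm _ 3 2, s11, s22, s33, s12, s13, s23, d11, d22, d33, d12, d13, d23, a11, a22, a33,
    a12, a13, a23, v1, v2, v3, D1, D2, D3, N, spat_one, spat_two, spat_three, sgn_one, sgn_two,
    sgn_three, if_true, if_neg n12, if_neg n12.symm, if_neg n13, if_neg n13.symm, if_neg n23,
    if_neg n23.symm, h.magAlg_trace]
  simp only [h.magAlg_symm 2 1, h.magAlg_symm 3 1, h.magAlg_symm 3 2, h.magAlg_trace] at hD
  -- After symmetry and trace-freeness of H are used on both sides, the two expressions coincide
  -- with coefficient one. The acceleration terms are those hidden in the curl of σ, in Dω and in a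
  -- ⊗ ω.
  linear_combination hD

end PointData

end

/-! ### The conditions in a coordinate domain -/

noncomputable section

open Filter Topology Matrix

variable {g : E4 → Matrix (Fin 4) (Fin 4) ℝ} {u : E4 → Fin 4 → ℝ} {y : E4}

/-- Projection is idempotent, so the projected derivative Dω and the full derivative ∇ω have the
same trace-free symmetric part. -/
theorem hatAlg_spat (A : Fin 4 → Fin 4 → ℝ) (i j : Fin 4) :
    hatAlg (fun a b => spat a * spat b * A a b) i j = hatAlg A i j := by
  have h : ∀ i, spat i * spat i = spat i := fun i => by unfold spat; split_ifs <;> norm_num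
  have h1 : ∀ m, spat m * (spat m * spat m * A m m) = spat m * A m m := fun m => by rw [h, ← mul_assoc, h]
  have h2 : spat i * spat j * (spat i * spat j * A i j + spat j * spat i * A j i)
      = spat i * spat j * (A i j + A j i) := by
    linear_combination (A i j + A j i) * (spat i * spat i * h j + spat j * h i)
  simp only [hatAlg, h1, h2]

namespace AdaptedAt

variable {Q : E4 → Matrix (Fin 4) (Fin 4) ℝ}

/-- The passage from geometry to algebra: beyond these relations, the pointwise lemmas need only E =
0 and the second divergence identity. -/
theorem pointData (hQ : AdaptedAt g u y Q) :
    PointData (fr4 (Q y) (weyl g y)) (fr2 (Q y) (schouten g y)) (fr2 (Q y) (gradU g u y))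
      (fr3 (Q y) (nabla2 g (gradU g u) y)) where
  left := frWeyl_antisymm_left hQ.metric (Q y)
  right := frWeyl_antisymm_right g y (Q y)
  pair := frWeyl_pair hQ.metric (Q y)
  cyclic := frWeyl_cyclic hQ.metric (Q y)
  trace := hQ.frWeyl_trace_self
  time := hQ.frGradU_zero
  ricci k i j := by rw [hQ.ricci_identity, hQ.frRiemann]

theorem fr2_magneticWeyl_eq (hQ : AdaptedAt g u y Q) (i k : Fin 4) :
    fr2 (Q y) (magneticWeyl g u y) i k = magAlg (fr4 (Q y) (weyl g y)) i k := by
  rw [hQ.fr2_magneticWeyl, hQ.fr4_dualWeyl, magAlg]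

/-- The function θ is unspecified, which is harmless: the two relations for H hold for every θ. -/
theorem fr2_curlShear (hQ : AdaptedAt g u y Q) : ∃ θ : Fin 4 → ℝ, ∀ i j,
    fr2 (Q y) (curlShear g u y) i j
      = curlAlg (fr2 (Q y) (gradU g u y)) (fr3 (Q y) (nabla2 g (gradU g u) y)) θ i j := by
  obtain ⟨θ, hθ⟩ := hQ.frNabla_shear
  have key : ∀ k i j, fr3 (Q y) (spatialD2 g u (shear g u) y) k i j
      = shearAlg (fr2 (Q y) (gradU g u y)) (fr3 (Q y) (nabla2 g (gradU g u) y)) θ k i j := by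
    intro k i j
    rw [hQ.fr3_spatialD2, shearAlg]
    by_cases hi : i = 0
    · simp [hi, spat_zero]
    by_cases hj : j = 0
    · simp [hj, spat_zero]
    rw [hθ k i j hi hj]
  refine ⟨θ, fun i j => ?_⟩
  rw [curlShear, hQ.fr2_curl, curlAlg]
  simp only [key]

theorem fr2_vortTensor (hQ : AdaptedAt g u y Q) (i j : Fin 4) :
    fr2 (Q y) (vortTensor g u y) i j
      = hatAlg (dvortAlg (fr2 (Q y) (gradU g u y)) (fr3 (Q y) (nabla2 g (gradU g u) y))) i j
      + 2 * hatAlg (fun a b => fr2 (Q y) (gradU g u y) 0 a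
        * vortAlg (fr2 (Q y) (gradU g u y)) b) i j := by
  have h1 : fr2 (Q y) (vortTensor g u y) i j
      = fr2 (Q y) (hat g u (spatialD1 g u (vorticity g u)) y) i j
      + 2 * fr2 (Q y) (hat g u (fun z c d => accel g u z c * vorticity g u z d) y) i j := by
    simp only [fr2, vortTensor, fr1_add, fr1_const_mul]
  have h2 : ∀ a b, fr2 (Q y) (spatialD1 g u (vorticity g u) y) a b = spat a * spat b *
      dvortAlg (fr2 (Q y) (gradU g u y)) (fr3 (Q y) (nabla2 g (gradU g u) y)) a b := by
    intro a b
    rw [hQ.fr2_spatialD1, hQ.frNabla_vorticity, dvortAlg]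
  have h3 : ∀ a b, fr2 (Q y) (fun c d => accel g u y c * vorticity g u y d) a b
      = fr2 (Q y) (gradU g u y) 0 a * vortAlg (fr2 (Q y) (gradU g u y)) b := by
    intro a b
    simp only [fr2, fr1_const_mul, fr1_mul_const]
    rw [hQ.frAccel_self, hQ.fr1_vorticity_self, vortAlg]
    rfl
  rw [h1, hQ.fr2_hat, hQ.fr2_hat, ← hatAlg_spat]
  simp only [h2, h3, hatAlg]

end AdaptedAt

/-- The conditions on the shear and the vorticity of an observer who measures a vanishing electric
Weyl field, in a coordinate domain. -/
theorem conditions_of_electricWeyl_eq_zero (hobs : ∀ᶠ z in 𝓝 y, ObserverAt g u z)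
    (hC : ∀ᶠ z in 𝓝 y, ∀ a b c, cotton g z a b c = 0)
    (hE : ∀ᶠ z in 𝓝 y, ∀ a b, electricWeyl g u z a b = 0) :
    trSq g (curlShear g u) y - 3 * trSq g (vortTensor g u) y
      = 2 * tInner g (curlShear g u) (vortTensor g u) y ∧
    ((∃ a b, magneticWeyl g u y a b ≠ 0) → 0 < trSq g (vortTensor g u) y ∧
      trSq g (vortTensor g u) y < trSq g (curlShear g u) y) := by
  obtain ⟨Q, hQ⟩ := exists_adapted hobs
  have h := hQ.pointData
  have hE0 : ∀ i k, fr4 (Q y) (weyl g y) i 0 k 0 = 0 := fun i k => by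
    rw [← hQ.fr2_electricWeyl]
    exact fr1_eq_zero fun a => fr1_eq_zero fun b => hE.self_of_nhds a b
  obtain ⟨θ, hS⟩ := hQ.fr2_curlShear
  have hO := h.magnetic_orthogonal hE0 (hQ.div_divElectric hC hE) θ
  have hM := h.magnetic_constraint θ
  simp only [← hQ.fr2_vortTensor, ← hS, ← hQ.fr2_magneticWeyl_eq] at hO hM
  have hH0 : ∀ j, fr2 (Q y) (magneticWeyl g u y) 0 j = 0 := fun j => by
    rw [hQ.fr2_magneticWeyl_eq]; exact (magAlg_table _ j).1
  have hY0 : ∀ j, fr2 (Q y) (vortTensor g u y) 0 j = 0 := fun j => by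
    rw [hQ.fr2_vortTensor, hatAlg_zero_left, hatAlg_zero_left]; ring
  have hYs : ∀ i j, fr2 (Q y) (vortTensor g u y) i j = fr2 (Q y) (vortTensor g u y) j i :=
    fun i j => by rw [hQ.fr2_vortTensor, hQ.fr2_vortTensor, hatAlg_symm, hatAlg_symm _ i j]
  have hHs : ∀ i j, fr2 (Q y) (magneticWeyl g u y) i j = fr2 (Q y) (magneticWeyl g u y) j i :=
    fun i j => by rw [hQ.fr2_magneticWeyl_eq, hQ.fr2_magneticWeyl_eq, h.magAlg_symm]
  have hne : (∃ a b, magneticWeyl g u y a b ≠ 0) → ∃ i j, fr2 (Q y) (magneticWeyl g u y) i j ≠ 0 := by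
    rintro ⟨a, b, hab⟩
    by_contra! hc
    exact hab (fr1_injective hQ.frame.pos.ne' (fun j => fr1_injective hQ.frame.pos.ne'
      (A := fun a => fr1 (Q y) (fun b => magneticWeyl g u y a b) j) (fun i => hc i j) a) b)
  rw [hQ.trSq_frame, hQ.trSq_frame, hQ.tInner_frame]
  generalize fr2 (Q y) (magneticWeyl g u y) = H at *
  generalize fr2 (Q y) (vortTensor g u y) = Y at *
  generalize fr2 (Q y) (curlShear g u y) = S at *
  -- With S eliminated the orthogonality relation reads |H|² = 4 (H, Y), and the equality to be
  -- proved is the same relation.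
  have hS' : ∀ i j, S i j = H i j - Y i j := fun i j => by rw [hM]; ring
  have hH0' : ∀ j, H j 0 = 0 := fun j => by rw [hHs, hH0]
  have hY0' : ∀ j, Y j 0 = 0 := fun j => by rw [hYs, hY0]
  simp only [hS', Fin.sum_univ_four, sgn_zero, sgn_one, sgn_two, sgn_three, hH0, hH0', hY0, hY0',
    hHs 2 1, hHs 3 1, hHs 3 2, hYs 2 1, hYs 3 1, hYs 3 2] at hO ⊢
  refine ⟨by linear_combination hO, fun hne' => ?_⟩
  -- The time components of H vanish, so its square is a sum of real squares, positive unless H = 0.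
  have hpos : 0 < H 1 1 ^ 2 + H 2 2 ^ 2 + H 3 3 ^ 2 + 2 * (H 1 2 ^ 2 + H 1 3 ^ 2 + H 2 3 ^ 2) := by
    by_contra! hle
    have e : ∀ a b, H a b = 0 := by
      refine eq_of_symm (C := fun _ _ => 0) hHs (fun _ _ => rfl) hH0 ?_ ?_ ?_ ?_ ?_ ?_ <;>
      · refine pow_eq_zero_iff (two_ne_zero) |>.1 (le_antisymm ?_ (sq_nonneg _))
        linarith [sq_nonneg (H 1 1), sq_nonneg (H 2 2), sq_nonneg (H 3 3), sq_nonneg (H 1 2),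
          sq_nonneg (H 1 3), sq_nonneg (H 2 3)]
    obtain ⟨i, j, hij⟩ := hne hne'
    exact hij (e i j)
  constructor
  -- From |H - 8Y|² ≥ 0 and |H|² = 4 (H, Y) one gets 64 |Y|² ≥ 3 |H|². Any factor above 2 in place
  -- of 8 would also give a positive bound.
  · linarith [sq_nonneg (H 1 1 - 8 * Y 1 1), sq_nonneg (H 2 2 - 8 * Y 2 2),
      sq_nonneg (H 3 3 - 8 * Y 3 3), sq_nonneg (H 1 2 - 8 * Y 1 2), sq_nonneg (H 1 3 - 8 * Y 1 3),
      sq_nonneg (H 2 3 - 8 * Y 2 3)]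
  -- Here |S|² - |Y|² = |H|² - 2 (H, Y) = |H|²/2.
  · linarith

end

noncomputable section

open Filter Topology Matrix

/-! ### Existence of frames -/

/-- A unit timelike vector of Minkowski space is the image of the first basis vector under a Lorentz
transformation. -/
theorem exists_lorentz {c : Fin 4 → ℝ} (hc : ∑ i, sgn i * c i ^ 2 = -1) :
    ∃ L : Matrix (Fin 4) (Fin 4) ℝ, Lᵀ * Matrix.diagonal sgn * L = Matrix.diagonal sgn ∧
      ∀ a, L a 0 = c a := by
  -- If c 0 = 1 then c is the first basis vector, and the reflection used otherwise would
  -- degenerate.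
  by_cases h1 : c 0 = 1
  · refine ⟨1, by simp, fun a => ?_⟩
    simp only [Fin.sum_univ_four, sgn_zero, sgn_one, sgn_two, sgn_three, h1] at hc
    have h : ∀ a : Fin 4, a ≠ 0 → c a = 0 := by
      intro a ha
      have : c a ^ 2 ≤ 0 := by
        fin_cases a
        · exact absurd rfl ha
        all_goals simp only [Fin.reduceFinMk]; linarith [sq_nonneg (c 1), sq_nonneg (c 2), sq_nonneg (c 3)]
      exact pow_eq_zero_iff two_ne_zero |>.1 (le_antisymm this (sq_nonneg _))
    by_cases ha : a = 0
    · rw [ha, h1]; rfl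
    · rw [h a ha, Matrix.one_apply_ne ha]
  have hk : c 0 - 1 ≠ 0 := sub_ne_zero.2 h1
  -- The Lorentz transformation is the reflection in the hyperplane orthogonal to n = e_0 - c, which
  -- sends e_0 to c. Here ⟨n, n⟩ = 2 (c 0 - 1) ≠ 0, so the reflection coefficient 2/⟨n, n⟩ is k =
  -- 1/(c 0 - 1).
  set n : Fin 4 → ℝ := fun a => (if a = 0 then 1 else 0) - c a with hn
  have hnn : ∑ a, sgn a * n a ^ 2 = 2 * (c 0 - 1) := by
    simp only [hn, Fin.sum_univ_four] at hc ⊢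
    simp [sgn_zero, sgn_one, sgn_two, sgn_three] at hc ⊢
    linear_combination hc
  obtain ⟨k, hk⟩ : ∃ k, (c 0 - 1) * k = 1 := ⟨_, mul_inv_cancel₀ hk⟩
  refine ⟨Matrix.of fun a i => (if a = i then 1 else 0) - n a * (sgn i * n i) * k, ?_, ?_⟩
  · ext i j
    have e : ∀ a, ((if a = i then 1 else 0) - n a * (sgn i * n i) * k) * sgn a
        * ((if a = j then 1 else 0) - n a * (sgn j * n j) * k)
        = (if a = i then sgn a * (if a = j then 1 else 0) else 0)
          - (if a = i then n a * sgn a * (sgn j * n j) * k else 0)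
          - (if a = j then n a * sgn a * (sgn i * n i) * k else 0)
          + sgn a * n a ^ 2 * ((sgn i * n i) * (sgn j * n j) * k ^ 2) := by
      intro a
      split_ifs <;> ring
    rw [Matrix.mul_apply]
    simp only [Matrix.mul_diagonal, Matrix.transpose_apply, Matrix.of_apply, e,
      Finset.sum_add_distrib, Finset.sum_sub_distrib, ← Finset.sum_mul, hnn, Finset.sum_ite_eq',
      Finset.mem_univ, if_true, Matrix.diagonal_apply]
    split_ifs <;> linear_combination 2 * (sgn i * n i) * (sgn j * n j) * k * hk
  · intro a
    have h0 : n 0 = 1 - c 0 := by simp [hn]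
    have h2 : n a = (if a = 0 then 1 else 0) - c a := rfl
    simp only [Matrix.of_apply, h0, sgn_zero]
    linear_combination -n a * hk - h2

/-- A unit timelike vector can be completed to a positively oriented orthonormal frame. -/
theorem exists_isFrame {g : E4 → Matrix (Fin 4) (Fin 4) ℝ} {u : E4 → Fin 4 → ℝ} {y : E4}
    {R : Matrix (Fin 4) (Fin 4) ℝ} (hR : Rᵀ * g y * R = Matrix.diagonal sgn)
    (hu : ∑ a, ∑ b, u y a * g y a b * u y b = -1) : ∃ P, IsFrame g u y P := by
  have hdet : R.det ≠ 0 := by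
    intro h
    have := congrArg Matrix.det hR
    rw [Matrix.det_mul, h, mul_zero, det_diagonal_sgn] at this
    norm_num at this
  have hRR : R * R⁻¹ = 1 := Matrix.mul_nonsing_inv _ (Ne.isUnit hdet)
  obtain ⟨c, huc⟩ : ∃ c, u y = R *ᵥ c :=
    ⟨R⁻¹ *ᵥ u y, by rw [Matrix.mulVec_mulVec, hRR, Matrix.one_mulVec]⟩
  have hcc : ∑ i, sgn i * c i ^ 2 = -1 := by
    have h1 : c ⬝ᵥ ((Rᵀ * g y * R) *ᵥ c) = u y ⬝ᵥ (g y *ᵥ u y) := by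
      rw [huc, ← Matrix.mulVec_mulVec, ← Matrix.mulVec_mulVec, Matrix.dotProduct_mulVec c Rᵀ,
        Matrix.vecMul_transpose]
    have h2 : u y ⬝ᵥ (g y *ᵥ u y) = -1 := by
      rw [← hu]
      simp only [dotProduct, Matrix.mulVec, Finset.mul_sum, mul_assoc]
    rw [← h2, ← h1, hR]
    simp only [dotProduct, Matrix.mulVec_diagonal]
    exact Finset.sum_congr rfl fun _ _ => by ring
  obtain ⟨L, hL, hL0⟩ := exists_lorentz hcc
  have ho : (R * L)ᵀ * g y * (R * L) = Matrix.diagonal sgn := by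
    rw [Matrix.transpose_mul, ← hL, ← hR]
    simp only [Matrix.mul_assoc]
  have ht : ∀ a, (R * L) a 0 = u y a := by
    intro a
    rw [huc]
    simp only [Matrix.mul_apply, hL0, Matrix.mulVec, dotProduct]
  have hd : (R * L).det ≠ 0 := by
    intro h
    have := congrArg Matrix.det ho
    rw [Matrix.det_mul, h, mul_zero, det_diagonal_sgn] at this
    norm_num at this
  -- A negatively oriented frame is corrected by reversing its last, spacelike leg, which leaves u
  -- untouched.
  rcases lt_or_gt_of_ne hd with h | h
  · have hD : (Matrix.diagonal ![(1 : ℝ), 1, 1, -1]).det = -1 := by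
      rw [Matrix.det_diagonal, Fin.prod_univ_four]; simp
    refine ⟨R * L * Matrix.diagonal ![1, 1, 1, -1], ?_, fun a => ?_, ?_⟩
    · have : (R * L * Matrix.diagonal ![1, 1, 1, -1])ᵀ * g y * (R * L * Matrix.diagonal ![1, 1, 1, -1])
          = Matrix.diagonal ![1, 1, 1, -1] * ((R * L)ᵀ * g y * (R * L))
            * Matrix.diagonal ![1, 1, 1, -1] := by
        rw [Matrix.transpose_mul, Matrix.diagonal_transpose]
        simp only [Matrix.mul_assoc]
      rw [this, ho, Matrix.diagonal_mul_diagonal, Matrix.diagonal_mul_diagonal]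
      congr 1
      funext i
      fin_cases i <;> simp
    · rw [Matrix.mul_diagonal, ht]; simp
    · rw [Matrix.det_mul, hD]; linarith
  · exact ⟨R * L, ho, ht, h⟩

end

noncomputable section

open Filter Topology Matrix

/-! ### Components in a chart -/

section Manifold

attribute [local instance] chartedSpaceSelf

variable {M : Type*} [TopologicalSpace M] [ChartedSpace E4 M]
  {e : OpenPartialHomeomorph M E4} {z : E4}

/-- The chain rule for the chart and its inverse: components in a chart determine the tangent
vector. -/
theorem mfderiv_symm_mfderiv (he : e ∈ charts M) (hz : z ∈ e.target)
    (v : TangentSpace 𝓘(ℝ, E4) (e.symm z)) :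
    mfderiv 𝓘(ℝ, E4) 𝓘(ℝ, E4) e.symm z (mfderiv 𝓘(ℝ, E4) 𝓘(ℝ, E4) e (e.symm z) v : E4) = v := by
  have h1 : e.MDifferentiable 𝓘(ℝ, E4) 𝓘(ℝ, E4) :=
    ⟨(contMDiffOn_of_mem_maximalAtlas he).mdifferentiableOn (by simp),
      (contMDiffOn_symm_of_mem_maximalAtlas he).mdifferentiableOn (by simp)⟩
  have h2 := DFunLike.congr_fun (h1.symm_comp_deriv (e.map_target hz)) v
  -- The chain rule gives the derivative at e (e.symm z), which equals z only propositionally.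
  -- Generalising the base point allows the substitution.
  have h3 : ∀ y, y = e (e.symm z) → (mfderiv 𝓘(ℝ, E4) 𝓘(ℝ, E4) e.symm y : E4 →L[ℝ] E4)
      (mfderiv 𝓘(ℝ, E4) 𝓘(ℝ, E4) e (e.symm z) v : E4) = (v : E4) := by
    rintro y rfl
    exact h2
  exact h3 z (e.right_inv hz).symm

theorem clm_eq_sum (L : E4 →L[ℝ] E4) (w : E4) :
    L w = ∑ a, w a • L (EuclideanSpace.single a (1 : ℝ)) := by
  have h : w = ∑ a, w a • (EuclideanSpace.single a (1 : ℝ) : E4) := by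
    ext i
    simp [Pi.single_apply]
  conv_lhs => rw [h]
  rw [map_sum]
  simp only [map_smul]

/-- A tangent vector is the combination of the coordinate vectors with its components. -/
theorem eq_sum_coordVector (he : e ∈ charts M) (hz : z ∈ e.target)
    (v : TangentSpace 𝓘(ℝ, E4) (e.symm z)) :
    v = ∑ a, (show E4 from mfderiv 𝓘(ℝ, E4) 𝓘(ℝ, E4) e (e.symm z) v) a •
      mfderiv 𝓘(ℝ, E4) 𝓘(ℝ, E4) e.symm z (EuclideanSpace.single a (1 : ℝ) : E4) :=
  (mfderiv_symm_mfderiv he hz v).symm.trans (clm_eq_sum _ _)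

variable [IsManifold 𝓘(ℝ, E4) ∞ M]

/-- The coordinate vector fields are smooth. -/
theorem contMDiffAt_coordVector (he : e ∈ charts M) (hz : z ∈ e.target) (v : E4) :
    ContMDiffAt 𝓘(ℝ, E4) 𝓘(ℝ, E4).tangent ∞
      (fun y => (⟨e.symm y, mfderiv 𝓘(ℝ, E4) 𝓘(ℝ, E4) e.symm y v⟩ : TangentBundle 𝓘(ℝ, E4) M)) z := by
  have : IsManifold 𝓘(ℝ, E4) 1 M := IsManifold.of_le (n := ∞) (by norm_num)
  -- A coordinate field is the tangent map of the inverse chart applied to a constant section of the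
  -- model's tangent bundle.
  have h1 := (contMDiffOn_symm_of_mem_maximalAtlas he).contMDiffOn_tangentMapWithin
    (m := ∞) (by simp) e.open_target.uniqueMDiffOn
  have h2 : ContMDiffAt 𝓘(ℝ, E4) 𝓘(ℝ, E4).tangent ∞
      (fun y => (⟨y, v⟩ : TangentBundle 𝓘(ℝ, E4) E4)) z :=
    contMDiffAt_vectorSpace_iff_contDiffAt.2 contDiffAt_const
  have h3 := (h1.contMDiffAt (x := ⟨z, v⟩) ((e.open_target.preimage
    (FiberBundle.continuous_proj E4 (TangentSpace 𝓘(ℝ, E4)))).mem_nhds hz)).comp z h2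
  refine h3.congr_of_eventuallyEq ?_
  filter_upwards [e.open_target.mem_nhds hz] with y hy
  simp only [Function.comp, tangentMapWithin, mfderivWithin_of_isOpen e.open_target hy]

/-- The image of the velocity under a chart is smooth. -/
theorem Observer.contDiffAt_comp {g : LorentzMetric M} (u : Observer g) (he : e ∈ charts M)
    (hz : z ∈ e.target) : ContDiffAt ℝ ∞
      (fun y => (mfderiv 𝓘(ℝ, E4) 𝓘(ℝ, E4) e (e.symm y) (u.vel (e.symm y)) : E4)) z := by
  have : IsManifold 𝓘(ℝ, E4) 1 M := IsManifold.of_le (n := ∞) (by norm_num)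
  have h1 := (contMDiffOn_of_mem_maximalAtlas he).contMDiffOn_tangentMapWithin
    (m := ∞) (by simp) e.open_source.uniqueMDiffOn
  have hs := contMDiffAt_symm_of_mem_maximalAtlas he hz
  have h2 := (u.contMDiff (e.symm z)).comp z hs
  have h3 := (h1.contMDiffAt (x := ⟨e.symm z, u.vel (e.symm z)⟩) ((e.open_source.preimage
    (FiberBundle.continuous_proj E4 (TangentSpace 𝓘(ℝ, E4)))).mem_nhds (e.map_target hz))).comp z h2
  refine (contMDiffAt_vectorSpace_iff_contDiffAt (V := fun y =>
    (mfderiv 𝓘(ℝ, E4) 𝓘(ℝ, E4) e (e.symm y) (u.vel (e.symm y)) : E4))).1 (h3.congr_of_eventuallyEq ?_)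
  filter_upwards [e.open_target.mem_nhds hz] with y hy
  simp only [Function.comp, tangentMapWithin,
    mfderivWithin_of_isOpen e.open_source (e.map_target hy)]
  exact congrArg (fun p => (⟨p, (mfderiv 𝓘(ℝ, E4) 𝓘(ℝ, E4) e (e.symm y) (u.vel (e.symm y)) : E4)⟩ :
    TangentBundle 𝓘(ℝ, E4) E4)) (e.right_inv hy).symm

/-- The components are the smooth bilinear section g, pulled back by the inverse chart, evaluated on
smooth coordinate fields. -/
theorem LorentzMetric.contDiffAt_comp (g : LorentzMetric M) (he : e ∈ charts M)
    (hz : z ∈ e.target) (i j : Fin 4) : ContDiffAt ℝ ∞ (fun y => g.comp e y i j) z := by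
  have hs := contMDiffAt_symm_of_mem_maximalAtlas he hz
  have h1 := (g.contMDiff (e.symm z)).comp z hs
  have h2 := ContMDiffAt.clm_bundle_apply₂ (E₃ := Bundle.Trivial M ℝ) h1
    (contMDiffAt_coordVector he hz (EuclideanSpace.single i 1))
    (contMDiffAt_coordVector he hz (EuclideanSpace.single j 1))
  rw [contMDiffAt_totalSpace] at h2
  exact h2.2.contDiffAt

/-- The scalar product in terms of components. -/
theorem LorentzMetric.val_eq_sum (g : LorentzMetric M) (he : e ∈ charts M) (hz : z ∈ e.target)
    (v w : TangentSpace 𝓘(ℝ, E4) (e.symm z)) :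
    g.val (e.symm z) v w = ∑ a, ∑ b,
      (show E4 from mfderiv 𝓘(ℝ, E4) 𝓘(ℝ, E4) e (e.symm z) v) a * g.comp e z a b
        * (show E4 from mfderiv 𝓘(ℝ, E4) 𝓘(ℝ, E4) e (e.symm z) w) b := by
  -- The coefficients are abstracted because the actual ones mention v and w, which would otherwise
  -- be rewritten as well.
  have key : ∀ (α β : Fin 4 → ℝ), v = ∑ a, α a • mfderiv 𝓘(ℝ, E4) 𝓘(ℝ, E4) e.symm z
      (EuclideanSpace.single a (1 : ℝ) : E4) → w = ∑ a, β a • mfderiv 𝓘(ℝ, E4) 𝓘(ℝ, E4) e.symm z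
      (EuclideanSpace.single a (1 : ℝ) : E4) →
      g.val (e.symm z) v w = ∑ a, ∑ b, α a * g.comp e z a b * β b := by
    intro α β hv hw
    rw [hv, hw]
    simp only [map_sum, map_smul, _root_.sum_apply, _root_.smul_apply, smul_eq_mul,
      Finset.mul_sum]
    rw [Finset.sum_comm]
    refine Finset.sum_congr rfl fun a _ => Finset.sum_congr rfl fun b _ => ?_
    rw [LorentzMetric.comp, Matrix.of_apply]
    ring
  exact key _ _ (eq_sum_coordVector he hz v) (eq_sum_coordVector he hz w)

/-- The orthonormal basis supplied by the signature, read in the chart, shows that det g ≠ 0 and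
provides the starting frame that is rotated onto u. -/
theorem Observer.observerAt {g : LorentzMetric M} (u : Observer g) (he : e ∈ charts M)
    (hz : z ∈ e.target) : ObserverAt (g.comp e) (u.comp e) z := by
  obtain ⟨b, hb⟩ := g.signature (e.symm z)
  have hR : (Matrix.of fun a i => (show E4 from mfderiv 𝓘(ℝ, E4) 𝓘(ℝ, E4) e (e.symm z) (b i)) a)ᵀ
      * g.comp e z
      * (Matrix.of fun a i => (show E4 from mfderiv 𝓘(ℝ, E4) 𝓘(ℝ, E4) e (e.symm z) (b i)) a)
      = Matrix.diagonal sgn := by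
    ext i j
    have hs : (Matrix.diagonal sgn : Matrix (Fin 4) (Fin 4) ℝ) i j
      = Matrix.diagonal ![(-1 : ℝ), 1, 1, 1] i j := by
      congr 2
      funext i
      fin_cases i <;> rfl
    rw [hs, ← hb i j, g.val_eq_sum he hz]
    simp only [Matrix.mul_apply, Matrix.transpose_apply, Matrix.of_apply, Finset.sum_mul]
    rw [Finset.sum_comm]
  refine ⟨⟨fun i j => g.contDiffAt_comp he hz i j, Eventually.of_forall fun y => ?_, ?_⟩,
    fun a => ?_, exists_isFrame hR ?_⟩
  · ext i j
    exact g.symm _ _ _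
  · intro h
    have := congrArg Matrix.det hR
    rw [Matrix.det_mul, Matrix.det_mul, h, mul_zero, zero_mul, det_diagonal_sgn] at this
    norm_num at this
  · exact (contDiffAt_euclidean.1 (u.contDiffAt_comp he hz)) a
  · rw [← u.unit (e.symm z), g.val_eq_sum he hz]
    rfl

end Manifold

end

/-! ### Vacuum metrics and the statement on the manifold -/

noncomputable section

open Filter Topology Matrix

section Manifold

attribute [local instance] chartedSpaceSelf

theorem nabla2_eq_zero {g : E4 → Matrix (Fin 4) (Fin 4) ℝ} {A : E4 → Fin 4 → Fin 4 → ℝ} {y : E4}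
    (h : ∀ᶠ z in 𝓝 y, ∀ a b, A z a b = 0) (c a b : Fin 4) : nabla2 g A y c a b = 0 := by
  have h1 : (fun z => A z a b) =ᶠ[𝓝 y] fun _ => 0 := h.mono fun z hz => hz a b
  simp [nabla2, pd, h1.fderiv_eq, h.self_of_nhds]

variable {M : Type*} [TopologicalSpace M] [ChartedSpace E4 M] [IsManifold 𝓘(ℝ, E4) ∞ M]
  {g : LorentzMetric M}

/-- The Cotton tensor of a vacuum metric vanishes. -/
theorem IsVacuum.isCottonZero (h : IsVacuum g) : IsCottonZero g := by
  intro e he y hy a b c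
  have h1 : ∀ᶠ z in 𝓝 y, ∀ a b, schouten (g.comp e) z a b = 0 := by
    filter_upwards [e.open_target.mem_nhds hy] with z hz a b
    simp [schouten, scalarCurv, h e he z hz]
  rw [cotton, nabla2_eq_zero h1, nabla2_eq_zero h1, sub_zero]

/-- The conditions on the shear and the vorticity of an observer who measures a vanishing electric
Weyl field. -/
theorem Observer.conditions (u : Observer g) (hC : IsCottonZero g) (hE : ElectricVanishes u)
    {e : OpenPartialHomeomorph M E4} (he : e ∈ charts M) {x : M} (hx : x ∈ e.source) :
    u.trCurlShearSq e x - 3 * u.trVortSq e x = 2 * u.curlShearVort e x ∧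
      (MagneticNonzeroAt u x →
        0 < u.trVortSq e x ∧ u.trVortSq e x < u.trCurlShearSq e x) := by
  have hn := e.open_target.mem_nhds (e.map_source hx)
  have h := conditions_of_electricWeyl_eq_zero (g := g.comp e) (u := u.comp e) (y := e x)
    (mem_of_superset hn fun z hz => u.observerAt he hz)
    (mem_of_superset hn fun z hz => hC e he z hz)
    (mem_of_superset hn fun z hz => hE e he z hz)
  exact ⟨h.1, fun hM => h.2 (hM e he hx)⟩

end Manifold

end

end GravMag

theorem theorem2 {M : Type*} [TopologicalSpace M] [ChartedSpace GravMag.E4 M]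
    [IsManifold 𝓘(ℝ, GravMag.E4) ∞ M] (g : GravMag.LorentzMetric M) (u : GravMag.Observer g) :
    -- the conditions on the observer
    (GravMag.IsCottonZero g → GravMag.ElectricVanishes u →
      ∀ e ∈ GravMag.charts M, ∀ x ∈ e.source,
        u.trCurlShearSq e x - 3 * u.trVortSq e x = 2 * u.curlShearVort e x ∧
        (GravMag.MagneticNonzeroAt u x →
          0 < u.trVortSq e x ∧ u.trVortSq e x < u.trCurlShearSq e x)) ∧
    -- the non-existence statement
    ((GravMag.IsVacuum g ∨ GravMag.IsCottonZero g) →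
      (∃ e ∈ GravMag.charts M, ∃ x ∈ e.source,
        u.trCurlShearSq e x - 3 * u.trVortSq e x ≠ 2 * u.curlShearVort e x ∨
        0 ≥ u.trVortSq e x ∨
        u.trVortSq e x ≥ u.trCurlShearSq e x) →
      ¬ GravMag.IsPurelyMagnetic u) := by
  refine ⟨fun hC hE e he x hx => u.conditions hC hE he hx, ?_⟩
  rintro hg ⟨e, he, x, hx, h⟩ ⟨hE, hH⟩
  obtain ⟨h1, h2⟩ := u.conditions (hg.elim (fun h => h.isCottonZero) id) hE he hx
  obtain ⟨h3, h4⟩ := h2 (hH x)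
  rcases h with h | h | h
  · exact h h1
  · exact absurd h3 (not_lt.2 h)
  · exact absurd h4 (not_lt.2 h)
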